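/- Let $M$ be a smooth manifold (Hausdorff, $\sigma$-compact) of dimension $d$, let $\mathcal F_a(M)$ ($a\in\mathbb R$) be the space of smooth densities $s(x)|Dx|^a$ of weight $a$, and let $\mathcal F(M)=\bigoplus_a\mathcal F_a(M)$ be the algebra of densities. Let $\hat w$ be the weight operator ($\hat w s=as$ for $s\in\mathcal F_a(M)$), and let $\mathcal L_K$ be the Lie derivative of densities along a vector field $K$, with $\mathrm{ad}_K D=\mathcal L_K D-D\mathcal L_K$. On compactly supported densities put $\langle s,t\rangle=\int_M st$ if the weights of $s$ and $t$ add up to $1$, and $\langle s,t\rangle=0$ otherwise; $D^*$ denotes the differential operator on $\mathcal F(M)$ that is adjoint to $D$ for this pairing. Let $\mathcal D^{(n)}_\lambda(M)$ be the space of differential operators of order $\le n$ on $\mathcal F_\lambda(M)$, and let $\mathcal D^{(n)}(\widehat M)$ be the space of differential operators of weight $0$ and order $\le n$ on the algebra $\mathcal F(M)$ that depend polynomially on the weight ($L$ has order $\le n$ if all its $(n+1)$-fold iterated commutators with densities vanish). Let $\mathcal V^{(0)}(M)$ be the space of linear operators on $\mathcal F(M)$ that commute with multiplication by functions on $M$;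 inductively, $D\in\mathcal V^{(k)}(M)$ if $[D,f]\in\mathcal V^{(k-1)}(M)$ for every function $f$ on $M$. Put $\mathcal V^{(-1)}(M)=\mathcal V^{(-2)}(M)=0$. Let $n\ge 0$ and $\lambda\ne\frac12$. A regular pencil lifting of $\mathcal D^{(n)}_\lambda(M)$ is a map $\widehat\Pi:\mathcal D^{(n)}_\lambda(M)\to\mathcal D^{(n)}(\widehat M)$ such that $\widehat\Pi(\Delta)$ restricts to $\Delta$ on $\mathcal F_\lambda(M)$; it is equivariant for a set of vector fields if $\mathrm{ad}_K\widehat\Pi(\Delta)=\widehat\Pi(\mathrm{ad}_K\Delta)$ for all its elements $K$ and all $\Delta$. For a volume form $\boldsymbol\rho$ (a positive smooth density of weight $1$) let $\widehat P(\Delta)$ be the operator on $\mathcal F(M)$ equal to $\boldsymbol\rho^{a-\lambda}\circ\Delta\circ\boldsymbol\rho^{\lambda-a}$ on $\mathcal F_a(M)$ for every $a$. For $b,c_1,\dots,c_n,e_1,\dots,e_n\in\mathbb R$ put $$\widehat\Pi(\Delta)=\bigl(1-b(\hat w-\lambda)\bigr)\widehat P(\Delta)+(-1)^n b(\hat w-\lambda)\widehat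 P(\Delta)^*+\sum_{k=1}^n c_k(\hat w-\lambda)^k\,\widehat P(\Delta)(1)+\sum_{k=1}^n e_k(\hat w-\lambda)^k\,\widehat P(\Delta)^*(1),$$ where $\widehat P(\Delta)(1)$ and $\widehat P(\Delta)^*(1)$ act by multiplication. Then: 1. For every volume form $\boldsymbol\rho$, each $\widehat P(\Delta)$ with $\Delta\in\mathcal D^{(n)}_\lambda(M)$ has a unique adjoint, and every member of this $(2n+1)$-parameter family is a regular pencil lifting of $\mathcal D^{(n)}_\lambda(M)$ that is equivariant with respect to the Lie algebra $\mathrm{sdiff}_{\boldsymbol\rho}(M)$ of vector fields $K$ with $\mathcal L_K\boldsymbol\rho=0$. The family contains (for $b=\frac1{1-2\lambda}$ and all $c_k=e_k=0$) the distinguished lifting $$\widehat\Pi^{\rm disting}(\Delta)=\frac{\hat w+\lambda-1}{2\lambda-1}\widehat P(\Delta)+(-1)^n\frac{\lambda-\hat w}{2\lambda-1}\widehat P(\Delta)^*,$$ and $\bigl(\widehat\Pi^{\rm disting}(\Delta)\bigr)^*=(-1)^n\,\widehat\Pi^{\rm disting}(\Delta)$ for all $\Delta$, that is, the distinguished lifting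 is self-adjoint for even $n$ and anti-self-adjoint for odd $n$. 2. Modulo $\mathcal V^{(n-2)}(M)$ the distinguished lifting does not depend on the volume form: for any two volume forms the two operators $\widehat\Pi^{\rm disting}(\Delta)$ differ by an element of $\mathcal V^{(n-2)}(M)$, for every $\Delta\in\mathcal D^{(n)}_\lambda(M)$. 3. The map from $\mathcal D^{(n)}_\lambda(M)$ to the quotient modulo $\mathcal V^{(n-2)}(M)$ induced by the distinguished lifting is equivariant with respect to the Lie algebra $\mathrm{diff}(M)$ of all vector fields: $\mathrm{ad}_K\widehat\Pi^{\rm disting}(\Delta)-\widehat\Pi^{\rm disting}(\mathrm{ad}_K\Delta)\in\mathcal V^{(n-2)}(M)$. 4. Let $n\ge2$. If a member $\widehat\Pi$ of the family induces a $\mathrm{diff}(M)$-equivariant map to the quotient modulo $\mathcal V^{(n-2)}(M)$, then this induced map is the one induced by the distinguished lifting: $\widehat\Pi(\Delta)-\widehat\Pi^{\rm disting}(\Delta)\in\mathcal V^{(n-2)}(M)$ for all $\Delta\in\mathcal D^{(n)}_\lambda(M)$. -/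

import Mathlib

open scoped Manifold ContDiff DirectSum

noncomputable section

namespace PencilLifting

open IsManifold

/-- The model space `ℝ^d`. -/
abbrev Euc (d : ℕ) := EuclideanSpace ℝ (Fin d)

/-! ### Calculus facts needed for the Lie derivative of densities -/

theorem contDiff_det (d : ℕ) : ContDiff ℝ ∞ (fun A : Euc d →L[ℝ] Euc d => A.det) := by
  have h : ∀ A : Euc d →L[ℝ] Euc d, A.det =
      (LinearMap.toMatrix (EuclideanSpace.basisFun (Fin d) ℝ).toBasis
        (EuclideanSpace.basisFun (Fin d) ℝ).toBasis A.toLinearMap).det := by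
    intro A
    rw [LinearMap.det_toMatrix]
  simp_rw [h, Matrix.det_apply]
  refine ContDiff.sum fun σ _ => ContDiff.const_smul _ (contDiff_prod fun i _ => ?_)
  simp only [LinearMap.toMatrix_apply]
  simp
  fun_prop

theorem fderiv_det {d : ℕ} (A A' H : Euc d →L[ℝ] Euc d) (h1 : A.comp A' = ContinuousLinearMap.id ℝ _)  :
    fderiv ℝ (fun A : Euc d →L[ℝ] Euc d => A.det) A H
      = A.det * LinearMap.trace ℝ (Euc d) (A'.comp H).toLinearMap := by
  have hd : HasFDerivAt (fun A : Euc d →L[ℝ] Euc d => A.det)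
      (fderiv ℝ (fun A : Euc d →L[ℝ] Euc d => A.det) A) A :=
    ((contDiff_det d).differentiable (by simp) A).hasFDerivAt
  have hl : HasDerivAt (fun t : ℝ => A + t • H) H 0 := by
    simpa using ((hasDerivAt_id (0:ℝ)).smul_const H).const_add A
  have h2 : HasDerivAt (fun t : ℝ => (A + t • H).det)
      (fderiv ℝ (fun A : Euc d →L[ℝ] Euc d => A.det) A H) 0 := by
    have e : A = A + (0:ℝ) • H := 
      (add_zero A).symm.trans (congrArg (fun z => A + z) (zero_smul ℝ H).symm)
    have h := HasFDerivAt.comp_hasDerivAt_of_eq (0:ℝ) hd hl e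
    exact h
  have h3 : ∀ t : ℝ, (A + t • H).det = A.det * (ContinuousLinearMap.id ℝ _ + t • (A'.comp H)).det := by
    intro t
    have : A + t • H = A.comp (ContinuousLinearMap.id ℝ _ + t • (A'.comp H)) := by
      rw [ContinuousLinearMap.comp_add, ContinuousLinearMap.comp_smul, ← ContinuousLinearMap.comp_assoc, h1]
      ext; simp
    rw [this]
    exact LinearMap.det_comp A.toLinearMap _
  obtain ⟨N, hN⟩ : ∃ N, N = A'.comp H := ⟨_, rfl⟩
  rw [← hN] at h3 ⊢
  let b := (EuclideanSpace.basisFun (Fin d) ℝ).toBasis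
  have h4 : ∀ t : ℝ, (ContinuousLinearMap.id ℝ _ + t • N).det
      = (1 + t • LinearMap.toMatrix b b N.toLinearMap).det := by
    intro t
    rw [ContinuousLinearMap.det, ← LinearMap.det_toMatrix b]
    congr 1
    simp
  have h5 : HasDerivAt (fun t : ℝ => (A + t • H).det)
      (A.det * LinearMap.trace ℝ (Euc d) N.toLinearMap) 0 := by
    simp_rw [h3, h4]
    refine HasDerivAt.const_mul _ ?_
    rw [funext fun t : ℝ => Matrix.det_one_add_smul t (LinearMap.toMatrix b b N.toLinearMap)]
    rw [LinearMap.trace_eq_matrix_trace ℝ b]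
    obtain ⟨T, hT⟩ : ∃ T, T = (LinearMap.toMatrix b b N.toLinearMap).trace := ⟨_, rfl⟩
    rw [← hT]
    generalize (Polynomial.divX (Polynomial.divX (R := ℝ) _)) = p
    have e1 : HasDerivAt (fun t : ℝ => 1 + T * t) T 0 := by
      simpa using ((hasDerivAt_id (0:ℝ)).const_mul T).const_add 1
    have e2 : HasDerivAt (fun t : ℝ => p.eval t * t ^ 2) 0 0 := by
      have := (p.hasDerivAt (0:ℝ)).mul ((hasDerivAt_id (0:ℝ)).pow 2)
      refine this.congr_deriv ?_
      simp
    refine (e1.add e2).congr_deriv (add_zero T)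
  exact h2.unique h5

theorem fderiv_abs_det_rpow {d : ℕ} {τ V W : Euc d → Euc d} {U : Set (Euc d)} (hU : IsOpen U)
    (hτ : ContDiffOn ℝ ∞ τ U) {y : Euc d} (hy : y ∈ U) (A' : Euc d →L[ℝ] Euc d)
    (h1 : (fderiv ℝ τ y).comp A' = ContinuousLinearMap.id ℝ _)
    (h2 : A'.comp (fderiv ℝ τ y) = ContinuousLinearMap.id ℝ _)
    (hdet : (fderiv ℝ τ y).det ≠ 0)
    (hV : DifferentiableAt ℝ V y) (hW : DifferentiableAt ℝ W (τ y))
    (hVW : ∀ z ∈ U, W (τ z) = fderiv ℝ τ z (V z)) (a : ℝ) :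
    DifferentiableAt ℝ (fun z => |(fderiv ℝ τ z).det| ^ a) y ∧
    fderiv ℝ (fun z => |(fderiv ℝ τ z).det| ^ a) y (V y) =
      a * |(fderiv ℝ τ y).det| ^ a *
        (LinearMap.trace ℝ (Euc d) (fderiv ℝ W (τ y)).toLinearMap
          - LinearMap.trace ℝ (Euc d) (fderiv ℝ V y).toLinearMap) := by
  have hUy : U ∈ nhds y := hU.mem_nhds hy
  have hτy : ContDiffAt ℝ ∞ τ y := hτ.contDiffAt hUy
  have hτ' : DifferentiableAt ℝ (fderiv ℝ τ) y :=
    (hτy.fderiv_right (m := ∞) le_rfl).differentiableAt (by simp)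
  have hτd : DifferentiableAt ℝ τ y := hτy.differentiableAt (by simp)
  have hsymm : IsSymmSndFDerivAt ℝ τ y := hτy.isSymmSndFDerivAt (by
    rw [minSmoothness_of_isRCLikeNormedField]
    exact (WithTop.coe_le_coe.mpr le_top : ((2 : ℕ∞) : WithTop ℕ∞) ≤ ((⊤ : ℕ∞) : WithTop ℕ∞)))
  -- derivative of the determinant
  have hD : HasFDerivAt (fun A : Euc d →L[ℝ] Euc d => A.det)
      (fderiv ℝ (fun A : Euc d →L[ℝ] Euc d => A.det) (fderiv ℝ τ y)) (fderiv ℝ τ y) :=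
    ((contDiff_det d).differentiable (by simp) _).hasFDerivAt
  have hJ := hD.comp y hτ'.hasFDerivAt
  obtain ⟨B, hB⟩ : ∃ B, B = fderiv ℝ (fderiv ℝ τ) y := ⟨_, rfl⟩
  rw [← hB] at hJ
  have hJV : (fderiv ℝ (fun A : Euc d →L[ℝ] Euc d => A.det) (fderiv ℝ τ y)) (B (V y))
      = (fderiv ℝ τ y).det * LinearMap.trace ℝ (Euc d) (A'.comp (B (V y))).toLinearMap :=
    fderiv_det _ _ _ h1
  -- differentiate the transformation law of the vector field
  have hL : HasFDerivAt (fun z => W (τ z)) ((fderiv ℝ W (τ y)).comp (fderiv ℝ τ y)) y :=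
    hW.hasFDerivAt.comp y hτd.hasFDerivAt
  have hR := hτ'.hasFDerivAt.clm_apply hV.hasFDerivAt
  have hR' := hR.congr_of_eventuallyEq (f₁ := fun z => W (τ z))
    (Filter.eventually_of_mem hUy fun z hz => hVW z hz)
  have hE := hL.unique hR'
  rw [← hB] at hE
  have hflip : B.flip (V y) = B (V y) := by
    ext1 w
    rw [ContinuousLinearMap.flip_apply, hB]
    exact hsymm w (V y)
  rw [hflip] at hE
  have htr : LinearMap.trace ℝ (Euc d) (fderiv ℝ W (τ y)).toLinearMap
      = LinearMap.trace ℝ (Euc d) (A'.comp (B (V y))).toLinearMap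
        + LinearMap.trace ℝ (Euc d) (fderiv ℝ V y).toLinearMap := by
    have e1 : A'.comp ((fderiv ℝ W (τ y)).comp (fderiv ℝ τ y))
        = fderiv ℝ V y + A'.comp (B (V y)) := by
      rw [hE, ContinuousLinearMap.comp_add, ← ContinuousLinearMap.comp_assoc, h2,
        ContinuousLinearMap.id_comp]
    have e2 : LinearMap.trace ℝ (Euc d)
        (A'.comp ((fderiv ℝ W (τ y)).comp (fderiv ℝ τ y))).toLinearMap
        = LinearMap.trace ℝ (Euc d) (fderiv ℝ W (τ y)).toLinearMap := by
      have := LinearMap.trace_mul_comm ℝ A'.toLinearMap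
        ((fderiv ℝ W (τ y)).comp (fderiv ℝ τ y)).toLinearMap
      refine this.trans ?_
      congr 1
      ext1 w
      have := DFunLike.congr_fun h1 w
      change fderiv ℝ W (τ y) (fderiv ℝ τ y (A' w)) = _
      change fderiv ℝ τ y (A' w) = w at this
      rw [this]; rfl
    rw [← e2, e1, add_comm]
    exact map_add (LinearMap.trace ℝ (Euc d)) (A'.comp (B (V y))).toLinearMap _
  -- absolute value and power
  have habs := (hasDerivAt_abs hdet).comp_hasFDerivAt y hJ
  have hpow := habs.rpow_const (p := a) (Or.inl (abs_ne_zero.mpr hdet))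
  refine ⟨hpow.differentiableAt, ?_⟩
  have := hpow.fderiv
  rw [show (fun z => |(fderiv ℝ τ z).det| ^ a) = (fun x => (((fun x => |x|) ∘
    (fun A : Euc d →L[ℝ] Euc d => A.det) ∘ fderiv ℝ τ) x) ^ a) from rfl, this]
  rw [htr]
  simp only [smul_apply, ContinuousLinearMap.comp_apply, hJV, smul_eq_mul,
    Function.comp_apply]
  obtain ⟨T, hT⟩ : ∃ T, T = LinearMap.trace ℝ (Euc d) (A'.comp (B (V y))).toLinearMap := ⟨_, rfl⟩
  rw [← hT]
  have hp : 0 < |(fderiv ℝ τ y).det| := abs_pos.mpr hdet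
  rw [show |(fderiv ℝ τ y).det| ^ a = |(fderiv ℝ τ y).det| ^ (a - 1) * |(fderiv ℝ τ y).det| by
    rw [← Real.rpow_add_one hp.ne']; ring_nf]
  have hs : |(fderiv ℝ τ y).det| = SignType.sign ((fderiv ℝ τ y).det) * (fderiv ℝ τ y).det :=
    (sign_mul_self _).symm
  conv_rhs => rw [hs]
  conv_lhs => rw [hs]
  ring

/-! ### Densities -/

variable {d : ℕ} {M : Type*} [TopologicalSpace M] [ChartedSpace (Euc d) M]

/-- A point in a local coordinate system: a smooth chart `φ` of `M` (any chart of the maximal smooth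
atlas) together with a coordinate vector `y` in the range of `φ`. A density is given by its
coefficients in all local coordinate systems, that is, by a real function on this type. -/
abbrev LocalPoint (d : ℕ) (M : Type*) [TopologicalSpace M] [ChartedSpace (Euc d) M] : Type _ :=
  {p : OpenPartialHomeomorph M (Euc d) × Euc d //
    p.1 ∈ maximalAtlas (𝓡 d) ∞ M ∧ p.2 ∈ p.1.target}

open Classical in
/-- The coefficient `s_φ(y)` in the coordinates `φ`, extended by `0` outside the range of `φ`. -/
def localCoeff (s : LocalPoint d M → ℝ) (φ : OpenPartialHomeomorph M (Euc d)) (y : Euc d) : ℝ :=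
  if h : φ ∈ maximalAtlas (𝓡 d) ∞ M ∧ y ∈ φ.target then s ⟨(φ, y), h⟩ else 0

theorem coeff_apply (s : LocalPoint d M → ℝ) {φ : OpenPartialHomeomorph M (Euc d)} {y : Euc d}
    (hφ : φ ∈ maximalAtlas (𝓡 d) ∞ M) (hy : y ∈ φ.target) : localCoeff s φ y = s ⟨(φ, y), hφ, hy⟩ :=
  dif_pos ⟨hφ, hy⟩

/-- The change of coordinates `y ↦ ψ (φ⁻¹ y)`. -/
abbrev transition (φ ψ : OpenPartialHomeomorph M (Euc d)) : Euc d → Euc d := ψ ∘ φ.symm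

/-- `s` is the family of coefficients of a smooth density of weight `a`, `s_φ(y) |Dy|^a`: for a
change of coordinates `z = z(y)` from `φ` to `ψ` one has `s_φ(y) = |det (∂z/∂y)|^a s_ψ(z(y))`. -/
structure IsDensity (a : ℝ) (s : LocalPoint d M → ℝ) : Prop where
  transform : ∀ φ ∈ maximalAtlas (𝓡 d) ∞ M, ∀ ψ ∈ maximalAtlas (𝓡 d) ∞ M,
    ∀ y ∈ (φ.symm.trans ψ).source,
      localCoeff s φ y = |(fderiv ℝ (transition φ ψ) y).det| ^ a * localCoeff s ψ (transition φ ψ y)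
  smooth : ∀ φ ∈ maximalAtlas (𝓡 d) ∞ M, ContDiffOn ℝ ∞ (localCoeff s φ) φ.target

/-- The space `F_a(M)` of smooth densities of weight `a`. -/
def Density (d : ℕ) (M : Type*) [TopologicalSpace M] [ChartedSpace (Euc d) M] (a : ℝ) :
    Submodule ℝ (LocalPoint d M → ℝ) where
  carrier := {s | IsDensity a s}
  zero_mem' := by
    have h : ∀ φ : OpenPartialHomeomorph M (Euc d), localCoeff (0 : LocalPoint d M → ℝ) φ = fun _ => 0 := by
      intro φ; ext y; simp [localCoeff]
    exact ⟨by simp [h], fun φ _ => by rw [h]; exact contDiffOn_const⟩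
  add_mem' := by
    intro s t hs ht
    have h : ∀ φ, localCoeff (s + t) φ = fun y => localCoeff s φ y + localCoeff t φ y := by
      intro φ; ext y; unfold localCoeff; split_ifs <;> simp
    refine ⟨fun φ hφ ψ hψ y hy => ?_, fun φ hφ => ?_⟩
    · simp only [h, hs.transform φ hφ ψ hψ y hy, ht.transform φ hφ ψ hψ y hy]; ring
    · rw [h]; exact (hs.smooth φ hφ).add (ht.smooth φ hφ)
  smul_mem' := by
    intro c s hs
    have h : ∀ φ, localCoeff (c • s) φ = fun y => c * localCoeff s φ y := by
      intro φ; ext y; unfold localCoeff; split_ifs <;> simp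
    refine ⟨fun φ hφ ψ hψ y hy => ?_, fun φ hφ => ?_⟩
    · simp only [h, hs.transform φ hφ ψ hψ y hy]; ring
    · rw [h]; exact contDiffOn_const.mul (hs.smooth φ hφ)

theorem transition_contDiffOn {φ ψ : OpenPartialHomeomorph M (Euc d)}
    (hφ : φ ∈ maximalAtlas (𝓡 d) ∞ M) (hψ : ψ ∈ maximalAtlas (𝓡 d) ∞ M) :
    ContDiffOn ℝ ∞ (transition φ ψ) (φ.symm.trans ψ).source := by
  have := (contDiffGroupoid ∞ (𝓡 d)).compatible_of_mem_maximalAtlas hφ hψ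
  exact contMDiffOn_iff_contDiffOn.mp (contMDiffOn_of_mem_contDiffGroupoid this)

theorem coeff_mul (s t : LocalPoint d M → ℝ) (φ : OpenPartialHomeomorph M (Euc d)) :
    localCoeff (s * t) φ = fun y => localCoeff s φ y * localCoeff t φ y := by
  ext y; unfold localCoeff; split_ifs <;> simp

theorem transition_deriv {φ ψ : OpenPartialHomeomorph M (Euc d)}
    (hφ : φ ∈ maximalAtlas (𝓡 d) ∞ M) (hψ : ψ ∈ maximalAtlas (𝓡 d) ∞ M) {y : Euc d}
    (hy : y ∈ (φ.symm.trans ψ).source) :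
    (fderiv ℝ (transition φ ψ) y).comp (fderiv ℝ (transition ψ φ) (transition φ ψ y))
        = ContinuousLinearMap.id ℝ _ ∧
      (fderiv ℝ (transition ψ φ) (transition φ ψ y)).comp (fderiv ℝ (transition φ ψ) y)
        = ContinuousLinearMap.id ℝ _ := by
  have hy1 : y ∈ φ.target ∧ φ.symm y ∈ ψ.source := by simpa using hy
  have hz : transition φ ψ y ∈ (ψ.symm.trans φ).source := by
    simp [transition, hy1.2, hy1.1]
  have d1 : DifferentiableAt ℝ (transition φ ψ) y :=
    ((transition_contDiffOn hφ hψ).contDiffAt ((φ.symm.trans ψ).open_source.mem_nhds hy)).differentiableAt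
      (by simp)
  have d2 : DifferentiableAt ℝ (transition ψ φ) (transition φ ψ y) :=
    ((transition_contDiffOn hψ hφ).contDiffAt ((ψ.symm.trans φ).open_source.mem_nhds hz)).differentiableAt
      (by simp)
  have back : transition ψ φ (transition φ ψ y) = y := by simp [transition, hy1.2, hy1.1]
  constructor
  · have d1' : DifferentiableAt ℝ (transition φ ψ) (transition ψ φ (transition φ ψ y)) := by rwa [back]
    have h := (d1'.hasFDerivAt.comp _ d2.hasFDerivAt)
    rw [back] at h
    refine h.unique ((hasFDerivAt_id (transition φ ψ y)).congr_of_eventuallyEq ?_)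
    filter_upwards [(ψ.symm.trans φ).open_source.mem_nhds hz] with w hw
    have hw1 : w ∈ ψ.target ∧ ψ.symm w ∈ φ.source := by simpa using hw
    simp [transition, hw1.1, hw1.2]
  · have h := (d2.hasFDerivAt.comp _ d1.hasFDerivAt)
    refine h.unique ((hasFDerivAt_id y).congr_of_eventuallyEq ?_)
    filter_upwards [(φ.symm.trans ψ).open_source.mem_nhds hy] with w hw
    have hw1 : w ∈ φ.target ∧ φ.symm w ∈ ψ.source := by simpa using hw
    simp [transition, hw1.1, hw1.2]

theorem transition_det_ne_zero {φ ψ : OpenPartialHomeomorph M (Euc d)}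
    (hφ : φ ∈ maximalAtlas (𝓡 d) ∞ M) (hψ : ψ ∈ maximalAtlas (𝓡 d) ∞ M) {y : Euc d}
    (hy : y ∈ (φ.symm.trans ψ).source) : (fderiv ℝ (transition φ ψ) y).det ≠ 0 := by
  intro h
  have h1 := congrArg ContinuousLinearMap.det (transition_deriv hφ hψ hy).1
  have h2 : ((fderiv ℝ (transition φ ψ) y).comp (fderiv ℝ (transition ψ φ) (transition φ ψ y))).det
      = (fderiv ℝ (transition φ ψ) y).det * (fderiv ℝ (transition ψ φ) (transition φ ψ y)).det :=
    LinearMap.det_comp _ _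
  rw [h2, h, zero_mul] at h1
  have h3 : (ContinuousLinearMap.id ℝ (Euc d)).det = 1 := LinearMap.det_id
  rw [h3] at h1
  exact zero_ne_one h1

/-- The product of densities of weights `a` and `b` is a density of weight `a + b`. -/
instance : SetLike.GradedMonoid (Density d M) where
  one_mem := by
    have h : ∀ φ ∈ maximalAtlas (𝓡 d) ∞ M, ∀ y ∈ φ.target,
      localCoeff (1 : LocalPoint d M → ℝ) φ y = 1 := fun φ hφ y hy => coeff_apply _ hφ hy
    refine ⟨fun φ hφ ψ hψ y hy => ?_, fun φ hφ => contDiffOn_const.congr (h φ hφ)⟩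
    have hy1 : y ∈ φ.target ∧ φ.symm y ∈ ψ.source := by simpa using hy
    rw [h φ hφ y hy1.1, h ψ hψ (transition φ ψ y) (ψ.map_source hy1.2)]; simp
  mul_mem := by
    intro a b s t hs ht
    refine ⟨fun φ hφ ψ hψ y hy => ?_, fun φ hφ => ?_⟩
    · simp only [coeff_mul, hs.transform φ hφ ψ hψ y hy, ht.transform φ hφ ψ hψ y hy]
      rw [Real.rpow_add (abs_pos.mpr (transition_det_ne_zero hφ hψ hy))]; ring
    · rw [coeff_mul]; exact (hs.smooth φ hφ).mul (ht.smooth φ hφ)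

/-- The algebra of densities `F(M) = ⨁_a F_a(M)`. -/
def DensityAlgebra (d : ℕ) (M : Type*) [TopologicalSpace M] [ChartedSpace (Euc d) M] : Type _ :=
  ⨁ a : ℝ, Density d M a

instance : CommRing (DensityAlgebra d M) :=
  inferInstanceAs (CommRing (⨁ a : ℝ, Density d M a))

instance : Algebra ℝ (DensityAlgebra d M) :=
  inferInstanceAs (Algebra ℝ (⨁ a : ℝ, Density d M a))

/-- The inclusion of `F_a(M)` in `F(M)`. -/
def incl (d : ℕ) (M : Type*) [TopologicalSpace M] [ChartedSpace (Euc d) M] (a : ℝ) :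
    Density d M a →ₗ[ℝ] DensityAlgebra d M :=
  DirectSum.lof ℝ ℝ (fun a => Density d M a) a

/-- The component of weight `a` of an element of `F(M)`. -/
def weightComponent (a : ℝ) : DensityAlgebra d M →ₗ[ℝ] Density d M a :=
  DirectSum.component ℝ ℝ (fun a => Density d M a) a

/-- The linear operator on `F(M)`, of weight zero, whose restriction to `F_a(M)` is `D a`. -/
def ofPencil (D : ∀ a : ℝ, Module.End ℝ (Density d M a)) : Module.End ℝ (DensityAlgebra d M) :=
  DirectSum.lmap (R := ℝ) D

theorem ofPencil_incl (D : ∀ a : ℝ, Module.End ℝ (Density d M a)) (a : ℝ) (s : Density d M a) :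
    ofPencil D (incl d M a s) = incl d M a (D a s) :=
  DirectSum.lmap_lof (R := ℝ) D a s

/-! ### Differential operators -/

/-- The operators all of whose `k`-fold iterated commutators with elements of `S` vanish. -/
def commFiltration {V : Type*} [AddCommGroup V] [Module ℝ V] (S : Set (Module.End ℝ V)) :
    ℕ → Submodule ℝ (Module.End ℝ V)
  | 0 => ⊥
  | k + 1 =>
    { carrier := {D | ∀ m ∈ S, D * m - m * D ∈ commFiltration S k}
      zero_mem' := fun m _ => by simp
      add_mem' := fun {D D'} hD hD' m hm => by
        have h : (D + D') * m - m * (D + D') = (D * m - m * D) + (D' * m - m * D') := by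
          noncomm_ring
        rw [h]; exact add_mem (hD m hm) (hD' m hm)
      smul_mem' := fun c D hD m hm => by
        rw [smul_mul_assoc, mul_smul_comm, ← smul_sub]
        exact Submodule.smul_mem _ c (hD m hm) }

/-! ### Vector fields and Lie derivatives -/

/-- Smooth vector fields on `M`. -/
abbrev VectorField (d : ℕ) (M : Type*) [TopologicalSpace M] [ChartedSpace (Euc d) M]
    [IsManifold (𝓡 d) ∞ M] : Type _ :=
  Cₛ^∞⟮𝓡 d; Euc d, (TangentSpace (𝓡 d) : M → Type _)⟯

section VF
variable [IsManifold (𝓡 d) ∞ M]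

/-- The components of the vector field `K` in the coordinates `φ`, as a function of the
coordinates. -/
def localField (K : VectorField d M) (φ : OpenPartialHomeomorph M (Euc d)) (y : Euc d) : Euc d :=
  mfderiv (𝓡 d) (𝓡 d) φ (φ.symm y) (K (φ.symm y))

theorem localField_smooth (K : VectorField d M) {φ : OpenPartialHomeomorph M (Euc d)}
    (hφ : φ ∈ maximalAtlas (𝓡 d) ∞ M) : ContDiffOn ℝ ∞ (localField K φ) φ.target := by
  have h1 : ContMDiffOn (𝓡 d) (𝓡 d).tangent ∞
      (fun y => (⟨φ.symm y, K (φ.symm y)⟩ : TangentBundle (𝓡 d) M)) φ.target :=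
    K.contMDiff_toFun.comp_contMDiffOn (contMDiffOn_symm_of_mem_maximalAtlas hφ)
  have h2 := (contMDiffOn_of_mem_maximalAtlas hφ).contMDiffOn_tangentMapWithin (m := ∞) le_rfl
    φ.open_source.uniqueMDiffOn
  have h3 := h2.comp h1 (fun y hy => φ.map_target hy)
  refine contMDiffOn_vectorSpace_iff_contDiffOn.mp (h3.congr fun y hy => ?_)
  have e : tangentMapWithin (𝓡 d) (𝓡 d) φ φ.source
      (⟨φ.symm y, K (φ.symm y)⟩ : TangentBundle (𝓡 d) M)
      = ⟨φ (φ.symm y), localField K φ y⟩ := by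
    rw [tangentMapWithin, mfderivWithin_of_mem_nhds (φ.open_source.mem_nhds (φ.map_target hy))]
    rfl
  rw [Function.comp_apply, e, φ.right_inv hy]

theorem localField_transform (K : VectorField d M) {φ ψ : OpenPartialHomeomorph M (Euc d)}
    (hφ : φ ∈ maximalAtlas (𝓡 d) ∞ M) (hψ : ψ ∈ maximalAtlas (𝓡 d) ∞ M) {y : Euc d}
    (hy : y ∈ (φ.symm.trans ψ).source) :
    localField K ψ (transition φ ψ y) = fderiv ℝ (transition φ ψ) y (localField K φ y) := by
  have hy1 : y ∈ φ.target ∧ φ.symm y ∈ ψ.source := by simpa using hy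
  have hx : ψ.symm (transition φ ψ y) = φ.symm y := ψ.left_inv hy1.2
  have hφx : φ.symm y ∈ φ.source := φ.map_target hy1.1
  unfold localField
  rw [hx]
  have dτ : DifferentiableAt ℝ (transition φ ψ) y :=
    ((transition_contDiffOn hφ hψ).contDiffAt ((φ.symm.trans ψ).open_source.mem_nhds hy)).differentiableAt
      (by simp)
  have dφ : MDifferentiableAt (𝓡 d) (𝓡 d) φ (φ.symm y) :=
    (contMDiffAt_of_mem_maximalAtlas hφ hφx).mdifferentiableAt (by simp)
  have dτ' : MDifferentiableAt (𝓡 d) (𝓡 d) (transition φ ψ) (φ (φ.symm y)) := by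
    rw [φ.right_inv hy1.1]; exact dτ.mdifferentiableAt
  have hev : ψ =ᶠ[nhds (φ.symm y)] transition φ ψ ∘ φ := by
    filter_upwards [φ.open_source.mem_nhds hφx] with z hz
    simp [transition, hz]
  have := hev.mfderiv_eq (I := 𝓡 d) (I' := 𝓡 d)
  rw [this, mfderiv_comp _ dτ' dφ, φ.right_inv hy1.1, mfderiv_eq_fderiv]
  rfl

/-- The coefficients of the Lie derivative: `K^i ∂_i s + a (∂_i K^i) s`. -/
def lieFun (K : VectorField d M) (a : ℝ) (s : LocalPoint d M → ℝ) : LocalPoint d M → ℝ :=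
  fun p => fderiv ℝ (localCoeff s p.1.1) p.1.2 (localField K p.1.1 p.1.2)
    + a * LinearMap.trace ℝ (Euc d) (fderiv ℝ (localField K p.1.1) p.1.2).toLinearMap * s p

theorem lieFun_isDensity (K : VectorField d M) (a : ℝ) {s : LocalPoint d M → ℝ}
    (hs : IsDensity a s) : IsDensity a (lieFun K a s) := by
  constructor
  · intro φ hφ ψ hψ y hy
    have hy1 : y ∈ φ.target ∧ φ.symm y ∈ ψ.source := by simpa using hy
    have hz : transition φ ψ y ∈ ψ.target := ψ.map_source hy1.2
    rw [coeff_apply _ hφ hy1.1, coeff_apply _ hψ hz]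
    simp only [lieFun]
    rw [← coeff_apply s hφ hy1.1, ← coeff_apply s hψ hz]
    have hU := (φ.symm.trans ψ).open_source
    obtain ⟨h1, h2⟩ := transition_deriv hφ hψ hy
    have hV : DifferentiableAt ℝ (localField K φ) y :=
      ((localField_smooth K hφ).contDiffAt (φ.open_target.mem_nhds hy1.1)).differentiableAt (by simp)
    have hW : DifferentiableAt ℝ (localField K ψ) (transition φ ψ y) :=
      ((localField_smooth K hψ).contDiffAt (ψ.open_target.mem_nhds hz)).differentiableAt (by simp)
    have hsψ : DifferentiableAt ℝ (localCoeff s ψ) (transition φ ψ y) :=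
      ((hs.smooth ψ hψ).contDiffAt (ψ.open_target.mem_nhds hz)).differentiableAt (by simp)
    have dτ : DifferentiableAt ℝ (transition φ ψ) y :=
      ((transition_contDiffOn hφ hψ).contDiffAt (hU.mem_nhds hy)).differentiableAt (by simp)
    obtain ⟨d1, d2⟩ := fderiv_abs_det_rpow hU (transition_contDiffOn hφ hψ) hy _ h1 h2
      (transition_det_ne_zero hφ hψ hy) hV hW (fun z hz => localField_transform K hφ hψ hz) a
    have hev : localCoeff s φ =ᶠ[nhds y]
        fun z => |(fderiv ℝ (transition φ ψ) z).det| ^ a * localCoeff s ψ (transition φ ψ z) :=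
      Filter.eventually_of_mem (hU.mem_nhds hy) fun z hz => hs.transform φ hφ ψ hψ z hz
    have hc : HasFDerivAt (fun z => localCoeff s ψ (transition φ ψ z))
        ((fderiv ℝ (localCoeff s ψ) (transition φ ψ y)).comp (fderiv ℝ (transition φ ψ) y)) y :=
      hsψ.hasFDerivAt.comp y dτ.hasFDerivAt
    have hm := (d1.hasFDerivAt.mul hc).congr_of_eventuallyEq hev
    rw [hm.fderiv, localField_transform K hφ hψ hy, hs.transform φ hφ ψ hψ y hy]
    simp only [add_apply, smul_apply, ContinuousLinearMap.comp_apply, smul_eq_mul, d2]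
    ring
  · intro φ hφ
    have h1 : ContDiffOn ℝ ∞ (fun y => fderiv ℝ (localCoeff s φ) y (localField K φ y)
        + a * LinearMap.trace ℝ (Euc d) (fderiv ℝ (localField K φ) y).toLinearMap * localCoeff s φ y)
        φ.target := by
      refine ContDiffOn.add ?_ (ContDiffOn.mul (contDiffOn_const.mul ?_) (hs.smooth φ hφ))
      · exact ((hs.smooth φ hφ).fderiv_of_isOpen φ.open_target le_rfl).clm_apply
          (localField_smooth K hφ)
      · have hT : ContDiff ℝ ∞ (fun A : Euc d →L[ℝ] Euc d =>
            LinearMap.trace ℝ (Euc d) A.toLinearMap) := by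
          have : IsBoundedLinearMap ℝ (fun A : Euc d →L[ℝ] Euc d =>
              LinearMap.trace ℝ (Euc d) A.toLinearMap) :=
            (LinearMap.toContinuousLinearMap ((LinearMap.trace ℝ (Euc d)).comp
              (ContinuousLinearMap.coeLM ℝ))).isBoundedLinearMap
          exact this.contDiff
        exact hT.comp_contDiffOn
          ((localField_smooth K hφ).fderiv_of_isOpen φ.open_target le_rfl)
    refine h1.congr fun y hy => ?_
    rw [coeff_apply _ hφ hy, coeff_apply s hφ hy]; rfl

/-- The Lie derivative along `K` on densities of weight `a`. -/
def lieDeriv (K : VectorField d M) (a : ℝ) : Module.End ℝ (Density d M a) where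
  toFun s := ⟨lieFun K a s.1, lieFun_isDensity K a s.2⟩
  map_add' s t := by
    refine Subtype.ext (funext fun p => ?_)
    have hd : ∀ u : Density d M a, DifferentiableAt ℝ (localCoeff u.1 p.1.1) p.1.2 := fun u =>
      ((u.2.smooth _ p.2.1).contDiffAt (p.1.1.open_target.mem_nhds p.2.2)).differentiableAt
        (by simp)
    have h : localCoeff (s.1 + t.1) p.1.1 = localCoeff s.1 p.1.1 + localCoeff t.1 p.1.1 := by
      ext y; unfold localCoeff; split_ifs <;> simp [*]
    change lieFun K a (s.1 + t.1) p = lieFun K a s.1 p + lieFun K a t.1 p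
    simp only [lieFun]
    rw [h, fderiv_add (hd s) (hd t)]
    simp only [add_apply, Pi.add_apply]
    ring
  map_smul' r s := by
    refine Subtype.ext (funext fun p => ?_)
    have hd : DifferentiableAt ℝ (localCoeff s.1 p.1.1) p.1.2 :=
      ((s.2.smooth _ p.2.1).contDiffAt (p.1.1.open_target.mem_nhds p.2.2)).differentiableAt
        (by simp)
    have h : localCoeff (r • s.1) p.1.1 = r • localCoeff s.1 p.1.1 := by
      ext y; unfold localCoeff; split_ifs <;> simp [*]
    change lieFun K a (r • s.1) p = r • lieFun K a s.1 p
    simp only [lieFun]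
    rw [h, fderiv_const_smul hd]
    simp only [smul_apply, Pi.smul_apply, smul_eq_mul]
    ring

/-- The Lie derivative along `K` on the algebra of densities. -/
def lieOp (K : VectorField d M) : Module.End ℝ (DensityAlgebra d M) :=
  ofPencil (lieDeriv K)

end VF

/-! ### Volume forms -/

/-- A volume form: an everywhere positive smooth density of weight one. -/
structure VolumeForm (d : ℕ) (M : Type*) [TopologicalSpace M] [ChartedSpace (Euc d) M] where
  toDensity : Density d M 1
  pos : ∀ p : LocalPoint d M, 0 < toDensity.1 p

namespace VolumeForm

/-- `ρ^a` as a density of weight `a`. -/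
def pow (ρ : VolumeForm d M) (a : ℝ) : Density d M a :=
  ⟨fun p => ρ.toDensity.1 p ^ a, by
    have hc : ∀ φ ∈ maximalAtlas (𝓡 d) ∞ M, ∀ y ∈ φ.target,
        localCoeff (fun p => ρ.toDensity.1 p ^ a) φ y = localCoeff ρ.toDensity.1 φ y ^ a := by
      intro φ hφ y hy
      rw [coeff_apply _ hφ hy, coeff_apply _ hφ hy]
    refine ⟨fun φ hφ ψ hψ y hy => ?_, fun φ hφ => ?_⟩
    · have hy1 : y ∈ φ.target ∧ φ.symm y ∈ ψ.source := by simpa using hy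
      have hz : transition φ ψ y ∈ ψ.target := ψ.map_source hy1.2
      have h0 : 0 < localCoeff ρ.toDensity.1 ψ (transition φ ψ y) := by
        rw [coeff_apply _ hψ hz]; exact ρ.pos _
      rw [hc φ hφ y hy1.1, hc ψ hψ _ hz, ρ.toDensity.2.transform φ hφ ψ hψ y hy, Real.rpow_one,
        Real.mul_rpow (abs_nonneg _) h0.le]
    · refine ContDiffOn.congr ?_ (hc φ hφ)
      refine (ρ.toDensity.2.smooth φ hφ).rpow_const_of_ne fun y hy => ?_
      rw [coeff_apply _ hφ hy]; exact (ρ.pos _).ne'⟩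

/-- The canonical isomorphism `F_a(M) → F_b(M)`, `s ↦ ρ^(b - a) s`. -/
def shift (ρ : VolumeForm d M) (a b : ℝ) : Density d M a →ₗ[ℝ] Density d M b where
  toFun s := ⟨(ρ.pow (b - a)).1 * s.1, by
    have h := SetLike.mul_mem_graded (A := Density d M) (ρ.pow (b - a)).2 s.2
    rwa [sub_add_cancel] at h⟩
  map_add' s t := Subtype.ext (mul_add _ _ _)
  map_smul' r s := Subtype.ext (mul_smul_comm r _ s.1)

end VolumeForm

/-! ### Differential operators of order at most `n` -/

/-- Multiplication by the function `f ∈ F_0(M)` on densities of weight `a`. -/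
def mulFun (f : Density d M 0) (a : ℝ) : Module.End ℝ (Density d M a) where
  toFun s := ⟨f.1 * s.1, by
    have h := SetLike.mul_mem_graded (A := Density d M) f.2 s.2
    rwa [zero_add] at h⟩
  map_add' s t := Subtype.ext (mul_add _ _ _)
  map_smul' r s := Subtype.ext (mul_smul_comm r _ s.1)

/-- `D^(n)_a(M)`: differential operators of order at most `n` on `F_a(M)`. -/
def DiffOp (d : ℕ) (M : Type*) [TopologicalSpace M] [ChartedSpace (Euc d) M] (n : ℕ) (a : ℝ) :
    Submodule ℝ (Module.End ℝ (Density d M a)) :=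
  commFiltration (Set.range fun f : Density d M 0 => mulFun f a) (n + 1)

/-- The weight operator: `ŵ s = a s` for `s ∈ F_a(M)`. -/
def weightOp (d : ℕ) (M : Type*) [TopologicalSpace M] [ChartedSpace (Euc d) M] :
    Module.End ℝ (DensityAlgebra d M) :=
  ofPencil fun a => a • LinearMap.id

/-- The operator `D` on `F(M)` has weight zero and its restrictions to the spaces `F_a(M)` depend
polynomially on `a`, once these spaces are identified with the space of functions by means of a
volume form `ρ`, that is, `D = ∑_k a^k ρ^a T_k ρ^(-a)` on `F_a(M)` with operators `T_k` on functions.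
(For differential operators any two volume forms give the same condition.) -/
def IsPolynomialPencil (D : Module.End ℝ (DensityAlgebra d M)) : Prop :=
  ∃ (ρ : VolumeForm d M) (m : ℕ) (T : ℕ → Module.End ℝ (Density d M 0)),
    ∀ (a : ℝ) (s : Density d M a),
      D (incl d M a s) =
        incl d M a (∑ k ∈ Finset.range (m + 1), a ^ k • ρ.shift 0 a (T k (ρ.shift a 0 s)))

/-- `D^(n)` of the extended manifold: differential operators of weight zero and of order at most `n`
on the algebra of densities (`n + 1` commutators with arbitrary densities vanish), polynomial in the
weight. -/
structure IsDiffOpAlg (n : ℕ) (D : Module.End ℝ (DensityAlgebra d M)) : Prop where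
  order_le : D ∈ commFiltration (Set.range (LinearMap.mulLeft ℝ (A := DensityAlgebra d M))) (n + 1)
  polynomial : IsPolynomialPencil D

/-- The space of operators on `F(M)` all of whose `k`-fold iterated commutators with functions on
`M` vanish (operators with fewer than `k` spatial derivatives). For `k = 1` these are the vertical
operators `V^(0)(M)`, and for `k ≥ 1` the space is `V^(k-1)(M)`; for `k = 0` it is `{0}`. -/
def verticalFiltration (d : ℕ) (M : Type*) [TopologicalSpace M] [ChartedSpace (Euc d) M] (k : ℕ) :
    Submodule ℝ (Module.End ℝ (DensityAlgebra d M)) :=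
  commFiltration (Set.range fun f : Density d M 0 =>
    LinearMap.mulLeft ℝ (A := DensityAlgebra d M) (incl d M 0 f)) k

/-! ### The canonical scalar product and adjoints -/

section Adjoint

variable [IsManifold (𝓡 d) ∞ M] [T2Space M] [SigmaCompactSpace M]

/-- A smooth partition of unity on `M`, subordinate to the domains of the preferred charts. -/
def partitionOfUnity (d : ℕ) (M : Type*) [TopologicalSpace M] [ChartedSpace (Euc d) M]
    [IsManifold (𝓡 d) ∞ M] [T2Space M] [SigmaCompactSpace M] :
    SmoothPartitionOfUnity M (𝓡 d) M Set.univ :=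
  (SmoothPartitionOfUnity.exists_isSubordinate_chartAt_source (𝓡 d) M).choose

/-- The integral over `M` of a (compactly supported) density of weight one. -/
def densityIntegral (s : Density d M 1) : ℝ :=
  ∑ᶠ x : M, ∫ y in (chartAt (Euc d) x).target,
    partitionOfUnity d M x ((chartAt (Euc d) x).symm y) * localCoeff s.1 (chartAt (Euc d) x) y

/-- All components of `s` vanish outside a common compact set. -/
def HasCompactSupp (s : DensityAlgebra d M) : Prop :=
  ∃ C : Set M, IsCompact C ∧
    ∀ (a : ℝ) (p : LocalPoint d M), p.1.1.symm p.1.2 ∉ C → (weightComponent a s).1 p = 0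

/-- The canonical scalar product `⟨s, t⟩` on compactly supported densities: the integral of the part
of weight one of the product `s t`. -/
def scalarProduct (s t : DensityAlgebra d M) : ℝ :=
  densityIntegral (weightComponent 1 (s * t))

/-- `D'` is a differential operator on `F(M)` (of some order) and it is adjoint to `D`. -/
def IsAdjoint (D D' : Module.End ℝ (DensityAlgebra d M)) : Prop :=
  (∃ n, IsDiffOpAlg n D') ∧
    ∀ s t : DensityAlgebra d M, HasCompactSupp s → HasCompactSupp t →
      scalarProduct (D s) t = scalarProduct s (D' t)

open Classical in
/-- The adjoint operator `D^*` (`0` if there is none). -/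
def adjointOp (D : Module.End ℝ (DensityAlgebra d M)) : Module.End ℝ (DensityAlgebra d M) :=
  if h : ∃ D', IsAdjoint D D' then h.choose else 0

end Adjoint

/-! ### Pencil liftings -/

section Liftings

variable [IsManifold (𝓡 d) ∞ M]

/-- `ad_K D = L_K D - D L_K` for operators on densities of weight `a`. -/
def adDensity (K : VectorField d M) {a : ℝ} (D : Module.End ℝ (Density d M a)) :
    Module.End ℝ (Density d M a) :=
  lieDeriv K a * D - D * lieDeriv K a

/-- `ad_K D = L_K D - D L_K` for operators on the algebra of densities. -/
def adAlgebra (K : VectorField d M) (D : Module.End ℝ (DensityAlgebra d M)) :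
    Module.End ℝ (DensityAlgebra d M) :=
  lieOp K * D - D * lieOp K

/-- The divergenceless vector fields with respect to `ρ`. -/
def divergenceless (ρ : VolumeForm d M) : Set (VectorField d M) :=
  {K | lieDeriv K 1 ρ.toDensity = 0}

/-- The values of `Lift` on `D^(n)_lam(M)` are operators of order at most `n` on `F(M)` and
`Lift Δ` passes through `Δ`. -/
def IsRegularPencilLifting (n : ℕ) (lam : ℝ)
    (Lift : Module.End ℝ (Density d M lam) → Module.End ℝ (DensityAlgebra d M)) : Prop :=
  ∀ Δ ∈ DiffOp d M n lam, IsDiffOpAlg n (Lift Δ) ∧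
    ∀ s : Density d M lam, Lift Δ (incl d M lam s) = incl d M lam (Δ s)

/-- `Lift` is equivariant on `D^(n)_lam(M)` with respect to the vector fields in `G`. -/
def IsEquivariant (n : ℕ) (lam : ℝ) (G : Set (VectorField d M))
    (Lift : Module.End ℝ (Density d M lam) → Module.End ℝ (DensityAlgebra d M)) : Prop :=
  ∀ K ∈ G, ∀ Δ ∈ DiffOp d M n lam, adAlgebra K (Lift Δ) = Lift (adDensity K Δ)

/-- The map from `D^(n)_lam(M)` to the quotient by `W` induced by `Lift` is equivariant with respect
to all vector fields. -/
def IsDiffEquivariantModulo (n : ℕ) (lam : ℝ)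
    (W : Submodule ℝ (Module.End ℝ (DensityAlgebra d M)))
    (Lift : Module.End ℝ (Density d M lam) → Module.End ℝ (DensityAlgebra d M)) : Prop :=
  ∀ K : VectorField d M, ∀ Δ ∈ DiffOp d M n lam,
    adAlgebra K (Lift Δ) - Lift (adDensity K Δ) ∈ W

/-- The lifting `P_lam(Δ)`, equal to `ρ^(a - lam) ∘ Δ ∘ ρ^(lam - a)` on `F_a(M)`. -/
def volumeLifting (ρ : VolumeForm d M) (lam : ℝ) (Δ : Module.End ℝ (Density d M lam)) :
    Module.End ℝ (DensityAlgebra d M) :=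
  ofPencil fun a => ρ.shift lam a ∘ₗ Δ ∘ₗ ρ.shift a lam

variable [T2Space M] [SigmaCompactSpace M]

open Polynomial in
/-- The family of liftings
`Δ ↦ A(ŵ) P(Δ) + B(ŵ) P(Δ)^* + C(ŵ) P(Δ)(1) + E(ŵ) P(Δ)^*(1)` with
`A = 1 - b (ŵ - lam)`, `B = (-1)^n b (ŵ - lam)`, `C = ∑_{k=1}^n c_k (ŵ - lam)^k` and
`E = ∑_{k=1}^n e_k (ŵ - lam)^k`, where `P(Δ)(1)` and `P(Δ)^*(1)` act by multiplication. -/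
def familyLifting (ρ : VolumeForm d M) (n : ℕ) (lam b : ℝ) (c e : Fin n → ℝ)
    (Δ : Module.End ℝ (Density d M lam)) : Module.End ℝ (DensityAlgebra d M) :=
  let P := volumeLifting ρ lam Δ
  let w := weightOp d M
  aeval w (1 - C b * (X - C lam)) * P
    + aeval w ((-1) ^ n * (C b * (X - C lam))) * adjointOp P
    + aeval w (∑ k : Fin n, C (c k) * (X - C lam) ^ (k.val + 1)) * LinearMap.mulLeft ℝ (P 1)
    + aeval w (∑ k : Fin n, C (e k) * (X - C lam) ^ (k.val + 1)) *
        LinearMap.mulLeft ℝ (adjointOp P 1)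

open Polynomial in
/-- The distinguished lifting
`Δ ↦ (ŵ + lam - 1)/(2 lam - 1) P(Δ) + (-1)^n (lam - ŵ)/(2 lam - 1) P(Δ)^*`. -/
def distinguishedLifting (ρ : VolumeForm d M) (n : ℕ) (lam : ℝ)
    (Δ : Module.End ℝ (Density d M lam)) : Module.End ℝ (DensityAlgebra d M) :=
  let P := volumeLifting ρ lam Δ
  let w := weightOp d M
  aeval w (C (1 / (2 * lam - 1)) * (X + C (lam - 1))) * P
    + aeval w ((-1) ^ n * (C (1 / (2 * lam - 1)) * (C lam - X))) * adjointOp P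

end Liftings

end PencilLifting

end

open PencilLifting

/-! A volume form ρ turns densities of weight a into functions, through f ↦ ρ^a f
(`VolumeForm.triv`), and an operator of weight zero becomes a family a ↦ F(a) of operators on
functions (`VolumeForm.pencil`). In this picture P(Δ) is a constant family T, ŵ is a ↦ a, the Lie
derivative is a ↦ K + a div K, the adjoint of F is a ↦ F(1 - a)^†, where † is the adjoint for ∫ρ,
and a family lies in V^(k) exactly when every F(a) has order at most k.

The analytic input is `exists_fnAdjoint`: an operator T of order ≤ n on functions has an adjoint T'
of order ≤ n, and T - (-1)^n T' has order ≤ n - 1. Orders are defined by commutators, so coordinates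
must be recovered first. Hadamard's lemma yields local coordinate functions x_i and fields X_i, and
the Euler identity n S = ∑ [S, x_i] X_i modulo lower order (`DualFrame.euler`) reduces the adjoint
of S to operators of smaller order and to vector fields. For the latter, X^† = -X - div X is the
divergence theorem. A partition of unity glues the local adjoints.

The rest is algebra with T and T'. A member of the family is T - b(ŵ - λ)(T - (-1)^n T') plus
functions times polynomials in ŵ of degree ≤ n, hence has order ≤ n, as ŵ has order one. The
substitution a ↦ 1 - a exchanges a + λ - 1 and λ - a, which gives the (anti-)self-adjointness. Up to
multiplications, which also disappear when div K = 0, the equivariance defect is (a - λ) times (1 -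
b(a - λ))[div K, T] + (-1)^n b(a + λ - 1)[div K, T']. Modulo order n - 2 one has [div K, T'] =
(-1)^n [div K, T], so the defect becomes (a - λ)(1 - b(1 - 2λ))[div K, T], and this is zero for the
distinguished b. Replacing ρ by e^l ρ conjugates T by e^((a-λ)l) and T' by e^((a+λ-1)l); the terms
linear in l cancel in the distinguished combination by the same comparison of symbols.

For uniqueness, n ≥ 2 puts all multiplications into V^(n-2). Any other b would force [div K, T] to
have order ≤ n - 2 for all K and T. With T = X^n and a suitable K this fails
(`exists_commutator_div_notMem`), unless d = 0 or M is empty; then all differential operators have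
order zero and there is nothing left to compare. -/

noncomputable section

set_option linter.unusedSectionVars false

namespace PencilLifting

open IsManifold

/-! ### Filtrations by iterated commutators -/

section CommFiltration

variable {V W : Type*} [AddCommGroup V] [Module ℝ V] [AddCommGroup W] [Module ℝ W]
  {S : Set (Module.End ℝ V)}

theorem mem_commFiltration_succ {k : ℕ} {D : Module.End ℝ V} :
    D ∈ commFiltration S (k + 1) ↔ ∀ m ∈ S, D * m - m * D ∈ commFiltration S k := Iff.rfl

theorem mem_commFiltration_zero {D : Module.End ℝ V} :
    D ∈ commFiltration S 0 ↔ D = 0 := Iff.rfl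

theorem commFiltration_le_succ (k : ℕ) : commFiltration S k ≤ commFiltration S (k + 1) := by
  induction k with
  | zero =>
    intro D hD
    rw [mem_commFiltration_zero] at hD
    subst hD
    exact zero_mem _
  | succ k ih => exact fun D hD m hm => ih (hD m hm)

theorem commFiltration_mono {j k : ℕ} (h : j ≤ k) : commFiltration S j ≤ commFiltration S k :=
  monotone_nat_of_le_succ commFiltration_le_succ h

/-- Index k + 1 stands for order k, so orders add. Commutation with m is a derivation, [DD', m] =
D[D', m] + [D, m]D', and each summand has smaller total order; a factor of order zero contributes no
commutator. -/
theorem mul_mem_commFiltration {j k : ℕ} {D D' : Module.End ℝ V}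
    (hD : D ∈ commFiltration S (j + 1)) (hD' : D' ∈ commFiltration S (k + 1)) :
    D * D' ∈ commFiltration S (j + k + 1) := by
  obtain ⟨N, hN⟩ : ∃ N, j + k = N := ⟨_, rfl⟩
  induction N generalizing j k D D' with
  | zero =>
    obtain ⟨rfl, rfl⟩ : j = 0 ∧ k = 0 := by omega
    intro m hm
    have h1 := hD m hm
    have h2 := hD' m hm
    rw [mem_commFiltration_zero] at h1 h2 ⊢
    have : D * D' * m - m * (D * D') = D * (D' * m - m * D') + (D * m - m * D) * D' := by
      noncomm_ring
    rw [this, h1, h2]; simp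
  | succ N ih =>
    intro m hm
    have h1 := hD m hm
    have h2 := hD' m hm
    have : D * D' * m - m * (D * D') = D * (D' * m - m * D') + (D * m - m * D) * D' := by
      noncomm_ring
    rw [this]
    refine add_mem ?_ ?_
    · rcases k with _ | k
      · rw [mem_commFiltration_zero] at h2; rw [h2]; simp
      · have := ih hD h2 (by omega)
        exact commFiltration_mono (by omega) this
    · rcases j with _ | j
      · rw [mem_commFiltration_zero] at h1; rw [h1]; simp
      · have := ih h1 hD' (by omega)
        exact commFiltration_mono (by omega) this

theorem mul_mem_commFiltration_left {k : ℕ} {D D' : Module.End ℝ V}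
    (hD : D ∈ commFiltration S 1) (hD' : D' ∈ commFiltration S k) :
    D * D' ∈ commFiltration S k := by
  rcases k with _ | k
  · rw [mem_commFiltration_zero] at hD'; simp [hD']
  · simpa using mul_mem_commFiltration hD hD'

theorem mul_mem_commFiltration_right {k : ℕ} {D D' : Module.End ℝ V}
    (hD : D ∈ commFiltration S k) (hD' : D' ∈ commFiltration S 1) :
    D * D' ∈ commFiltration S k := by
  rcases k with _ | k
  · rw [mem_commFiltration_zero] at hD; simp [hD]
  · simpa using mul_mem_commFiltration hD hD'

theorem one_mem_commFiltration : (1 : Module.End ℝ V) ∈ commFiltration S 1 := by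
  intro m _
  simp

theorem pow_mem_commFiltration {D : Module.End ℝ V} (hD : D ∈ commFiltration S 2) (k : ℕ) :
    D ^ k ∈ commFiltration S (k + 1) := by
  induction k with
  | zero => simpa using one_mem_commFiltration
  | succ k ih => rw [pow_succ]; exact mul_mem_commFiltration ih hD

/-- Conjugation respects commutators, so an order can be computed in any trivialization that carries
one set of multipliers onto the other. -/
theorem conj_mem_commFiltration_iff (e : V ≃ₗ[ℝ] W) {S' : Set (Module.End ℝ W)}
    (hS : e.conj '' S = S') (k : ℕ) (D : Module.End ℝ V) :
    e.conj D ∈ commFiltration S' k ↔ D ∈ commFiltration S k := by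
  subst hS
  induction k generalizing D with
  | zero => rw [mem_commFiltration_zero, mem_commFiltration_zero]; simp
  | succ k ih =>
    simp only [mem_commFiltration_succ, Set.forall_mem_image]
    refine forall₂_congr fun m hm => ?_
    rw [← ih]
    simp [map_sub, Module.End.mul_eq_comp, LinearEquiv.conj_comp]

end CommFiltration

/-! ### Differential operators on a commutative algebra -/

section CommAlg

variable {A : Type*} [CommRing A] [Algebra ℝ A]

variable (A) in
/-- Differential operators on a commutative algebra all of whose `k`-fold commutators with
multiplications vanish. -/
abbrev algDiffOp (k : ℕ) : Submodule ℝ (Module.End ℝ A) :=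
  commFiltration (Set.range (LinearMap.mulLeft ℝ (A := A))) k

/-- The multiplication operator. -/
abbrev mulOp (f : A) : Module.End ℝ A := LinearMap.mulLeft ℝ f

theorem mulOp_mul (f g : A) : mulOp (f * g) = mulOp f * mulOp g := by
  ext x; simp

theorem mulOp_comm (f g : A) : mulOp f * mulOp g = mulOp g * mulOp f := by
  rw [← mulOp_mul, ← mulOp_mul, mul_comm]

theorem mulOp_mul_commutator (c f : A) (B : Module.End ℝ A) :
    mulOp c * B * mulOp f - mulOp f * (mulOp c * B)
      = mulOp c * (B * mulOp f - mulOp f * B) := by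
  have h : mulOp f * (mulOp c * B) = mulOp c * (mulOp f * B) := by
    rw [← mul_assoc, mulOp_comm, mul_assoc]
  rw [h, mul_assoc, ← mul_sub (mulOp c)]

/-- The Jacobi identity with [f, g] = 0. It allows inductions on the order: a further commutator
with g turns a claim about T into the same claim about [T, g]. -/
theorem commutator_mulOp_right_comm (T : Module.End ℝ A) (f g : A) :
    (T * mulOp f - mulOp f * T) * mulOp g - mulOp g * (T * mulOp f - mulOp f * T)
      = (T * mulOp g - mulOp g * T) * mulOp f - mulOp f * (T * mulOp g - mulOp g * T) := by
  have h2 := mulOp_comm g f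
  have h3 : T * (mulOp g * mulOp f) = T * (mulOp f * mulOp g) := by rw [h2]
  have h4 : mulOp g * mulOp f * T = mulOp f * mulOp g * T := by rw [h2]
  simp only [sub_mul, mul_sub, mul_assoc] at h3 h4 ⊢
  rw [h3, h4]; abel

theorem mulOp_mem (f : A) : mulOp f ∈ algDiffOp A 1 := by
  rintro _ ⟨g, rfl⟩
  rw [mem_commFiltration_zero]
  change mulOp f * mulOp g - mulOp g * mulOp f = 0
  rw [mulOp_comm, sub_self]

theorem mem_algDiffOp_succ {k : ℕ} {D : Module.End ℝ A} :
    D ∈ algDiffOp A (k + 1) ↔ ∀ f : A, D * mulOp f - mulOp f * D ∈ algDiffOp A k := by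
  rw [mem_commFiltration_succ]
  exact Set.forall_mem_range

/-- An operator that commutes with multiplications satisfies D(f · 1) = f D(1). -/
theorem eq_mulOp_of_mem {D : Module.End ℝ A} (hD : D ∈ algDiffOp A 1) : D = mulOp (D 1) := by
  ext f
  have h := mem_algDiffOp_succ.mp hD f
  rw [mem_commFiltration_zero] at h
  have h1 := LinearMap.congr_fun h 1
  simp only [LinearMap.sub_apply, Module.End.mul_apply, LinearMap.mulLeft_apply, mul_one,
    LinearMap.zero_apply] at h1
  rw [sub_eq_zero.mp h1]
  simp [mul_comm]

theorem mulOp_comm_mem {k : ℕ} {D : Module.End ℝ A} (hD : D ∈ algDiffOp A (k + 1)) (f : A) :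
    mulOp f * D - D * mulOp f ∈ algDiffOp A k := by
  rw [← neg_sub]; exact neg_mem (mem_algDiffOp_succ.mp hD f)

/-- Orders j and k give a bracket of order j + k - 1: the Jacobi identity reduces the total order,
and at the bottom both operators are multiplications in a commutative algebra. -/
theorem commutator_mem {j k : ℕ} {D D' : Module.End ℝ A}
    (hD : D ∈ algDiffOp A (j + 1)) (hD' : D' ∈ algDiffOp A (k + 1)) :
    D * D' - D' * D ∈ algDiffOp A (j + k) := by
  obtain ⟨N, hN⟩ : ∃ N, j + k = N := ⟨_, rfl⟩
  induction N generalizing j k D D' with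
  | zero =>
    obtain ⟨rfl, rfl⟩ : j = 0 ∧ k = 0 := by omega
    rw [eq_mulOp_of_mem hD, eq_mulOp_of_mem hD', mulOp_comm, sub_self]
    exact zero_mem _
  | succ N ih =>
    rcases j with _ | j
    · rw [eq_mulOp_of_mem hD, Nat.zero_add]; exact mulOp_comm_mem hD' _
    rcases k with _ | k
    · rw [eq_mulOp_of_mem hD', Nat.add_zero]; exact mem_algDiffOp_succ.mp hD _
    have e : j + 1 + (k + 1) = (j + k + 1) + 1 := by omega
    rw [e, mem_algDiffOp_succ]
    intro f
    have h1 := ih (mem_algDiffOp_succ.mp hD f) hD' (by omega)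
    have h2 := ih hD (mem_algDiffOp_succ.mp hD' f) (by omega)
    have : (D * D' - D' * D) * mulOp f - mulOp f * (D * D' - D' * D)
        = ((D * mulOp f - mulOp f * D) * D' - D' * (D * mulOp f - mulOp f * D))
          + (D * (D' * mulOp f - mulOp f * D') - (D' * mulOp f - mulOp f * D') * D) := by
      simp only [sub_mul, mul_sub, mul_assoc]
      abel
    rw [this]
    exact add_mem (commFiltration_mono (by omega) h1) (commFiltration_mono (by omega) h2)

/-- A derivation is a differential operator of order one. -/
theorem derivation_mem (X : Derivation ℝ A A) : (X : A →ₗ[ℝ] A) ∈ algDiffOp A 2 := by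
  rw [mem_algDiffOp_succ]
  intro f
  have : (X : A →ₗ[ℝ] A) * mulOp f - mulOp f * (X : A →ₗ[ℝ] A) = mulOp (X f) := by
    ext g; simp [mul_comm]
  rw [this]; exact mulOp_mem _

theorem derivation_commutator (X : Derivation ℝ A A) (f : A) :
    (X : A →ₗ[ℝ] A) * mulOp f - mulOp f * (X : A →ₗ[ℝ] A) = mulOp (X f) := by
  ext g; simp [mul_comm]

theorem commutator_eq_mulOp {S : Module.End ℝ A} (hS : S ∈ algDiffOp A 2) (f : A) :
    S * mulOp f - mulOp f * S = mulOp (S f - f * S 1) := by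
  rw [eq_mulOp_of_mem (mem_algDiffOp_succ.mp hS f)]
  simp

/-- The derivation underlying a first order differential operator. -/
def derivationOf (S : Module.End ℝ A) (hS : S ∈ algDiffOp A 2) : Derivation ℝ A A where
  toLinearMap := S - mulOp (S 1)
  map_one_eq_zero' := by simp
  leibniz' f g := by
    have h := LinearMap.congr_fun (commutator_eq_mulOp hS f) g
    simp only [LinearMap.sub_apply, Module.End.mul_apply, LinearMap.mulLeft_apply] at h
    simp only [LinearMap.sub_apply, LinearMap.mulLeft_apply, smul_eq_mul]
    rw [sub_eq_iff_eq_add.mp h]; ring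

theorem derivationOf_apply (S : Module.End ℝ A) (hS : S ∈ algDiffOp A 2) (f : A) :
    derivationOf S hS f = S f - f * S 1 := by
  change S f - S 1 * f = _
  rw [mul_comm]

theorem commutator_eq_derivationOf {S : Module.End ℝ A} (hS : S ∈ algDiffOp A 2) (f : A) :
    S * mulOp f - mulOp f * S = mulOp (derivationOf S hS f) := by
  rw [commutator_eq_mulOp hS, derivationOf_apply]

/-- Functions `x i` and derivations `X i` that are dual to each other for all derivations with
values in the ideal `I`. -/
structure DualFrame (I : Ideal A) {ι : Type*} [Fintype ι] (x : ι → A) (X : ι → Derivation ℝ A A) :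
    Prop where
  expand : ∀ D : Derivation ℝ A A, (∀ f, D f ∈ I) → ∀ f, D f = ∑ i, D (x i) * X i f

variable {I : Ideal A} {ι : Type*} [Fintype ι] {x : ι → A} {X : ι → Derivation ℝ A A}

/-- Dual frames exist only locally, so the inductions below run over operators with values in the
ideal `I`. Commutators stay in this class. -/
theorem commutator_range_mem {S : Module.End ℝ A} (hI : ∀ f, S f ∈ I) (h : A) (f : A) :
    (S * mulOp h - mulOp h * S) f ∈ I := by
  simp only [LinearMap.sub_apply, Module.End.mul_apply, LinearMap.mulLeft_apply]
  exact sub_mem (hI _) (I.mul_mem_left _ (hI _))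

/-- The chain rule for principal symbols. In order one, S - S(1) is a derivation with values in `I`
and the frame expands it exactly; higher orders follow by taking one more commutator. -/
theorem DualFrame.commutator_expand (h : DualFrame I x X) {n : ℕ} {S : Module.End ℝ A}
    (hS : S ∈ algDiffOp A (n + 2)) (hI : ∀ f, S f ∈ I) (f : A) :
    (S * mulOp f - mulOp f * S) - ∑ i, mulOp (X i f) * (S * mulOp (x i) - mulOp (x i) * S)
      ∈ algDiffOp A n := by
  induction n generalizing S with
  | zero =>
    rw [mem_commFiltration_zero]
    simp only [commutator_eq_derivationOf hS]
    have := h.expand (derivationOf S hS)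
      (fun f => by rw [derivationOf_apply]; exact sub_mem (hI _) (I.mul_mem_left _ (hI _))) f
    rw [this]
    ext g
    simp [Finset.mul_sum, mul_comm, mul_left_comm]
  | succ n ih =>
    rw [mem_algDiffOp_succ]
    intro g
    have := ih (mem_algDiffOp_succ.mp hS g) (commutator_range_mem hI g)
    convert this using 1
    rw [commutator_mulOp_right_comm S g f, sub_mul, mul_sub]
    simp only [Finset.sum_mul, Finset.mul_sum]
    rw [sub_sub_sub_comm, ← Finset.sum_sub_distrib]
    congr 1
    refine Finset.sum_congr rfl fun i _ => ?_
    rw [mulOp_mul_commutator, commutator_mulOp_right_comm S g]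

/-- Euler's identity for the principal symbol, a homogeneous polynomial of degree n in the momenta:
bracketing with x_i differentiates it in the i-th momentum, and X_i multiplies by that momentum. -/
theorem DualFrame.euler (h : DualFrame I x X) {n : ℕ} {S : Module.End ℝ A}
    (hS : S ∈ algDiffOp A (n + 1)) (hI : ∀ f, S f ∈ I) :
    (n : ℝ) • S - ∑ i, (S * mulOp (x i) - mulOp (x i) * S) * (X i : A →ₗ[ℝ] A)
      ∈ algDiffOp A n := by
  induction n generalizing S with
  | zero =>
    rw [mem_commFiltration_zero]
    have : ∀ f, S * mulOp f - mulOp f * S = 0 := fun f => mem_algDiffOp_succ.mp hS f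
    simp [this]
  | succ n ih =>
    rw [mem_algDiffOp_succ]
    intro f
    have h1 := ih (mem_algDiffOp_succ.mp hS f) (commutator_range_mem hI f)
    have h2 := h.commutator_expand hS hI f
    -- The first term on the right is the Euler sum of [S, f], the second has lower order, and by
    -- `commutator_expand` the third sums to one more copy of [S, f]; this raises the factor from n
    -- to n + 1.
    have key : ∀ i, (S * mulOp (x i) - mulOp (x i) * S) * (X i : A →ₗ[ℝ] A) * mulOp f
        - mulOp f * ((S * mulOp (x i) - mulOp (x i) * S) * (X i : A →ₗ[ℝ] A))
        = ((S * mulOp f - mulOp f * S) * mulOp (x i) - mulOp (x i) * (S * mulOp f - mulOp f * S))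
            * (X i : A →ₗ[ℝ] A)
          + ((S * mulOp (x i) - mulOp (x i) * S) * mulOp (X i f)
              - mulOp (X i f) * (S * mulOp (x i) - mulOp (x i) * S))
          + mulOp (X i f) * (S * mulOp (x i) - mulOp (x i) * S) := by
      intro i
      rw [← derivation_commutator]
      have h2 := mulOp_comm (x i) f
      have h3 : S * (mulOp (x i) * (mulOp f * (X i : A →ₗ[ℝ] A)))
          = S * (mulOp f * (mulOp (x i) * (X i : A →ₗ[ℝ] A))) := by
        rw [← mul_assoc (mulOp (x i)), h2, mul_assoc]
      have h4 : mulOp (x i) * (mulOp f * (S * (X i : A →ₗ[ℝ] A)))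
          = mulOp f * (mulOp (x i) * (S * (X i : A →ₗ[ℝ] A))) := by
        rw [← mul_assoc, h2, mul_assoc]
      simp only [sub_mul, mul_sub, mul_assoc] at h3 h4 ⊢
      rw [h3, h4]; abel
    have h5 : ∑ i, ((S * mulOp (x i) - mulOp (x i) * S) * mulOp (X i f)
              - mulOp (X i f) * (S * mulOp (x i) - mulOp (x i) * S)) ∈ algDiffOp A n :=
      Submodule.sum_mem _ fun i _ =>
        mem_algDiffOp_succ.mp (mem_algDiffOp_succ.mp hS _) _
    have := sub_mem (add_mem h1 h2) h5
    convert this using 1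
    rw [sub_mul, mul_sub, Finset.sum_mul, Finset.mul_sum, sub_sub_sub_comm,
      ← Finset.sum_sub_distrib]
    simp only [key, Finset.sum_add_distrib]
    have hs : ((n + 1 : ℕ) : ℝ) • S * mulOp f - mulOp f * ((n + 1 : ℕ) : ℝ) • S
        = (n : ℝ) • (S * mulOp f - mulOp f * S) + (S * mulOp f - mulOp f * S) := by
      rw [smul_mul_assoc, mul_smul_comm, ← smul_sub (M := ℝ) (A := Module.End ℝ A)]
      push_cast
      rw [add_smul, one_smul]
    rw [hs]
    abel

theorem derivation_pow_mem (X : Derivation ℝ A A) (k : ℕ) :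
    (X : A →ₗ[ℝ] A) ^ k ∈ algDiffOp A (k + 1) :=
  pow_mem_commFiltration (V := A) (derivation_mem X) k

/-- If every derivation sends `g` to `c g` times its value on `l`, then this holds for the
commutators of all differential operators up to lower order. -/
theorem commutator_chain {g l c : A} (h : ∀ D : Derivation ℝ A A, D g = c * D l)
    {n : ℕ} {T : Module.End ℝ A} (hT : T ∈ algDiffOp A (n + 1)) :
    (T * mulOp g - mulOp g * T) - mulOp c * (T * mulOp l - mulOp l * T)
      ∈ algDiffOp A (n - 1) := by
  induction n generalizing T with
  | zero =>
    have : ∀ f, T * mulOp f - mulOp f * T = 0 := fun f => mem_algDiffOp_succ.mp hT f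
    simp [this]
  | succ n ih =>
    -- In order one the target index n - 1 is 0, so an exact equality is needed; it is the
    -- hypothesis on derivations.
    rcases n with _ | n
    · rw [commutator_eq_derivationOf hT, commutator_eq_derivationOf hT, h, mulOp_mul, sub_self]
      exact zero_mem _
    · change _ ∈ algDiffOp A (n + 1)
      rw [mem_algDiffOp_succ]
      intro f
      have := ih (mem_algDiffOp_succ.mp hT f)
      rw [Nat.add_sub_cancel] at this
      convert this using 1
      rw [commutator_mulOp_right_comm T f g, commutator_mulOp_right_comm T f l,
        ← mulOp_mul_commutator c f]
      simp only [sub_mul, mul_sub, mul_assoc]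
      abel

end CommAlg

/-! ### Hadamard's lemma on the model space -/

section Hadamard

open MeasureTheory in
/-- Integrals of smooth functions over a parameter in `[0, 1]` are smooth. -/
theorem contDiff_integral_unitInterval {E : Type*} [NormedAddCommGroup E] [NormedSpace ℝ E]
    {G : E × ℝ → ℝ} (hG : ContDiff ℝ ∞ G) :
    ContDiff ℝ ∞ fun y => ∫ t in (0 : ℝ)..1, G (y, t) := by
  -- The integral is the convolution at 0 of the indicator of [0, 1] with t ↦ b(t) G(y, -t). The
  -- bump, equal to 1 on [-2, 2], only makes the support in t compact.
  let b : ContDiffBump (0 : ℝ) := ⟨2, 3, by norm_num, by norm_num⟩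
  have hk : IsCompact (Metric.closedBall (0 : ℝ) 3) := isCompact_closedBall _ _
  have key := contDiffOn_convolution_right_with_param_comp (n := ⊤) (μ := volume)
    (ContinuousLinearMap.mul ℝ ℝ) (s := (Set.univ : Set E)) (v := fun _ => (0 : ℝ))
    contDiffOn_const (f := Set.indicator (Set.Icc (0 : ℝ) 1) (fun _ => (1 : ℝ)))
    (g := fun y t => b t * G (y, -t)) isOpen_univ hk (fun y t _ ht => by
      have : b t = 0 := b.zero_of_le_dist (by
        rw [Metric.mem_closedBall, not_le] at ht; exact ht.le)
      rw [this, zero_mul])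
    ((integrable_indicator_iff measurableSet_Icc).mpr
      (continuousOn_const.integrableOn_compact isCompact_Icc)).locallyIntegrable
    (by
      refine ContDiff.contDiffOn ?_
      exact (b.contDiff.comp contDiff_snd).mul (hG.comp (contDiff_fst.prodMk contDiff_snd.neg)))
  refine contDiffOn_univ.mp (key.congr fun y _ => ?_)
  rw [MeasureTheory.convolution_def, intervalIntegral.integral_of_le zero_le_one,
    ← integral_Icc_eq_integral_Ioc, ← integral_indicator measurableSet_Icc]
  congr 1
  ext t
  by_cases ht : t ∈ Set.Icc (0 : ℝ) 1
  · have hb : b (-t) = 1 := b.one_of_mem_closedBall (by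
      rw [Metric.mem_closedBall, dist_zero_right, Real.norm_eq_abs, abs_neg, abs_le]
      change -2 ≤ t ∧ t ≤ 2
      exact ⟨by linarith [ht.1], by linarith [ht.2]⟩)
    simp [ht, hb]
  · simp [ht]

/-- Hadamard's lemma. -/
theorem exists_hadamard {d : ℕ} {F : Euc d → ℝ} (hF : ContDiff ℝ ∞ F) (c : Euc d) :
    ∃ g : Fin d → Euc d → ℝ, (∀ i, ContDiff ℝ ∞ (g i)) ∧
      ∀ y, F y = F c + ∑ i, (y i - c i) * g i y := by
  have hF' : ContDiff ℝ ∞ (fderiv ℝ F) := hF.fderiv_right (m := ∞) le_rfl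
  refine ⟨fun i y => ∫ t in (0 : ℝ)..1, fderiv ℝ F (c + t • (y - c)) (EuclideanSpace.single i 1),
    fun i => ?_, fun y => ?_⟩
  · refine contDiff_integral_unitInterval
      (G := fun q : Euc d × ℝ => fderiv ℝ F (c + q.2 • (q.1 - c)) (EuclideanSpace.single i 1)) ?_
    refine (hF'.comp ?_).clm_apply contDiff_const
    fun_prop
  · have hline : Continuous fun t : ℝ => c + t • (y - c) := by fun_prop
    have hc : ∀ v, Continuous fun t : ℝ => fderiv ℝ F (c + t • (y - c)) v := fun v =>
      (hF'.continuous.comp hline).clm_apply continuous_const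
    have h1 : ∫ t in (0 : ℝ)..1, fderiv ℝ F (c + t • (y - c)) (y - c) = F y - F c := by
      have := intervalIntegral.integral_eq_sub_of_hasDerivAt (a := 0) (b := 1)
        (f := fun t : ℝ => F (c + t • (y - c)))
        (f' := fun t => fderiv ℝ F (c + t • (y - c)) (y - c)) (fun t _ => by
          have hl : HasDerivAt (fun t : ℝ => c + t • (y - c)) (y - c) t := by
            simpa using ((hasDerivAt_id t).smul_const (y - c)).const_add c
          exact ((hF.differentiable (by simp)) _).hasFDerivAt.comp_hasDerivAt t hl)
        ((hc _).intervalIntegrable _ _)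
      simpa using this
    have h2 : y - c = ∑ i, (y i - c i) • (EuclideanSpace.single i (1 : ℝ) : Euc d) := by
      have := (EuclideanSpace.basisFun (Fin d) ℝ).sum_repr (y - c)
      simpa using this.symm
    have h3 : ∫ t in (0 : ℝ)..1, fderiv ℝ F (c + t • (y - c)) (y - c)
        = ∑ i, (y i - c i) * ∫ t in (0 : ℝ)..1,
            fderiv ℝ F (c + t • (y - c)) (EuclideanSpace.single i 1) := by
      simp_rw [← intervalIntegral.integral_const_mul]
      rw [← intervalIntegral.integral_finsetSum]
      · congr 1
        ext t
        conv_lhs => rw [h2]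
        rw [map_sum]
        simp_rw [map_smul, smul_eq_mul]
        simp [← h2]
      · exact fun i _ => (continuous_const.mul (hc _)).intervalIntegrable _ _
    rw [← h3, h1]; ring

end Hadamard

/-- A function supported in a compact subset of the domain of a chart has a smooth coordinate
expression on the whole model space. -/
theorem contDiff_extend {d : ℕ} {M : Type*} [TopologicalSpace M]
    {φ : OpenPartialHomeomorph M (Euc d)} {v : Euc d → ℝ} {K : Set M}
    (hK : IsCompact K) (hKφ : K ⊆ φ.source) (hv : ContDiffOn ℝ ∞ v φ.target)
    (h0 : ∀ y, y ∉ φ '' K → v y = 0) : ContDiff ℝ ∞ v := by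
  have hK' : IsCompact (φ '' K) := hK.image_of_continuousOn (φ.continuousOn.mono hKφ)
  rw [contDiff_iff_contDiffAt]
  intro y
  by_cases hy : y ∈ φ '' K
  · obtain ⟨x, hx, rfl⟩ := hy
    exact hv.contDiffAt (φ.open_target.mem_nhds (φ.map_source (hKφ hx)))
  · refine contDiffAt_const (c := (0 : ℝ)) |>.congr_of_eventuallyEq ?_
    filter_upwards [hK'.isClosed.isOpen_compl.mem_nhds hy] with z hz using h0 z hz

/-! ### Smooth functions on M -/

variable {d : ℕ} {M : Type*} [TopologicalSpace M] [ChartedSpace (Euc d) M]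

/-- The algebra of smooth functions on `M`. -/
abbrev Fn (d : ℕ) (M : Type*) [TopologicalSpace M] [ChartedSpace (Euc d) M] : Type _ :=
  C^∞⟮𝓡 d, M; 𝓘(ℝ, ℝ), ℝ⟯

theorem Fn.contDiffOn_chart (f : Fn d M) {φ : OpenPartialHomeomorph M (Euc d)}
    (hφ : φ ∈ maximalAtlas (𝓡 d) ∞ M) : ContDiffOn ℝ ∞ (f ∘ φ.symm) φ.target :=
  contMDiffOn_iff_contDiffOn.mp
    (f.contMDiff.comp_contMDiffOn (contMDiffOn_symm_of_mem_maximalAtlas hφ))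

theorem Fn.mul_apply (f g : Fn d M) (x : M) : (f * g) x = f x * g x := rfl

theorem Fn.smul_apply (c : ℝ) (f : Fn d M) (x : M) : (c • f) x = c * f x := rfl

theorem Fn.sum_apply {ι : Type*} (s : Finset ι) (f : ι → Fn d M) (x : M) :
    (∑ i ∈ s, f i) x = ∑ i ∈ s, f i x :=
  map_sum (ContMDiffMap.evalRingHom (I := 𝓡 d) (n := ∞) (R := ℝ) x) f s

/-- The function `η · (v ∘ φ)`, for `η` supported in the domain of the chart `φ`. -/
def cutoffPull (η : Fn d M) (φ : OpenPartialHomeomorph M (Euc d))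
    (hφ : φ ∈ maximalAtlas (𝓡 d) ∞ M) (hη : tsupport η ⊆ φ.source) (v : Euc d → ℝ)
    (hv : ContDiffOn ℝ ∞ v φ.target) : Fn d M :=
  ⟨fun x => η x * v (φ x), contMDiff_of_tsupport fun x hx => by
    have hx' : x ∈ φ.source := hη (closure_mono (Function.support_mul_subset_left _ _) hx)
    have h1 : ContMDiffAt (𝓡 d) 𝓘(ℝ, ℝ) ∞ (fun x => v (φ x)) x :=
      ((contMDiffOn_iff_contDiffOn.mpr hv).contMDiffAt
        (φ.open_target.mem_nhds (φ.map_source hx'))).comp x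
        ((contMDiffOn_of_mem_maximalAtlas hφ).contMDiffAt (φ.open_source.mem_nhds hx'))
    exact η.contMDiff.contMDiffAt.mul h1⟩

theorem cutoffPull_apply (η : Fn d M) (φ : OpenPartialHomeomorph M (Euc d))
    (hφ : φ ∈ maximalAtlas (𝓡 d) ∞ M) (hη : tsupport η ⊆ φ.source) (v : Euc d → ℝ)
    (hv : ContDiffOn ℝ ∞ v φ.target) (x : M) :
    cutoffPull η φ hφ hη v hv x = η x * v (φ x) := rfl

/-! ### Bump functions and locality of differential operators -/

section Bumps

variable [IsManifold (𝓡 d) ∞ M] [T2Space M] [SigmaCompactSpace M]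

theorem exists_bump {s U : Set M} (hs : IsClosed s) (hU : IsOpen U) (hsU : s ⊆ U) :
    ∃ η : Fn d M, (∀ᶠ x in nhdsSet s, η x = 1) ∧ tsupport η ⊆ U ∧ ∀ x, 0 ≤ η x := by
  have := Manifold.locallyCompact_of_finiteDimensional (M := M) (𝓡 d)
  obtain ⟨V, hV, hsV, hVU⟩ := normal_exists_closure_subset hs hU hsU
  obtain ⟨f, h1, h0, hf⟩ := exists_contMDiffMap_one_nhds_of_subset_interior (𝓡 d)
    (n := ⊤) (t := closure V) hs
    (hsV.trans (interior_maximal subset_closure hV))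
  refine ⟨f, h1, ?_, fun x => (hf x).1⟩
  refine (closure_minimal ?_ isClosed_closure).trans hVU
  intro x hx
  by_contra h
  exact hx (h0 x h)

theorem exists_compact_bump {s U : Set M} (hs : IsCompact s) (hU : IsOpen U) (hsU : s ⊆ U) :
    ∃ η : Fn d M, (∀ᶠ x in nhdsSet s, η x = 1) ∧ tsupport η ⊆ U ∧ HasCompactSupport η ∧
      ∀ x, 0 ≤ η x := by
  have := Manifold.locallyCompact_of_finiteDimensional (M := M) (𝓡 d)
  obtain ⟨L, hL, hsL, hLU⟩ := exists_compact_between hs hU hsU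
  obtain ⟨η, h1, h2, h3⟩ := exists_bump (d := d) hs.isClosed isOpen_interior hsL
  refine ⟨η, h1, (h2.trans interior_subset).trans hLU, ?_, h3⟩
  exact hL.of_isClosed_subset (isClosed_tsupport _) (h2.trans interior_subset)

theorem exists_bump_at {p : M} {U : Set M} (hU : U ∈ nhds p) :
    ∃ η : Fn d M, (∀ᶠ x in nhds p, η x = 1) ∧ tsupport η ⊆ U ∧ HasCompactSupport η ∧
      ∀ x, 0 ≤ η x := by
  obtain ⟨V, hVU, hV, hpV⟩ := mem_nhds_iff.mp hU
  obtain ⟨η, h1, h2, h3⟩ := exists_compact_bump (d := d) isCompact_singleton hV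
    (Set.singleton_subset_iff.mpr hpV)
  rw [nhdsSet_singleton] at h1
  exact ⟨η, h1, h2.trans hVU, h3⟩

/-- Differential operators are local. -/
theorem apply_eq_zero_of_eventuallyEq_zero {k : ℕ} {T : Module.End ℝ (Fn d M)}
    (hT : T ∈ algDiffOp (Fn d M) k) {f : Fn d M} {p : M} (hf : ∀ᶠ x in nhds p, f x = 0) :
    T f p = 0 := by
  induction k generalizing T with
  | zero => rw [mem_commFiltration_zero.mp hT]; rfl
  | succ k ih =>
    -- With b = 1 near p and supported where f vanishes, b f = 0, hence [T, b] f = -b T f. Its value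
    -- at p is -(T f)(p), and [T, b] has smaller order.
    obtain ⟨b, hb1, hb, -⟩ := exists_bump_at (d := d) hf
    have hbf : b * f = 0 := by
      ext x
      by_cases hx : x ∈ tsupport b
      · have : f x = 0 := hb hx
        simp [this]
      · simp [image_eq_zero_of_notMem_tsupport hx]
    have := ih (mem_algDiffOp_succ.mp hT b)
    simp only [LinearMap.sub_apply, Module.End.mul_apply, LinearMap.mulLeft_apply, hbf, map_zero,
      zero_sub] at this
    have h2 : b p * T f p = 0 := neg_eq_zero.mp this
    rwa [hb1.self_of_nhds, one_mul] at h2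

theorem apply_congr_of_eventuallyEq {k : ℕ} {T : Module.End ℝ (Fn d M)}
    (hT : T ∈ algDiffOp (Fn d M) k) {f g : Fn d M} {p : M} (hf : ∀ᶠ x in nhds p, f x = g x) :
    T f p = T g p := by
  have := apply_eq_zero_of_eventuallyEq_zero hT (f := f - g) (p := p)
    (hf.mono fun x hx => sub_eq_zero.mpr hx)
  rw [map_sub] at this
  exact sub_eq_zero.mp this

theorem tsupport_apply_subset {k : ℕ} {T : Module.End ℝ (Fn d M)}
    (hT : T ∈ algDiffOp (Fn d M) k) (f : Fn d M) : tsupport (T f) ⊆ tsupport f := by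
  refine closure_minimal (fun p hp => ?_) (isClosed_tsupport _)
  by_contra h
  refine hp (apply_eq_zero_of_eventuallyEq_zero hT ?_)
  filter_upwards [(isClosed_tsupport f).isOpen_compl.mem_nhds h] with x hx
    using image_eq_zero_of_notMem_tsupport hx

theorem hasCompactSupport_apply {k : ℕ} {T : Module.End ℝ (Fn d M)}
    (hT : T ∈ algDiffOp (Fn d M) k) {f : Fn d M} (hf : HasCompactSupport f) :
    HasCompactSupport (T f) :=
  hf.of_isClosed_subset (isClosed_tsupport _) (tsupport_apply_subset hT f)

/-- Hadamard's lemma in a chart. -/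
theorem exists_hadamard_chart {φ : OpenPartialHomeomorph M (Euc d)}
    (hφ : φ ∈ maximalAtlas (𝓡 d) ∞ M) {p : M} (hp : p ∈ φ.source) (f : Fn d M) :
    ∃ G : Fin d → Fn d M, ∀ᶠ x in nhds p, f x = f p + ∑ i, (φ x i - φ p i) * G i x := by
  obtain ⟨b, hb1, hb, hbc, -⟩ := exists_bump_at (d := d) (φ.open_source.mem_nhds hp)
  classical
  let v : Euc d → ℝ := fun y => if y ∈ φ.target then (b * f) (φ.symm y) else 0
  have hv : ContDiff ℝ ∞ v := by
    refine contDiff_extend (φ := φ) (K := tsupport b) hbc hb ?_ ?_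
    · exact ((b * f).contDiffOn_chart hφ).congr fun y hy => if_pos hy
    · intro y hy
      by_cases hyt : y ∈ φ.target
      · have : φ.symm y ∉ tsupport b := fun h => hy ⟨_, h, φ.right_inv hyt⟩
        change (if y ∈ φ.target then b (φ.symm y) * f (φ.symm y) else 0) = 0
        rw [image_eq_zero_of_notMem_tsupport this]; simp
      · exact if_neg hyt
  obtain ⟨g, hg, hgv⟩ := exists_hadamard hv (φ p)
  refine ⟨fun i => cutoffPull b φ hφ hb (g i) (hg i).contDiffOn, ?_⟩
  have hvx : ∀ x ∈ φ.source, b x = 1 → v (φ x) = f x := by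
    intro x hx hbx
    change (if φ x ∈ φ.target then b (φ.symm (φ x)) * f (φ.symm (φ x)) else 0) = _
    rw [if_pos (φ.map_source hx), φ.left_inv hx, hbx, one_mul]
  filter_upwards [hb1, φ.open_source.mem_nhds hp] with x hx hxs
  rw [← hvx x hxs hx, hgv, hvx p hp hb1.self_of_nhds]
  simp [cutoffPull_apply, hx]

end Bumps

variable {d : ℕ} {M : Type*} [TopologicalSpace M] [ChartedSpace (Euc d) M]

/-! ### Trivialization of densities by a volume form -/

section Trivialization

/-- A smooth function as a density of weight zero. -/
def Fn.toDensity (f : Fn d M) : Density d M 0 :=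
  ⟨fun p => f (p.1.1.symm p.1.2), by
    have hc : ∀ φ ∈ maximalAtlas (𝓡 d) ∞ M, ∀ y ∈ φ.target,
        localCoeff (fun p : LocalPoint d M => f (p.1.1.symm p.1.2)) φ y = f (φ.symm y) :=
      fun φ hφ y hy => coeff_apply _ hφ hy
    refine ⟨fun φ hφ ψ hψ y hy => ?_, fun φ hφ => (f.contDiffOn_chart hφ).congr (hc φ hφ)⟩
    have hy1 : y ∈ φ.target ∧ φ.symm y ∈ ψ.source := by simpa using hy
    rw [hc φ hφ y hy1.1, hc ψ hψ (transition φ ψ y) (ψ.map_source hy1.2)]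
    simp [transition, hy1.2]⟩

theorem Fn.differentiableAt_chart (f : Fn d M) {φ : OpenPartialHomeomorph M (Euc d)}
    (hφ : φ ∈ maximalAtlas (𝓡 d) ∞ M) {y : Euc d} (hy : y ∈ φ.target) :
    DifferentiableAt ℝ (f ∘ φ.symm) y :=
  ((f.contDiffOn_chart hφ).contDiffAt (φ.open_target.mem_nhds hy)).differentiableAt (by simp)

theorem localCoeff_pos (ρ : VolumeForm d M)
    {φ : OpenPartialHomeomorph M (Euc d)} (hφ : φ ∈ maximalAtlas (𝓡 d) ∞ M) {y : Euc d}
    (hy : y ∈ φ.target) : 0 < localCoeff ρ.toDensity.1 φ y := by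
  rw [coeff_apply _ hφ hy]; exact ρ.pos _

theorem VolumeForm.shift_apply (ρ : VolumeForm d M) (a b : ℝ) (s : Density d M a)
    (p : LocalPoint d M) : (ρ.shift a b s).1 p = ρ.toDensity.1 p ^ (b - a) * s.1 p := rfl

theorem VolumeForm.shift_shift (ρ : VolumeForm d M) (a b c : ℝ) (s : Density d M a) :
    ρ.shift b c (ρ.shift a b s) = ρ.shift a c s := by
  refine Subtype.ext (funext fun p => ?_)
  rw [ρ.shift_apply, ρ.shift_apply, ρ.shift_apply, ← mul_assoc, ← Real.rpow_add (ρ.pos p)]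
  ring_nf

theorem VolumeForm.shift_self (ρ : VolumeForm d M) (a : ℝ) (s : Density d M a) :
    ρ.shift a a s = s := by
  refine Subtype.ext (funext fun p => ?_)
  rw [ρ.shift_apply, sub_self, Real.rpow_zero, one_mul]

variable [IsManifold (𝓡 d) ∞ M]

/-- The preferred local coordinates of a point. -/
def basePoint (d : ℕ) {M : Type*} [TopologicalSpace M] [ChartedSpace (Euc d) M]
    [IsManifold (𝓡 d) ∞ M] (x : M) : LocalPoint d M :=
  ⟨(chartAt (Euc d) x, chartAt (Euc d) x x), chart_mem_maximalAtlas x,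
    (chartAt (Euc d) x).map_source (mem_chart_source _ x)⟩

/-- In weight zero the Jacobian factor is 1, so the coefficient depends only on the underlying point
of M. -/
theorem density_zero_transform (s : Density d M 0) (p : LocalPoint d M) :
    s.1 p = s.1 (basePoint d (p.1.1.symm p.1.2)) := by
  obtain ⟨⟨φ, y⟩, hφ, hy⟩ := p
  have hs : φ.symm y ∈ (chartAt (Euc d) (φ.symm y)).source := mem_chart_source _ _
  have := s.2.transform φ hφ (chartAt (Euc d) (φ.symm y)) (chart_mem_maximalAtlas _) y
    (by rw [OpenPartialHomeomorph.trans_source]; exact ⟨hy, hs⟩)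
  rw [Real.rpow_zero, one_mul, coeff_apply _ hφ hy, coeff_apply (y := transition _ _ y) _
    (chart_mem_maximalAtlas _) ((chartAt (Euc d) (φ.symm y)).map_source hs)] at this
  exact this

/-- The smooth function given by a density of weight zero. -/
def Fn.ofDensity (s : Density d M 0) : Fn d M :=
  ⟨fun x => s.1 (basePoint d x), fun x => by
    have hx := mem_chart_source (Euc d) x
    have hφ : chartAt (Euc d) x ∈ maximalAtlas (𝓡 d) ∞ M := chart_mem_maximalAtlas x
    have h1 : ContMDiffAt (𝓡 d) 𝓘(ℝ, ℝ) ∞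
        (fun z => localCoeff s.1 (chartAt (Euc d) x) (chartAt (Euc d) x z)) x :=
      ((contMDiffOn_iff_contDiffOn.mpr (s.2.smooth _ hφ)).contMDiffAt
        ((chartAt (Euc d) x).open_target.mem_nhds ((chartAt (Euc d) x).map_source hx))).comp x
        ((contMDiffOn_of_mem_maximalAtlas hφ).contMDiffAt
          ((chartAt (Euc d) x).open_source.mem_nhds hx))
    refine h1.congr_of_eventuallyEq ?_
    filter_upwards [(chartAt (Euc d) x).open_source.mem_nhds hx] with z hz
    rw [coeff_apply _ hφ ((chartAt (Euc d) x).map_source hz)]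
    exact (congrArg (fun w => s.1 (basePoint d w)) ((chartAt (Euc d) x).left_inv hz).symm).trans
      (density_zero_transform s ⟨(chartAt (Euc d) x, chartAt (Euc d) x z), hφ,
        (chartAt (Euc d) x).map_source hz⟩).symm⟩

theorem basePoint_symm (x : M) : (basePoint d x).1.1.symm (basePoint d x).1.2 = x :=
  (chartAt (Euc d) x).left_inv (mem_chart_source _ x)

/-- Smooth functions are the densities of weight zero. -/
def fnEquiv (d : ℕ) (M : Type*) [TopologicalSpace M] [ChartedSpace (Euc d) M]
    [IsManifold (𝓡 d) ∞ M] : Fn d M ≃ₗ[ℝ] Density d M 0 where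
  toFun := Fn.toDensity
  invFun := Fn.ofDensity
  map_add' _ _ := rfl
  map_smul' _ _ := rfl
  left_inv f := by
    ext x
    exact congrArg f (basePoint_symm x)
  right_inv s := Subtype.ext (funext fun p => (density_zero_transform s p).symm)

/-- The isomorphism `s ↦ ρ^(b - a) s`. -/
def VolumeForm.shiftEquiv (ρ : VolumeForm d M) (a b : ℝ) : Density d M a ≃ₗ[ℝ] Density d M b :=
  { ρ.shift a b with
    invFun := ρ.shift b a
    left_inv := fun s => by
      refine (ρ.shift_shift a b a s).trans (ρ.shift_self a s)
    right_inv := fun s => by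
      refine (ρ.shift_shift b a b s).trans (ρ.shift_self b s) }

/-- The identification of functions with densities of weight `a` by means of a volume form,
`f ↦ ρ^a f`. -/
def VolumeForm.triv (ρ : VolumeForm d M) (a : ℝ) : Fn d M ≃ₗ[ℝ] Density d M a :=
  (fnEquiv d M).trans (ρ.shiftEquiv 0 a)

theorem VolumeForm.triv_apply (ρ : VolumeForm d M) (a : ℝ) (f : Fn d M) (p : LocalPoint d M) :
    (ρ.triv a f).1 p = ρ.toDensity.1 p ^ a * f (p.1.1.symm p.1.2) := by
  change ρ.toDensity.1 p ^ (a - 0) * _ = _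
  rw [sub_zero]; rfl

theorem VolumeForm.triv_eq_shift (ρ : VolumeForm d M) (a : ℝ) (f : Fn d M) :
    ρ.triv a f = ρ.shift 0 a (fnEquiv d M f) := rfl

theorem VolumeForm.shift_triv (ρ : VolumeForm d M) (a b : ℝ) (f : Fn d M) :
    ρ.shift a b (ρ.triv a f) = ρ.triv b f := by
  rw [triv_eq_shift, triv_eq_shift, shift_shift]

theorem VolumeForm.triv_zero (ρ : VolumeForm d M) (f : Fn d M) :
    ρ.triv 0 f = fnEquiv d M f := by
  rw [triv_eq_shift, shift_self]

theorem VolumeForm.triv_symm_apply (ρ : VolumeForm d M) (a : ℝ) (s : Density d M a) (x : M) :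
    (ρ.triv a).symm s x = ρ.toDensity.1 (basePoint d x) ^ (-a) * s.1 (basePoint d x) := by
  obtain ⟨f, rfl⟩ := (ρ.triv a).surjective s
  rw [LinearEquiv.symm_apply_apply, triv_apply, ← mul_assoc, ← Real.rpow_add (ρ.pos _),
    neg_add_cancel, Real.rpow_zero, one_mul, basePoint_symm]

theorem mulFun_triv (ρ : VolumeForm d M) (a : ℝ) (g f : Fn d M) :
    mulFun (fnEquiv d M g) a (ρ.triv a f) = ρ.triv a (g * f) := by
  refine Subtype.ext (funext fun p => ?_)
  change g _ * (ρ.triv a f).1 p = _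
  rw [ρ.triv_apply, ρ.triv_apply, Fn.mul_apply]; ring

theorem triv_mul_triv (ρ : VolumeForm d M) (a b : ℝ) (f g : Fn d M) :
    (ρ.triv a f).1 * (ρ.triv b g).1 = (ρ.triv (a + b) (f * g)).1 := by
  funext p
  rw [Pi.mul_apply, ρ.triv_apply, ρ.triv_apply, ρ.triv_apply, Fn.mul_apply,
    Real.rpow_add (ρ.pos p)]
  ring

theorem localCoeff_triv (ρ : VolumeForm d M) (a : ℝ) (f : Fn d M)
    {φ : OpenPartialHomeomorph M (Euc d)} (hφ : φ ∈ maximalAtlas (𝓡 d) ∞ M) {y : Euc d}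
    (hy : y ∈ φ.target) :
    localCoeff (ρ.triv a f).1 φ y = localCoeff ρ.toDensity.1 φ y ^ a * f (φ.symm y) := by
  rw [coeff_apply _ hφ hy, coeff_apply _ hφ hy, ρ.triv_apply]

/-- Multiplication by a function is the same operator in every trivialization, so the order on
densities of weight a is the order on functions. -/
theorem mem_diffOp_iff (ρ : VolumeForm d M) (n : ℕ) (a : ℝ) (T : Module.End ℝ (Fn d M)) :
    (ρ.triv a).conj T ∈ DiffOp d M n a ↔ T ∈ algDiffOp (Fn d M) (n + 1) := by
  refine conj_mem_commFiltration_iff (ρ.triv a) ?_ _ _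
  have h : ∀ g, (ρ.triv a).conj (mulOp g) = mulFun (fnEquiv d M g) a := by
    intro g
    ext1 s
    obtain ⟨f, rfl⟩ := (ρ.triv a).surjective s
    rw [LinearEquiv.conj_apply_apply, LinearEquiv.symm_apply_apply, mulFun_triv]
    rfl
  ext D
  constructor
  · rintro ⟨_, ⟨g, rfl⟩, rfl⟩
    exact ⟨fnEquiv d M g, (h g).symm⟩
  · rintro ⟨s, rfl⟩
    obtain ⟨g, rfl⟩ := (fnEquiv d M).surjective s
    exact ⟨_, ⟨g, rfl⟩, h g⟩

end Trivialization

/-! ### Lie derivatives, divergence and coordinate vector fields -/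

section LieDerivative

variable [IsManifold (𝓡 d) ∞ M]

theorem lieDeriv_apply (K : VectorField d M) (a : ℝ) (s : Density d M a) (p : LocalPoint d M) :
    (lieDeriv K a s).1 p = fderiv ℝ (localCoeff s.1 p.1.1) p.1.2 (localField K p.1.1 p.1.2)
    + a * LinearMap.trace ℝ (Euc d) (fderiv ℝ (localField K p.1.1) p.1.2).toLinearMap * s.1 p :=
  rfl

/-- The derivative of a function along a vector field. -/
def vfDerivFun (K : VectorField d M) (f : Fn d M) : Fn d M :=
  (fnEquiv d M).symm (lieDeriv K 0 (fnEquiv d M f))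

theorem fderiv_localCoeff_fnEquiv (f : Fn d M) {φ : OpenPartialHomeomorph M (Euc d)}
    (hφ : φ ∈ maximalAtlas (𝓡 d) ∞ M) {y : Euc d} (hy : y ∈ φ.target) :
    fderiv ℝ (localCoeff (fnEquiv d M f).1 φ) y = fderiv ℝ (f ∘ φ.symm) y := by
  refine Filter.EventuallyEq.fderiv_eq ?_
  filter_upwards [φ.open_target.mem_nhds hy] with z hz
  rw [coeff_apply _ hφ hz]; rfl

theorem vfDerivFun_symm_apply (K : VectorField d M) (f : Fn d M)
    {φ : OpenPartialHomeomorph M (Euc d)}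
    (hφ : φ ∈ maximalAtlas (𝓡 d) ∞ M) {y : Euc d} (hy : y ∈ φ.target) :
    vfDerivFun K f (φ.symm y) = fderiv ℝ (f ∘ φ.symm) y (localField K φ y) := by
  have h : fnEquiv d M (vfDerivFun K f) = lieDeriv K 0 (fnEquiv d M f) :=
    LinearEquiv.apply_symm_apply _ _
  have h2 := congrArg (fun s : Density d M 0 => s.1 ⟨(φ, y), hφ, hy⟩) h
  simp only [lieDeriv_apply, zero_mul, add_zero] at h2
  rw [fderiv_localCoeff_fnEquiv f hφ hy] at h2
  exact h2

/-- The derivation of the algebra of functions given by a vector field. -/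
def vfDeriv (K : VectorField d M) : Derivation ℝ (Fn d M) (Fn d M) where
  toFun := vfDerivFun K
  map_add' f g := by simp [vfDerivFun]
  map_smul' c f := by simp [vfDerivFun]
  map_one_eq_zero' := by
    ext x
    have hy := (basePoint d x).2.2
    rw [← basePoint_symm (d := d) x]
    change vfDerivFun K 1 _ = 0
    rw [vfDerivFun_symm_apply K 1 (basePoint d x).2.1 hy]
    have : ((1 : Fn d M) ∘ (basePoint d x).1.1.symm : Euc d → ℝ) = fun _ => 1 := rfl
    rw [this]; simp
  leibniz' f g := by
    ext x
    have hy := (basePoint d x).2.2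
    have hφ := (basePoint d x).2.1
    rw [← basePoint_symm (d := d) x]
    change vfDerivFun K (f * g) _ = f _ * vfDerivFun K g _ + g _ * vfDerivFun K f _
    rw [vfDerivFun_symm_apply K _ hφ hy, vfDerivFun_symm_apply K _ hφ hy,
      vfDerivFun_symm_apply K _ hφ hy]
    have : ((f * g : Fn d M) ∘ (basePoint d x).1.1.symm : Euc d → ℝ)
        = (f ∘ (basePoint d x).1.1.symm) * (g ∘ (basePoint d x).1.1.symm) := rfl
    rw [this, fderiv_mul (f.differentiableAt_chart hφ hy) (g.differentiableAt_chart hφ hy)]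
    simp

theorem vfDeriv_symm_apply (K : VectorField d M) (f : Fn d M)
    {φ : OpenPartialHomeomorph M (Euc d)}
    (hφ : φ ∈ maximalAtlas (𝓡 d) ∞ M) {y : Euc d} (hy : y ∈ φ.target) :
    vfDeriv K f (φ.symm y) = fderiv ℝ (f ∘ φ.symm) y (localField K φ y) :=
  vfDerivFun_symm_apply K f hφ hy

/-- The divergence of a vector field with respect to a volume form. -/
def VolumeForm.div (ρ : VolumeForm d M) (K : VectorField d M) : Fn d M :=
  (ρ.triv 1).symm (lieDeriv K 1 ρ.toDensity)

theorem VolumeForm.div_symm_apply (ρ : VolumeForm d M) (K : VectorField d M)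
    {φ : OpenPartialHomeomorph M (Euc d)}
    (hφ : φ ∈ maximalAtlas (𝓡 d) ∞ M) {y : Euc d} (hy : y ∈ φ.target) :
    localCoeff ρ.toDensity.1 φ y * ρ.div K (φ.symm y)
      = fderiv ℝ (localCoeff ρ.toDensity.1 φ) y (localField K φ y)
        + LinearMap.trace ℝ (Euc d) (fderiv ℝ (localField K φ) y).toLinearMap
          * localCoeff ρ.toDensity.1 φ y := by
  have h : ρ.triv 1 (ρ.div K) = lieDeriv K 1 ρ.toDensity := LinearEquiv.apply_symm_apply _ _
  have h2 := congrArg (fun s : Density d M 1 => s.1 ⟨(φ, y), hφ, hy⟩) h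
  simp only [lieDeriv_apply, ρ.triv_apply, Real.rpow_one, one_mul] at h2
  rw [coeff_apply _ hφ hy]
  exact h2

/-- The derivative of ρ^a and the trace term of the Lie derivative combine into a div K. After
trivialization the weight thus enters affinely, with slope the divergence. -/
theorem lieDeriv_triv (ρ : VolumeForm d M) (K : VectorField d M) (a : ℝ) (f : Fn d M) :
    lieDeriv K a (ρ.triv a f) = ρ.triv a (vfDeriv K f + a • (ρ.div K * f)) := by
  refine Subtype.ext (funext fun p => ?_)
  obtain ⟨⟨φ, y⟩, hφ, hy⟩ := p
  have hr := localCoeff_pos ρ hφ hy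
  have hd : DifferentiableAt ℝ (localCoeff ρ.toDensity.1 φ) y :=
    ((ρ.toDensity.2.smooth φ hφ).contDiffAt (φ.open_target.mem_nhds hy)).differentiableAt (by simp)
  have hev : localCoeff (ρ.triv a f).1 φ =ᶠ[nhds y]
      fun z => localCoeff ρ.toDensity.1 φ z ^ a * (f ∘ φ.symm) z := by
    filter_upwards [φ.open_target.mem_nhds hy] with z hz using localCoeff_triv ρ a f hφ hz
  have hD := ((hd.hasFDerivAt.rpow_const (p := a) (Or.inl hr.ne')).mul
    (f.differentiableAt_chart hφ hy).hasFDerivAt).congr_of_eventuallyEq hev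
  rw [lieDeriv_apply, ρ.triv_apply, ρ.triv_apply]
  simp only
  rw [hD.fderiv]
  change _ = _ * (vfDeriv K f (φ.symm y) + a * (ρ.div K (φ.symm y) * f (φ.symm y)))
  rw [vfDeriv_symm_apply K f hφ hy]
  have hdiv := ρ.div_symm_apply K hφ hy
  rw [← coeff_apply ρ.toDensity.1 hφ hy]
  set r := localCoeff ρ.toDensity.1 φ y
  have hra : r ^ a = r ^ (a - 1) * r := by
    rw [← Real.rpow_add_one hr.ne']; ring_nf
  simp only [add_apply, smul_apply, smul_eq_mul, Function.comp_apply]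
  rw [hra]
  linear_combination (-(a * r ^ (a - 1) * f (φ.symm y))) * hdiv

/-- The vector field with components `η V` in the chart `φ`. -/
def chartField (η : Fn d M) (φ : OpenPartialHomeomorph M (Euc d))
    (hφ : φ ∈ maximalAtlas (𝓡 d) ∞ M) (hη : tsupport η ⊆ φ.source) (V : Euc d → Euc d)
    (hV : ContDiffOn ℝ ∞ V φ.target) : VectorField d M :=
  ⟨(η : M → ℝ) • fun x => mfderiv (𝓡 d) (𝓡 d) φ.symm (φ x) (V (φ x)), by
    refine ContMDiffOn.smul_section_of_tsupport η.contMDiff.contMDiffOn φ.open_source hη ?_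
    have h1 : ContMDiffOn (𝓡 d) (𝓡 d).tangent ∞
        (fun y => (⟨y, V y⟩ : TangentBundle (𝓡 d) (Euc d))) φ.target :=
      contMDiffOn_vectorSpace_iff_contDiffOn.mpr hV
    have h2 := (contMDiffOn_symm_of_mem_maximalAtlas hφ).contMDiffOn_tangentMapWithin (m := ∞)
      le_rfl φ.open_target.uniqueMDiffOn
    have h3 := (h2.comp h1 (fun y hy => hy)).comp (contMDiffOn_of_mem_maximalAtlas hφ)
      (fun x hx => φ.map_source hx)
    refine h3.congr fun x hx => ?_
    have e : tangentMapWithin (𝓡 d) (𝓡 d) φ.symm φ.target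
        (⟨φ x, V (φ x)⟩ : TangentBundle (𝓡 d) (Euc d))
        = ⟨φ.symm (φ x), mfderiv (𝓡 d) (𝓡 d) φ.symm (φ x) (V (φ x))⟩ := by
      rw [tangentMapWithin, mfderivWithin_of_mem_nhds (φ.open_target.mem_nhds (φ.map_source hx))]
    rw [Function.comp_apply, Function.comp_apply, e, φ.left_inv hx]⟩

theorem localField_chartField (η : Fn d M) (φ : OpenPartialHomeomorph M (Euc d))
    (hφ : φ ∈ maximalAtlas (𝓡 d) ∞ M) (hη : tsupport η ⊆ φ.source) (V : Euc d → Euc d)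
    (hV : ContDiffOn ℝ ∞ V φ.target) {y : Euc d} (hy : y ∈ φ.target) :
    localField (chartField η φ hφ hη V hV) φ y = η (φ.symm y) • V y := by
  have h1 : MDifferentiableAt (𝓡 d) (𝓡 d) φ (φ.symm y) :=
    (contMDiffAt_of_mem_maximalAtlas hφ (φ.map_target hy)).mdifferentiableAt (by simp)
  have h2 : MDifferentiableAt (𝓡 d) (𝓡 d) φ.symm y :=
    ((contMDiffOn_symm_of_mem_maximalAtlas hφ).contMDiffAt
      (φ.open_target.mem_nhds hy)).mdifferentiableAt (by simp)
  have h3 : (φ ∘ φ.symm) =ᶠ[nhds y] id := by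
    filter_upwards [φ.open_target.mem_nhds hy] with z hz using φ.right_inv hz
  have h4 := h3.mfderiv_eq (I := 𝓡 d) (I' := 𝓡 d)
  rw [mfderiv_comp y h1 h2, mfderiv_id] at h4
  change mfderiv (𝓡 d) (𝓡 d) φ (φ.symm y)
    (η (φ.symm y) • mfderiv (𝓡 d) (𝓡 d) φ.symm (φ (φ.symm y)) (V (φ (φ.symm y)))) = _
  let h : Euc d → Euc d := fun z => mfderiv (𝓡 d) (𝓡 d) φ.symm z (V z)
  have h5 : h (φ (φ.symm y)) = h y := by rw [φ.right_inv hy]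
  have h6 : mfderiv (𝓡 d) (𝓡 d) φ (φ.symm y) (h y) = V y := DFunLike.congr_fun h4 (V y)
  refine ((mfderiv (𝓡 d) (𝓡 d) φ (φ.symm y)).map_smul _ (h (φ (φ.symm y)))).trans ?_
  rw [h5]
  exact congrArg (fun z : Euc d => η (φ.symm y) • z) h6

end LieDerivative

/-! ### Integration of densities and the divergence theorem -/

section Integral
open MeasureTheory

variable {d : ℕ} {M : Type*} [TopologicalSpace M] [ChartedSpace (Euc d) M]
  [IsManifold (𝓡 d) ∞ M]

/-- The integral of the density `ρ f` in the coordinates `φ`. -/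
def VolumeForm.chartInt (ρ : VolumeForm d M) (φ : OpenPartialHomeomorph M (Euc d)) (f : Fn d M) :
    ℝ :=
  ∫ y, localCoeff (ρ.triv 1 f).1 φ y

theorem localCoeff_of_notMem (s : LocalPoint d M → ℝ) {φ : OpenPartialHomeomorph M (Euc d)}
    {y : Euc d} (hy : y ∉ φ.target) : localCoeff s φ y = 0 :=
  dif_neg fun h => hy h.2

theorem localCoeff_triv_eq_zero (ρ : VolumeForm d M) (a : ℝ) (f : Fn d M)
    {φ : OpenPartialHomeomorph M (Euc d)} (hφ : φ ∈ maximalAtlas (𝓡 d) ∞ M) {y : Euc d}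
    (hy : y ∈ φ.target → f (φ.symm y) = 0) : localCoeff (ρ.triv a f).1 φ y = 0 := by
  by_cases h : y ∈ φ.target
  · rw [localCoeff_triv ρ a f hφ h, hy h, mul_zero]
  · exact localCoeff_of_notMem _ h

/-- Both integrals live on the overlap of the two charts, and the transformation law in weight one
supplies exactly the Jacobian of the change of variables. -/
theorem chartInt_eq_chartInt (ρ : VolumeForm d M) {φ ψ : OpenPartialHomeomorph M (Euc d)}
    (hφ : φ ∈ maximalAtlas (𝓡 d) ∞ M) (hψ : ψ ∈ maximalAtlas (𝓡 d) ∞ M) {f : Fn d M}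
    (hf : ∀ x, f x ≠ 0 → x ∈ φ.source ∧ x ∈ ψ.source) :
    ρ.chartInt φ f = ρ.chartInt ψ f := by
  have hS : ∀ {φ ψ : OpenPartialHomeomorph M (Euc d)} (_ : φ ∈ maximalAtlas (𝓡 d) ∞ M)
      (_ : ∀ x, f x ≠ 0 → x ∈ ψ.source),
      ∫ y in (φ.symm.trans ψ).source, localCoeff (ρ.triv 1 f).1 φ y = ρ.chartInt φ f := by
    intro φ ψ hφ h
    refine setIntegral_eq_integral_of_forall_compl_eq_zero fun y hy => ?_
    refine localCoeff_triv_eq_zero ρ 1 f hφ fun hyt => ?_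
    by_contra h0
    exact hy (by rw [OpenPartialHomeomorph.trans_source]; exact ⟨hyt, h _ h0⟩)
  rw [← hS (ψ := ψ) hφ fun x hx => (hf x hx).2, ← hS (ψ := φ) hψ fun x hx => (hf x hx).1]
  have himg : transition φ ψ '' (φ.symm.trans ψ).source = (ψ.symm.trans φ).source := by
    have h := (φ.symm.trans ψ).image_source_eq_target
    have h2 : (φ.symm.trans ψ).target = (ψ.symm.trans φ).source := by
      rw [← OpenPartialHomeomorph.symm_source, OpenPartialHomeomorph.trans_symm_eq_symm_trans_symm,
        OpenPartialHomeomorph.symm_symm]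
    rw [← h2, ← h]
    rfl
  rw [← himg]
  have hopen := (φ.symm.trans ψ).open_source
  rw [integral_image_eq_integral_abs_det_fderiv_smul volume hopen.measurableSet
    (f' := fun y => fderiv ℝ (transition φ ψ) y) (fun y hy =>
      (((transition_contDiffOn hφ hψ).contDiffAt (hopen.mem_nhds hy)).differentiableAt
        (by simp)).hasFDerivAt.hasFDerivWithinAt) (φ.symm.trans ψ).injOn]
  refine setIntegral_congr_fun hopen.measurableSet fun y hy => ?_
  simp only [smul_eq_mul]
  rw [(ρ.triv 1 f).2.transform φ hφ ψ hψ y hy, Real.rpow_one]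

theorem integrable_of_contDiffOn {φ : OpenPartialHomeomorph M (Euc d)} {v : Euc d → ℝ} {K : Set M}
    (hK : IsCompact K) (hKφ : K ⊆ φ.source) (hv : ContDiffOn ℝ ∞ v φ.target)
    (h0 : ∀ y, y ∉ φ '' K → v y = 0) : Integrable v := by
  have hK' : IsCompact (φ '' K) := hK.image_of_continuousOn (φ.continuousOn.mono hKφ)
  exact (contDiff_extend hK hKφ hv h0).continuous.integrable_of_hasCompactSupport
    (HasCompactSupport.intro hK' h0)

theorem localCoeff_triv_eq_zero_of_notMem (ρ : VolumeForm d M) (a : ℝ) (f : Fn d M)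
    {φ : OpenPartialHomeomorph M (Euc d)} (hφ : φ ∈ maximalAtlas (𝓡 d) ∞ M) {y : Euc d}
    (hy : y ∉ φ '' tsupport f) : localCoeff (ρ.triv a f).1 φ y = 0 := by
  refine localCoeff_triv_eq_zero ρ a f hφ fun h => ?_
  by_contra h0
  exact hy ⟨φ.symm y, subset_tsupport _ h0, φ.right_inv h⟩

theorem contDiff_localCoeff_triv (ρ : VolumeForm d M) (a : ℝ) {f : Fn d M}
    {φ : OpenPartialHomeomorph M (Euc d)} (hφ : φ ∈ maximalAtlas (𝓡 d) ∞ M)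
    (hf : HasCompactSupport f) (hfφ : tsupport f ⊆ φ.source) :
    ContDiff ℝ ∞ (localCoeff (ρ.triv a f).1 φ) :=
  contDiff_extend hf hfφ ((ρ.triv a f).2.smooth φ hφ)
    fun _ hy => localCoeff_triv_eq_zero_of_notMem ρ a f hφ hy

theorem integrable_localCoeff_triv (ρ : VolumeForm d M) (a : ℝ) {f : Fn d M}
    {φ : OpenPartialHomeomorph M (Euc d)} (hφ : φ ∈ maximalAtlas (𝓡 d) ∞ M)
    (hf : HasCompactSupport f) (hfφ : tsupport f ⊆ φ.source) :
    Integrable (localCoeff (ρ.triv a f).1 φ) :=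
  integrable_of_contDiffOn hf hfφ ((ρ.triv a f).2.smooth φ hφ)
    fun _ hy => localCoeff_triv_eq_zero_of_notMem ρ a f hφ hy

theorem localCoeff_add (s t : LocalPoint d M → ℝ) (φ : OpenPartialHomeomorph M (Euc d))
    (y : Euc d) : localCoeff (s + t) φ y = localCoeff s φ y + localCoeff t φ y := by
  unfold localCoeff; split_ifs <;> simp

theorem localCoeff_smul (c : ℝ) (s : LocalPoint d M → ℝ) (φ : OpenPartialHomeomorph M (Euc d))
    (y : Euc d) : localCoeff (c • s) φ y = c * localCoeff s φ y := by
  unfold localCoeff; split_ifs <;> simp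

theorem chartInt_add (ρ : VolumeForm d M) {φ : OpenPartialHomeomorph M (Euc d)}
    (hφ : φ ∈ maximalAtlas (𝓡 d) ∞ M) {f g : Fn d M}
    (hf : HasCompactSupport f) (hfφ : tsupport f ⊆ φ.source)
    (hg : HasCompactSupport g) (hgφ : tsupport g ⊆ φ.source) :
    ρ.chartInt φ (f + g) = ρ.chartInt φ f + ρ.chartInt φ g := by
  unfold VolumeForm.chartInt
  rw [← integral_add (integrable_localCoeff_triv ρ 1 hφ hf hfφ)
    (integrable_localCoeff_triv ρ 1 hφ hg hgφ)]
  congr 1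
  ext y
  rw [map_add]
  exact localCoeff_add _ _ _ _

theorem chartInt_smul (ρ : VolumeForm d M) (φ : OpenPartialHomeomorph M (Euc d)) (c : ℝ)
    (f : Fn d M) : ρ.chartInt φ (c • f) = c * ρ.chartInt φ f := by
  unfold VolumeForm.chartInt
  rw [← integral_const_mul]
  congr 1
  ext y
  rw [map_smul]
  exact localCoeff_smul _ _ _ _

theorem chartInt_zero (ρ : VolumeForm d M) (φ : OpenPartialHomeomorph M (Euc d)) :
    ρ.chartInt φ 0 = 0 := by
  have := chartInt_smul ρ φ 0 0
  rwa [zero_smul, zero_mul] at this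

theorem trace_eq_sum (A : Euc d →L[ℝ] Euc d) :
    LinearMap.trace ℝ (Euc d) A.toLinearMap = ∑ i, A (EuclideanSpace.single i 1) i := by
  rw [LinearMap.trace_eq_matrix_trace ℝ (EuclideanSpace.basisFun (Fin d) ℝ).toBasis, Matrix.trace]
  refine Finset.sum_congr rfl fun i _ => ?_
  simp [LinearMap.toMatrix_apply]

/-- The divergence theorem for densities supported in a chart. -/
theorem integral_lieDeriv_chart (ρ : VolumeForm d M) (K : VectorField d M) {f : Fn d M}
    {φ : OpenPartialHomeomorph M (Euc d)} (hφ : φ ∈ maximalAtlas (𝓡 d) ∞ M)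
    (hf : HasCompactSupport f) (hfφ : tsupport f ⊆ φ.source) :
    ∫ y, localCoeff (lieDeriv K 1 (ρ.triv 1 f)).1 φ y = 0 := by
  obtain ⟨u, hu⟩ : ∃ u, u = localCoeff (ρ.triv 1 f).1 φ := ⟨_, rfl⟩
  have hus : ContDiff ℝ ∞ u := hu ▸ contDiff_localCoeff_triv ρ 1 hφ hf hfφ
  have hu0 : ∀ y ∉ φ '' tsupport f, u y = 0 :=
    fun y hy => hu ▸ localCoeff_triv_eq_zero_of_notMem ρ 1 f hφ hy
  have hcomp : IsCompact (φ '' tsupport f) :=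
    hf.isCompact.image_of_continuousOn (φ.continuousOn.mono hfφ)
  have hdu0 : ∀ y ∉ φ '' tsupport f, fderiv ℝ u y = 0 := by
    intro y hy
    have : u =ᶠ[nhds y] fun _ => 0 := by
      filter_upwards [hcomp.isClosed.isOpen_compl.mem_nhds hy] with z hz using hu0 z hz
    rw [this.fderiv_eq]; simp
  have hut : tsupport u ⊆ φ '' tsupport f := by
    refine closure_minimal (fun y hy => ?_) hcomp.isClosed
    by_contra h
    exact hy (hu0 y h)
  have himg : φ '' tsupport f ⊆ φ.target := by
    rintro _ ⟨x, hx, rfl⟩; exact φ.map_source (hfφ hx)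
  obtain ⟨V, hV⟩ : ∃ V, V = localField K φ := ⟨_, rfl⟩
  have hVs : ContDiffOn ℝ ∞ V φ.target := hV ▸ localField_smooth K hφ
  have hVi : ∀ i, ContDiffOn ℝ ∞ (fun y => V y i) φ.target := fun i => by
    have : ContDiff ℝ ∞ fun w : Euc d => w i := by fun_prop
    exact this.comp_contDiffOn hVs
  have hV' : ∀ i, ContDiffOn ℝ ∞ (fun y => fderiv ℝ (fun z => V z i) y
      (EuclideanSpace.single i 1)) φ.target := fun i =>
    ((hVi i).fderiv_of_isOpen φ.open_target le_rfl).clm_apply contDiffOn_const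
  have hu' : ∀ i, ContDiff ℝ ∞ (fun y => fderiv ℝ u y (EuclideanSpace.single i (1 : ℝ))) :=
    fun i => (hus.fderiv_right (m := ∞) le_rfl).clm_apply contDiff_const
  have hint1 : ∀ i, Integrable (fun y => fderiv ℝ u y (EuclideanSpace.single i 1) * V y i) :=
    fun i => integrable_of_contDiffOn hf hfφ ((hu' i).contDiffOn.mul (hVi i))
      fun y hy => by simp [hdu0 y hy]
  have hint2 : ∀ i, Integrable (fun y => u y * fderiv ℝ (fun z => V z i) y
      (EuclideanSpace.single i 1)) :=
    fun i => integrable_of_contDiffOn hf hfφ (hus.contDiffOn.mul (hV' i))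
      fun y hy => by simp [hu0 y hy]
  have hint3 : ∀ i, Integrable (fun y => u y * V y i) :=
    fun i => integrable_of_contDiffOn hf hfφ (hus.contDiffOn.mul (hVi i))
      fun y hy => by simp [hu0 y hy]
  -- The components of V are smooth only on the range of the chart, which is enough for integration
  -- by parts because it contains the support of u.
  have hparts : ∀ i, ∫ y, u y * fderiv ℝ (fun z => V z i) y (EuclideanSpace.single i 1)
      = -∫ y, fderiv ℝ u y (EuclideanSpace.single i 1) * V y i := fun i =>
    integral_mul_fderiv_eq_neg_fderiv_mul_of_integrable (hint1 i) (hint2 i) (hint3 i)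
      (fun y _ => hus.differentiable (by simp) y)
      (fun y hy => ((hVi i).contDiffAt (φ.open_target.mem_nhds
        (himg (hut hy)))).differentiableAt (by simp))
  -- In weight one the Lie derivative has coefficient ∑ ∂_i(u V^i), a total divergence.
  have hpt : ∀ y, localCoeff (lieDeriv K 1 (ρ.triv 1 f)).1 φ y
      = ∑ i, (fderiv ℝ u y (EuclideanSpace.single i 1) * V y i
        + u y * fderiv ℝ (fun z => V z i) y (EuclideanSpace.single i 1)) := by
    intro y
    by_cases hy : y ∈ φ.target
    · rw [coeff_apply _ hφ hy, lieDeriv_apply, one_mul, trace_eq_sum, Finset.sum_add_distrib]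
      simp only
      rw [← coeff_apply (ρ.triv 1 f).1 hφ hy, ← hu, ← hV]
      congr 1
      · have hVy : V y = ∑ i, V y i • (EuclideanSpace.single i (1 : ℝ) : Euc d) := by
          have := (EuclideanSpace.basisFun (Fin d) ℝ).sum_repr (V y)
          simpa using this.symm
        conv_lhs => rw [hVy]
        rw [map_sum]
        exact Finset.sum_congr rfl fun i _ => by rw [map_smul, smul_eq_mul, mul_comm]
      · rw [Finset.sum_mul]
        refine Finset.sum_congr rfl fun i _ => ?_
        have hd : DifferentiableAt ℝ V y :=
          (hVs.contDiffAt (φ.open_target.mem_nhds hy)).differentiableAt (by simp)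
        have := ((EuclideanSpace.proj i : Euc d →L[ℝ] ℝ).hasFDerivAt.comp y hd.hasFDerivAt).fderiv
        have h2 : fderiv ℝ (fun z => V z i) y = (EuclideanSpace.proj i : Euc d →L[ℝ] ℝ).comp
          (fderiv ℝ V y) := this
        rw [h2, mul_comm]; rfl
    · have hy' : y ∉ φ '' tsupport f := fun h => hy (himg h)
      rw [localCoeff_of_notMem _ hy]
      simp [hu0 y hy', hdu0 y hy']
  simp_rw [hpt]
  have hint : ∀ i, Integrable fun y => fderiv ℝ u y (EuclideanSpace.single i 1) * V y i
      + u y * fderiv ℝ (fun z => V z i) y (EuclideanSpace.single i 1) :=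
    fun i => (hint1 i).add (hint2 i)
  rw [integral_finsetSum _ fun i _ => hint i]
  refine Finset.sum_eq_zero fun i _ => ?_
  rw [integral_add (hint1 i) (hint2 i), hparts i, add_neg_cancel]

variable [T2Space M] [SigmaCompactSpace M]

theorem tsupport_partition_subset (x : M) :
    tsupport (partitionOfUnity d M x) ⊆ (chartAt (Euc d) x).source :=
  (SmoothPartitionOfUnity.exists_isSubordinate_chartAt_source (𝓡 d) M).choose_spec x

theorem tsupport_mul_subset_left (f g : Fn d M) : tsupport (f * g) ⊆ tsupport f :=
  closure_mono (Function.support_mul_subset_left _ _)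

theorem tsupport_mul_subset_right (f g : Fn d M) : tsupport (f * g) ⊆ tsupport g :=
  closure_mono (Function.support_mul_subset_right _ _)

theorem hasCompactSupport_mul_left {f : Fn d M} (hf : HasCompactSupport f) (g : Fn d M) :
    HasCompactSupport (f * g : Fn d M) :=
  hf.of_isClosed_subset (isClosed_tsupport _) (tsupport_mul_subset_left f g)

theorem hasCompactSupport_mul_right (f : Fn d M) {g : Fn d M} (hg : HasCompactSupport g) :
    HasCompactSupport (f * g : Fn d M) :=
  hg.of_isClosed_subset (isClosed_tsupport _) (tsupport_mul_subset_right f g)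

theorem hasCompactSupport_add {f g : Fn d M} (hf : HasCompactSupport f)
    (hg : HasCompactSupport g) : HasCompactSupport (f + g : Fn d M) :=
  HasCompactSupport.add hf hg

theorem hasCompactSupport_zero : HasCompactSupport (0 : Fn d M) :=
  HasCompactSupport.zero

theorem hasCompactSupport_sum {ι : Type*} (s : Finset ι) {f : ι → Fn d M}
    (hf : ∀ i ∈ s, HasCompactSupport (f i)) : HasCompactSupport (∑ i ∈ s, f i : Fn d M) := by
  induction s using Finset.cons_induction with
  | empty => exact hasCompactSupport_zero
  | cons i s hi ih =>
    rw [Finset.sum_cons]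
    exact hasCompactSupport_add (hf i (Finset.mem_cons_self _ _))
      (ih fun j hj => hf j (Finset.mem_cons_of_mem hj))

/-- Only finitely many members of the partition of unity meet a compact set. -/
theorem exists_finset_partition {C : Set M} (hC : IsCompact C) :
    ∃ F : Finset M, ∀ x ∉ F, ∀ f : Fn d M, tsupport f ⊆ C → partitionOfUnity d M x * f = 0 := by
  have hfin := (partitionOfUnity d M).locallyFinite.finite_nonempty_inter_compact hC
  refine ⟨hfin.toFinset, fun x hx f hf => ?_⟩
  ext z
  rw [Set.Finite.mem_toFinset, Set.mem_ofPred_eq, Set.not_nonempty_iff_eq_empty] at hx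
  by_cases hz : z ∈ tsupport f
  · have : partitionOfUnity d M x z = 0 := by
      by_contra h
      exact Set.notMem_empty z (hx ▸ ⟨h, hf hz⟩)
    rw [Fn.mul_apply, this, zero_mul]; rfl
  · rw [Fn.mul_apply, image_eq_zero_of_notMem_tsupport hz, mul_zero]; rfl

theorem sum_partition_mul {F : Finset M} {f : Fn d M}
    (hF : ∀ x ∉ F, partitionOfUnity d M x * f = 0) :
    ∑ x ∈ F, partitionOfUnity d M x * f = f := by
  ext z
  rw [Fn.sum_apply]
  by_cases hz : f z = 0
  · rw [hz]; exact Finset.sum_eq_zero fun x _ => by rw [Fn.mul_apply, hz, mul_zero]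
  · simp_rw [Fn.mul_apply]
    rw [← Finset.sum_mul]
    have h1 : ∑ x ∈ F, partitionOfUnity d M x z = 1 := by
      refine (partitionOfUnity d M).sum_finsupport' z (Set.mem_univ z) fun x hx => ?_
      by_contra h
      have := congrArg (fun g : Fn d M => g z) (hF x h)
      rw [SmoothPartitionOfUnity.mem_finsupport] at hx
      exact mul_ne_zero hx hz this
    rw [h1, one_mul]

/-- The integral `∫ ρ f`. -/
def VolumeForm.int (ρ : VolumeForm d M) (f : Fn d M) : ℝ := densityIntegral (ρ.triv 1 f)

theorem int_eq_finsum (ρ : VolumeForm d M) (f : Fn d M) :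
    ρ.int f = ∑ᶠ x : M, ρ.chartInt (chartAt (Euc d) x) (partitionOfUnity d M x * f) := by
  refine finsum_congr fun x => ?_
  have hφ : chartAt (Euc d) x ∈ maximalAtlas (𝓡 d) ∞ M := chart_mem_maximalAtlas x
  unfold VolumeForm.chartInt
  rw [← setIntegral_eq_integral_of_forall_compl_eq_zero (s := (chartAt (Euc d) x).target)
    fun y hy => localCoeff_of_notMem _ hy]
  refine setIntegral_congr_fun (chartAt (Euc d) x).open_target.measurableSet fun y hy => ?_
  rw [localCoeff_triv ρ 1 _ hφ hy, localCoeff_triv ρ 1 _ hφ hy, Fn.mul_apply]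
  ring

theorem int_eq_sum (ρ : VolumeForm d M) {F : Finset M} {f : Fn d M}
    (hF : ∀ x ∉ F, partitionOfUnity d M x * f = 0) :
    ρ.int f = ∑ x ∈ F, ρ.chartInt (chartAt (Euc d) x) (partitionOfUnity d M x * f) := by
  rw [int_eq_finsum]
  refine finsum_eq_sum_of_support_subset _ fun x hx => ?_
  by_contra h
  exact hx (by simp only [hF x h, chartInt_zero])

theorem chartInt_sum (ρ : VolumeForm d M) {φ : OpenPartialHomeomorph M (Euc d)}
    (hφ : φ ∈ maximalAtlas (𝓡 d) ∞ M) {ι : Type*} (s : Finset ι) {f : ι → Fn d M}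
    (hf : ∀ i, HasCompactSupport (f i)) (hfφ : ∀ i, tsupport (f i) ⊆ φ.source) :
    ρ.chartInt φ (∑ i ∈ s, f i) = ∑ i ∈ s, ρ.chartInt φ (f i) := by
  induction s using Finset.cons_induction with
  | empty => exact chartInt_zero ρ φ
  | cons i s hi ih =>
    rw [Finset.sum_cons, Finset.sum_cons, chartInt_add ρ hφ (hf i) (hfφ i)
      (hasCompactSupport_sum s fun i _ => hf i), ih]
    have : tsupport (∑ i ∈ s, f i : Fn d M) ⊆ ⋃ i ∈ s, tsupport (f i) := by
      refine closure_minimal (fun z hz => ?_)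
        (s.finite_toSet.isClosed_biUnion fun i _ => isClosed_tsupport _)
      by_contra h
      simp only [Set.mem_iUnion, not_exists] at h
      refine hz ?_
      rw [Fn.sum_apply]
      exact Finset.sum_eq_zero fun i hi => image_eq_zero_of_notMem_tsupport (h i hi)
    exact this.trans (Set.iUnion₂_subset fun i _ => hfφ i)

/-- Each piece of f cut out by the partition of unity lies in two charts, its own and `φ`;
independence of the chart moves all of them to `φ`. -/
theorem int_eq_chartInt (ρ : VolumeForm d M) {φ : OpenPartialHomeomorph M (Euc d)}
    (hφ : φ ∈ maximalAtlas (𝓡 d) ∞ M) {f : Fn d M}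
    (hf : HasCompactSupport f) (hfφ : tsupport f ⊆ φ.source) :
    ρ.int f = ρ.chartInt φ f := by
  obtain ⟨F, hF⟩ := exists_finset_partition (d := d) hf
  have hF' : ∀ x ∉ F, partitionOfUnity d M x * f = 0 := fun x hx => hF x hx f le_rfl
  rw [int_eq_sum ρ hF']
  conv_rhs => rw [← sum_partition_mul hF']
  rw [chartInt_sum ρ hφ F (fun x => hasCompactSupport_mul_right _ hf)
    (fun x => (tsupport_mul_subset_right _ _).trans hfφ)]
  refine Finset.sum_congr rfl fun x _ => ?_
  refine chartInt_eq_chartInt ρ (chart_mem_maximalAtlas x) hφ fun z hz => ⟨?_, ?_⟩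
  · exact tsupport_partition_subset x (tsupport_mul_subset_left _ _ (subset_tsupport _ hz))
  · exact hfφ (tsupport_mul_subset_right _ _ (subset_tsupport _ hz))

theorem int_add (ρ : VolumeForm d M) {f g : Fn d M} (hf : HasCompactSupport f)
    (hg : HasCompactSupport g) : ρ.int (f + g) = ρ.int f + ρ.int g := by
  obtain ⟨F, hF⟩ := exists_finset_partition (d := d) (IsCompact.union hf hg)
  have h1 : ∀ x ∉ F, partitionOfUnity d M x * f = 0 :=
    fun x hx => hF x hx f Set.subset_union_left
  have h2 : ∀ x ∉ F, partitionOfUnity d M x * g = 0 :=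
    fun x hx => hF x hx g Set.subset_union_right
  have h3 : ∀ x ∉ F, partitionOfUnity d M x * (f + g) = 0 :=
    fun x hx => by rw [mul_add, h1 x hx, h2 x hx, add_zero]
  rw [int_eq_sum ρ h1, int_eq_sum ρ h2, int_eq_sum ρ h3, ← Finset.sum_add_distrib]
  refine Finset.sum_congr rfl fun x _ => ?_
  rw [mul_add]
  exact chartInt_add ρ (chart_mem_maximalAtlas x) (hasCompactSupport_mul_right _ hf)
    ((tsupport_mul_subset_left _ _).trans (tsupport_partition_subset x))
    (hasCompactSupport_mul_right _ hg)
    ((tsupport_mul_subset_left _ _).trans (tsupport_partition_subset x))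

theorem int_smul (ρ : VolumeForm d M) (c : ℝ) {f : Fn d M} (hf : HasCompactSupport f) :
    ρ.int (c • f) = c * ρ.int f := by
  obtain ⟨F, hF⟩ := exists_finset_partition (d := d) hf
  have h1 : ∀ x ∉ F, partitionOfUnity d M x * f = 0 := fun x hx => hF x hx f le_rfl
  have h3 : ∀ x ∉ F, partitionOfUnity d M x * (c • f) = 0 :=
    fun x hx => by rw [mul_smul_comm, h1 x hx, smul_zero]
  rw [int_eq_sum ρ h1, int_eq_sum ρ h3, Finset.mul_sum]
  refine Finset.sum_congr rfl fun x _ => ?_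
  rw [mul_smul_comm, chartInt_smul]

theorem int_zero (ρ : VolumeForm d M) : ρ.int 0 = 0 := by
  have := int_smul ρ 0 (f := 0) hasCompactSupport_zero
  rwa [zero_smul, zero_mul] at this

theorem int_neg (ρ : VolumeForm d M) {f : Fn d M} (hf : HasCompactSupport f) :
    ρ.int (-f) = -ρ.int f := by
  have := int_smul ρ (-1) hf
  rwa [neg_one_smul, neg_one_mul] at this

theorem int_sum (ρ : VolumeForm d M) {ι : Type*} (s : Finset ι) {f : ι → Fn d M}
    (hf : ∀ i, HasCompactSupport (f i)) : ρ.int (∑ i ∈ s, f i) = ∑ i ∈ s, ρ.int (f i) := by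
  induction s using Finset.cons_induction with
  | empty => exact int_zero ρ
  | cons i s hi ih =>
    rw [Finset.sum_cons, Finset.sum_cons, int_add ρ (hf i)
      (hasCompactSupport_sum s fun i _ => hf i), ih]

/-- Positivity of the integral, the source of uniqueness of adjoints. The contributions of the
charts are nonnegative, so each vanishes, and a continuous nonnegative integrand with zero integral
is zero. -/
theorem eq_zero_of_int_eq_zero (ρ : VolumeForm d M) {f : Fn d M} (hf : HasCompactSupport f)
    (h0 : ∀ x, 0 ≤ f x) (hint : ρ.int f = 0) : f = 0 := by
  obtain ⟨F, hF⟩ := exists_finset_partition (d := d) hf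
  have h1 : ∀ x ∉ F, partitionOfUnity d M x * f = 0 := fun x hx => hF x hx f le_rfl
  rw [int_eq_sum ρ h1] at hint
  have hnn : ∀ x : M, ∀ y : Euc d,
      0 ≤ localCoeff (ρ.triv 1 (partitionOfUnity d M x * f)).1 (chartAt (Euc d) x) y := by
    intro x y
    by_cases hy : y ∈ (chartAt (Euc d) x).target
    · rw [localCoeff_triv ρ 1 _ (chart_mem_maximalAtlas x) hy]
      exact mul_nonneg (Real.rpow_nonneg (localCoeff_pos ρ (chart_mem_maximalAtlas x) hy).le _)
        (mul_nonneg ((partitionOfUnity d M).nonneg x _) (h0 _))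
    · rw [localCoeff_of_notMem _ hy]
  rw [Finset.sum_eq_zero_iff_of_nonneg fun x _ => integral_nonneg (hnn x)] at hint
  rw [← sum_partition_mul h1]
  refine Finset.sum_eq_zero fun x hx => ?_
  have hφ : chartAt (Euc d) x ∈ maximalAtlas (𝓡 d) ∞ M := chart_mem_maximalAtlas x
  have hc : HasCompactSupport (partitionOfUnity d M x * f : Fn d M) :=
    hasCompactSupport_mul_right _ hf
  have hs := (tsupport_mul_subset_left (partitionOfUnity d M x) f).trans
    (tsupport_partition_subset x)
  have hz := hint x hx
  unfold VolumeForm.chartInt at hz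
  rw [integral_eq_zero_iff_of_nonneg (hnn x) (integrable_localCoeff_triv ρ 1 hφ hc hs),
    Continuous.ae_eq_iff_eq _ (contDiff_localCoeff_triv ρ 1 hφ hc hs).continuous
      continuous_zero] at hz
  ext z
  by_contra hne
  have hzs : z ∈ (chartAt (Euc d) x).source := hs (subset_tsupport _ hne)
  have hy := (chartAt (Euc d) x).map_source hzs
  have := congrFun hz (chartAt (Euc d) x z)
  rw [localCoeff_triv ρ 1 _ hφ hy, (chartAt (Euc d) x).left_inv hzs] at this
  exact mul_ne_zero (Real.rpow_pos_of_pos (localCoeff_pos ρ hφ hy) _).ne' hne this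

/-- The divergence theorem. -/
theorem int_vfDeriv (ρ : VolumeForm d M) (K : VectorField d M) {f : Fn d M}
    (hf : HasCompactSupport f) : ρ.int (vfDeriv K f + ρ.div K * f) = 0 := by
  obtain ⟨F, hF⟩ := exists_finset_partition (d := d) hf
  have h1 : ∀ x ∉ F, partitionOfUnity d M x * f = 0 := fun x hx => hF x hx f le_rfl
  -- Since L is a differential operator it does not enlarge supports, so L applied to a piece of f
  -- can still be integrated in the chart of that piece.
  let L : Module.End ℝ (Fn d M) := (vfDeriv K : Fn d M →ₗ[ℝ] Fn d M) + mulOp (ρ.div K)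
  have hL : L ∈ algDiffOp (Fn d M) 2 :=
    add_mem (derivation_mem _) (commFiltration_le_succ 1 (mulOp_mem _))
  have hsum : vfDeriv K f + ρ.div K * f = ∑ x ∈ F, L (partitionOfUnity d M x * f) := by
    rw [← map_sum, sum_partition_mul h1]; rfl
  rw [hsum, int_sum ρ F fun x => hasCompactSupport_apply hL (hasCompactSupport_mul_right _ hf)]
  refine Finset.sum_eq_zero fun x _ => ?_
  have hs := (tsupport_mul_subset_left (partitionOfUnity d M x) f).trans
    (tsupport_partition_subset x)
  rw [int_eq_chartInt ρ (chart_mem_maximalAtlas x)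
    (hasCompactSupport_apply hL (hasCompactSupport_mul_right _ hf))
    ((tsupport_apply_subset hL _).trans hs)]
  have h := integral_lieDeriv_chart ρ K (chart_mem_maximalAtlas x)
    (hasCompactSupport_mul_right (partitionOfUnity d M x) hf) hs
  rw [lieDeriv_triv, one_smul] at h
  exact h

end Integral

/-- Used with B = [S, x_i], X the frame field, D its divergence, Y the adjoint of B and c = ±1 the
sign for which B - cY has lower order. Every term on the right then has order below that of B X. -/
theorem mul_sub_neg_smul_eq {R : Type*} [Ring R] [Algebra ℝ R] (B X D Y : R) (c : ℝ) :
    B * X - (-c) • ((-X - D) * Y) = B * X - X * B + X * (B - c • Y) - c • (D * Y) := by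
  rw [neg_smul, sub_mul, neg_mul, mul_sub, mul_smul_comm, smul_sub, smul_neg]
  abel

theorem smul_add_sub_smul_eq {V : Type*} [AddCommGroup V] [Module ℝ V] (R R' S S' : V) (r c : ℝ) :
    r • (R + S) - c • (r • (R' + S')) = r • ((R - c • R') + (S - c • S')) := by
  module

/-! ### Adjoints of differential operators on functions -/

section Adjoints

variable {d : ℕ} {M : Type*} [TopologicalSpace M] [ChartedSpace (Euc d) M]
  [IsManifold (𝓡 d) ∞ M] [T2Space M] [SigmaCompactSpace M] {ρ : VolumeForm d M}

/-- `T'` is adjoint to `T` with respect to the volume form `ρ`. -/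
def IsFnAdjoint (ρ : VolumeForm d M) (T T' : Module.End ℝ (Fn d M)) : Prop :=
  ∀ f g : Fn d M, HasCompactSupport f → HasCompactSupport g → ρ.int (T f * g) = ρ.int (f * T' g)

namespace IsFnAdjoint

variable {S S' T T' : Module.End ℝ (Fn d M)}

theorem symm (h : IsFnAdjoint ρ T T') : IsFnAdjoint ρ T' T := fun f g hf hg => by
  rw [mul_comm, ← h g f hg hf, mul_comm]

theorem add (h : IsFnAdjoint ρ S S') (h' : IsFnAdjoint ρ T T') :
    IsFnAdjoint ρ (S + T) (S' + T') := fun f g hf hg => by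
  rw [LinearMap.add_apply, LinearMap.add_apply, add_mul, mul_add,
    int_add ρ (hasCompactSupport_mul_right _ hg) (hasCompactSupport_mul_right _ hg),
    int_add ρ (hasCompactSupport_mul_left hf _) (hasCompactSupport_mul_left hf _),
    h f g hf hg, h' f g hf hg]

theorem smul (c : ℝ) (h : IsFnAdjoint ρ T T') : IsFnAdjoint ρ (c • T) (c • T') :=
  fun f g hf hg => by
  rw [LinearMap.smul_apply, LinearMap.smul_apply, smul_mul_assoc, mul_smul_comm,
    int_smul ρ c (hasCompactSupport_mul_right _ hg),
    int_smul ρ c (hasCompactSupport_mul_left hf _), h f g hf hg]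

theorem neg (h : IsFnAdjoint ρ T T') : IsFnAdjoint ρ (-T) (-T') := by
  rw [← neg_one_smul ℝ T, ← neg_one_smul ℝ T']; exact h.smul _

theorem sub (h : IsFnAdjoint ρ S S') (h' : IsFnAdjoint ρ T T') :
    IsFnAdjoint ρ (S - T) (S' - T') := by
  rw [sub_eq_add_neg, sub_eq_add_neg]; exact h.add h'.neg

theorem zero : IsFnAdjoint ρ (0 : Module.End ℝ (Fn d M)) 0 := fun f g _ _ => by simp

theorem sum {ι : Type*} (s : Finset ι) {S S' : ι → Module.End ℝ (Fn d M)}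
    (h : ∀ i, IsFnAdjoint ρ (S i) (S' i)) :
    IsFnAdjoint ρ (∑ i ∈ s, S i) (∑ i ∈ s, S' i) := by
  induction s using Finset.cons_induction with
  | empty => exact zero
  | cons i s hi ih => rw [Finset.sum_cons, Finset.sum_cons]; exact (h i).add ih

/-- The order hypotheses ensure that T f and S' g are again compactly supported, so that both
adjunctions apply. -/
theorem mul {j k : ℕ} (h : IsFnAdjoint ρ S S') (h' : IsFnAdjoint ρ T T')
    (hT : T ∈ algDiffOp (Fn d M) j) (hS : S' ∈ algDiffOp (Fn d M) k) :
    IsFnAdjoint ρ (S * T) (T' * S') := fun f g hf hg => by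
  rw [Module.End.mul_apply, Module.End.mul_apply, h _ _ (hasCompactSupport_apply hT hf) hg,
    h' _ _ hf (hasCompactSupport_apply hS hg)]

theorem mulOp (h : Fn d M) : IsFnAdjoint ρ (mulOp h) (mulOp h) := fun f g _ _ => by
  rw [LinearMap.mulLeft_apply, LinearMap.mulLeft_apply]
  congr 1; ring

/-- The divergence theorem for the product f g, expanded by the Leibniz rule. -/
theorem vfDeriv (K : VectorField d M) :
    IsFnAdjoint ρ (vfDeriv K : Fn d M →ₗ[ℝ] Fn d M)
      (-(PencilLifting.vfDeriv K : Fn d M →ₗ[ℝ] Fn d M) - PencilLifting.mulOp (ρ.div K)) :=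
  fun f g hf hg => by
  have h := int_vfDeriv ρ K (hasCompactSupport_mul_left hf g)
  have e : PencilLifting.vfDeriv K (f * g) + ρ.div K * (f * g)
      = PencilLifting.vfDeriv K f * g + -(f * (-PencilLifting.vfDeriv K g - ρ.div K * g)) := by
    rw [Derivation.leibniz]
    simp only [smul_eq_mul]
    ring
  rw [e, int_add ρ (hasCompactSupport_mul_right _ hg)
    (by rw [← mul_neg]; exact hasCompactSupport_mul_left hf _),
    int_neg ρ (hasCompactSupport_mul_left hf _)] at h
  exact add_neg_eq_zero.mp h

end IsFnAdjoint

/-- A differential operator that vanishes on compactly supported functions is zero. -/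
theorem eq_zero_of_compact {k : ℕ} {T : Module.End ℝ (Fn d M)} (hT : T ∈ algDiffOp (Fn d M) k)
    (h : ∀ f : Fn d M, HasCompactSupport f → T f = 0) : T = 0 := by
  ext f p
  obtain ⟨b, hb1, -, hb, -⟩ := exists_bump_at (d := d) (Filter.univ_mem (f := nhds p))
  rw [apply_congr_of_eventuallyEq hT (g := b * f) (hb1.mono fun x hx => by simp [hx]),
    h _ (hasCompactSupport_mul_left hb f)]
  rfl

theorem eq_zero_of_int_mul_eq_zero {g : Fn d M}
    (h : ∀ f : Fn d M, HasCompactSupport f → ρ.int (f * g) = 0) : g = 0 := by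
  ext p
  obtain ⟨b, hb1, -, hb, hb0⟩ := exists_bump_at (d := d) (Filter.univ_mem (f := nhds p))
  -- Testing against b g, with b a bump at p, gives ∫ b g² = 0, and positivity forces g(p) = 0.
  have h1 := h (b * g) (hasCompactSupport_mul_left hb g)
  have h2 := eq_zero_of_int_eq_zero ρ
    (hasCompactSupport_mul_left (hasCompactSupport_mul_left hb g) g)
    (fun x => by
      simp only [Fn.mul_apply, mul_assoc]
      exact mul_nonneg (hb0 x) (mul_self_nonneg _)) h1
  have h3 := congrArg (fun f : Fn d M => f p) h2
  simp only [Fn.mul_apply, hb1.self_of_nhds, one_mul] at h3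
  exact mul_self_eq_zero.mp h3

/-- Nondegeneracy of the pairing determines the adjoint on compactly supported functions only;
locality extends this to all functions. The orders of the two candidates may differ. -/
theorem IsFnAdjoint.unique {j k : ℕ} {T T' T'' : Module.End ℝ (Fn d M)}
    (h' : IsFnAdjoint ρ T T') (h'' : IsFnAdjoint ρ T T'') (hT' : T' ∈ algDiffOp (Fn d M) j)
    (hT'' : T'' ∈ algDiffOp (Fn d M) k) : T' = T'' := by
  rw [← sub_eq_zero]
  refine eq_zero_of_compact (k := max j k)
    (sub_mem (commFiltration_mono (le_max_left _ _) hT')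
      (commFiltration_mono (le_max_right _ _) hT'')) fun g hg => ?_
  refine eq_zero_of_int_mul_eq_zero (ρ := ρ) fun f hf => ?_
  have h := (h'.sub h'') f g hf hg
  rw [sub_self, LinearMap.zero_apply, zero_mul, int_zero] at h
  exact h.symm

theorem vfDeriv_chartField_cutoffPull {φ : OpenPartialHomeomorph M (Euc d)}
    (hφ : φ ∈ maximalAtlas (𝓡 d) ∞ M) {η : Fn d M} (hη : tsupport η ⊆ φ.source)
    {p : M} (hp : ∀ᶠ x in nhds p, η x = 1) (i j : Fin d) :
    vfDeriv (chartField η φ hφ hη (fun _ => EuclideanSpace.single i 1) contDiffOn_const)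
      (cutoffPull η φ hφ hη (fun y => y j) (by fun_prop)) p = if j = i then 1 else 0 := by
  have hps : p ∈ φ.source := hη (subset_tsupport _ (by
    rw [Function.mem_support, hp.self_of_nhds]; exact one_ne_zero))
  have hy := φ.map_source hps
  have h := vfDeriv_symm_apply (chartField η φ hφ hη (fun _ => EuclideanSpace.single i 1)
    contDiffOn_const) (cutoffPull η φ hφ hη (fun y => y j) (by fun_prop)) hφ hy
  rw [localField_chartField _ _ _ _ _ _ hy, φ.left_inv hps, hp.self_of_nhds, one_smul] at h
  rw [h]
  have hev : (cutoffPull η φ hφ hη (fun y => y j) (by fun_prop) ∘ φ.symm)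
      =ᶠ[nhds (φ p)] fun y => (EuclideanSpace.proj j : Euc d →L[ℝ] ℝ) y := by
    have hcont : Filter.Tendsto φ.symm (nhds (φ p)) (nhds p) := by
      have := φ.continuousAt_symm hy
      rwa [ContinuousAt, φ.left_inv hps] at this
    filter_upwards [hcont.eventually hp, φ.open_target.mem_nhds hy] with z hz hzt
    simp only [Function.comp_apply, cutoffPull_apply]
    rw [hz, one_mul, φ.right_inv hzt]; rfl
  rw [hev.fderiv_eq, ContinuousLinearMap.fderiv]
  simp

/-- The coordinate functions and coordinate vector fields, cut off by a function that is one near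
`p`, form a dual frame at `p`. -/
theorem derivation_apply_eq_sum {φ : OpenPartialHomeomorph M (Euc d)}
    (hφ : φ ∈ maximalAtlas (𝓡 d) ∞ M) {η : Fn d M} (hη : tsupport η ⊆ φ.source)
    {p : M} (hp : ∀ᶠ x in nhds p, η x = 1) (D : Derivation ℝ (Fn d M) (Fn d M)) (f : Fn d M) :
    D f p = ∑ i, D (cutoffPull η φ hφ hη (fun y => y i) (by fun_prop)) p *
      vfDeriv (chartField η φ hφ hη (fun _ => EuclideanSpace.single i 1) contDiffOn_const) f p := by
  have hps : p ∈ φ.source := hη (subset_tsupport _ (by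
    rw [Function.mem_support, hp.self_of_nhds]; exact one_ne_zero))
  obtain ⟨G, hG⟩ := exists_hadamard_chart hφ hps f
  set x : Fin d → Fn d M := fun i => cutoffPull η φ hφ hη (fun y => y i) (by fun_prop) with hx
  have hxp : ∀ i, x i p = φ p i := fun i => by
    rw [hx]; simp only [cutoffPull_apply]; rw [hp.self_of_nhds, one_mul]
  -- By Hadamard f = f(p) + ∑ (x_i - x_i(p)) G_i near p, so a derivation at p sees only the numbers
  -- G_i(p). Applying this to the coordinate fields as well identifies G_i(p) with X_i f(p).
  have key : ∀ D : Derivation ℝ (Fn d M) (Fn d M), D f p = ∑ i, D (x i) p * G i p := by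
    intro D
    have h1 := apply_congr_of_eventuallyEq (derivation_mem D) (f := f) (p := p)
      (g := algebraMap ℝ (Fn d M) (f p) + ∑ i, (x i - algebraMap ℝ (Fn d M) (φ p i)) * G i) (by
        filter_upwards [hG, hp] with z hz hηz
        rw [hz]
        change _ = f p + (∑ i, (x i - algebraMap ℝ (Fn d M) (φ p i)) * G i : Fn d M) z
        rw [Fn.sum_apply]
        congr 1
        refine Finset.sum_congr rfl fun i _ => ?_
        change _ = (x i z - φ p i) * G i z
        rw [hx]; simp only [cutoffPull_apply]; rw [hηz, one_mul])
    refine h1.trans ?_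
    change D _ p = _
    rw [map_add, D.map_algebraMap, zero_add, map_sum, Fn.sum_apply]
    refine Finset.sum_congr rfl fun i _ => ?_
    rw [D.leibniz, map_sub, D.map_algebraMap, sub_zero]
    change (x i p - φ p i) * D (G i) p + G i p * D (x i) p = _
    rw [hxp]; ring
  rw [key D]
  refine Finset.sum_congr rfl fun i _ => ?_
  congr 1
  rw [key]
  simp [hx, vfDeriv_chartField_cutoffPull hφ hη hp]

/-- The chain rule for an abstract derivation is not automatic: it holds because at each point the
derivation is a combination of coordinate fields, for which it is calculus. -/
theorem derivation_comp_exp {g l : Fn d M} {c : ℝ} (h : ∀ x, g x = Real.exp (c * l x))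
    (D : Derivation ℝ (Fn d M) (Fn d M)) : D g = (c • g) * D l := by
  ext p
  have hφ : chartAt (Euc d) p ∈ maximalAtlas (𝓡 d) ∞ M := chart_mem_maximalAtlas p
  have hps := mem_chart_source (Euc d) p
  obtain ⟨η, hη1, hη, -, -⟩ := exists_bump_at (d := d)
    ((chartAt (Euc d) p).open_source.mem_nhds hps)
  rw [Fn.mul_apply, derivation_apply_eq_sum hφ hη hη1 D g, derivation_apply_eq_sum hφ hη hη1 D l,
    Finset.mul_sum]
  refine Finset.sum_congr rfl fun i _ => ?_
  have hX : ∀ K : VectorField d M, vfDeriv K g p = (c * g p) * vfDeriv K l p := by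
    intro K
    have hy := (chartAt (Euc d) p).map_source hps
    have h1 := vfDeriv_symm_apply K g hφ hy
    have h2 := vfDeriv_symm_apply K l hφ hy
    rw [(chartAt (Euc d) p).left_inv hps] at h1 h2
    have hgl : (g ∘ (chartAt (Euc d) p).symm : Euc d → ℝ)
        = fun z => Real.exp (c * (l ∘ (chartAt (Euc d) p).symm) z) := funext fun z => h _
    have hd := (((l.differentiableAt_chart hφ hy).hasFDerivAt.const_mul c).exp).fderiv
    rw [h1, h2, hgl, hd, h p]
    simp only [smul_apply, smul_eq_mul, Function.comp_apply, (chartAt (Euc d) p).left_inv hps]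
    ring
  rw [hX, Fn.smul_apply]; ring

/-- Existence of the adjoint of a differential operator, and its principal symbol, in the presence
of a dual frame. -/
theorem DualFrame.exists_adjoint {I : Ideal (Fn d M)} {ι : Type*} [Fintype ι] {x : ι → Fn d M}
    {K : ι → VectorField d M} (h : DualFrame I x fun i => vfDeriv (K i)) {n : ℕ}
    {S : Module.End ℝ (Fn d M)} (hS : S ∈ algDiffOp (Fn d M) (n + 1)) (hI : ∀ f, S f ∈ I) :
    ∃ S' ∈ algDiffOp (Fn d M) (n + 1), IsFnAdjoint ρ S S' ∧
      S - (-1 : ℝ) ^ n • S' ∈ algDiffOp (Fn d M) n := by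
  induction n generalizing S with
  | zero =>
    refine ⟨S, hS, ?_, by simp⟩
    rw [eq_mulOp_of_mem hS]; exact IsFnAdjoint.mulOp _
  | succ n ih =>
    have hX : ∀ i, (vfDeriv (K i) : Fn d M →ₗ[ℝ] Fn d M) ∈ algDiffOp (Fn d M) 2 :=
      fun i => derivation_mem _
    choose Y hYmem hYadj hYsym using fun i =>
      ih (mem_algDiffOp_succ.mp hS (x i)) (commutator_range_mem hI (x i))
    obtain ⟨R, hR⟩ : ∃ R, R = ((n + 1 : ℕ) : ℝ) • S
        - ∑ i, (S * mulOp (x i) - mulOp (x i) * S) * (vfDeriv (K i) : Fn d M →ₗ[ℝ] Fn d M) :=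
      ⟨_, rfl⟩
    -- By Euler's identity the remainder R has smaller order. It also takes values in `I`, so the
    -- induction hypothesis applies to R as well as to the commutators [S, x_i].
    have hRmem : R ∈ algDiffOp (Fn d M) (n + 1) := hR ▸ h.euler hS hI
    have hRI : ∀ f, R f ∈ I := fun f => by
      rw [hR, LinearMap.sub_apply, LinearMap.smul_apply, LinearMap.sum_apply]
      refine sub_mem ?_ (Submodule.sum_mem _ fun i _ => commutator_range_mem hI _ _)
      have : ((n + 1 : ℕ) : ℝ) • S f = algebraMap ℝ (Fn d M) ((n + 1 : ℕ) : ℝ) * S f :=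
        Algebra.smul_def _ _
      rw [this]; exact I.mul_mem_left _ (hI f)
    obtain ⟨R', hR'mem, hR'adj, -⟩ := ih hRmem hRI
    have hn : ((n + 1 : ℕ) : ℝ) ≠ 0 := by positivity
    have hSR : S = ((n + 1 : ℕ) : ℝ)⁻¹ • (R + ∑ i, (S * mulOp (x i) - mulOp (x i) * S)
        * (vfDeriv (K i) : Fn d M →ₗ[ℝ] Fn d M)) := by
      rw [hR, sub_add_cancel, smul_smul, inv_mul_cancel₀ hn, one_smul]
    have hX'mem : ∀ i, -(vfDeriv (K i) : Fn d M →ₗ[ℝ] Fn d M) - mulOp (ρ.div (K i))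
        ∈ algDiffOp (Fn d M) 2 := fun i =>
      sub_mem (neg_mem (hX i)) (commFiltration_le_succ 1 (mulOp_mem _))
    -- The adjoint term by term of (n + 1) S = R + ∑ [S, x_i] X_i, with X_i^† = -X_i - div X_i
    -- placed on the left of the adjoint of [S, x_i].
    refine ⟨((n + 1 : ℕ) : ℝ)⁻¹ • (R' + ∑ i, (-(vfDeriv (K i) : Fn d M →ₗ[ℝ] Fn d M)
        - mulOp (ρ.div (K i))) * Y i), ?_, ?_, ?_⟩
    · refine Submodule.smul_mem _ _ (add_mem (commFiltration_le_succ _ hR'mem)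
        (Submodule.sum_mem _ fun i _ => ?_))
      have := mul_mem_commFiltration (hX'mem i) (hYmem i)
      exact commFiltration_mono (by omega) this
    · conv_lhs => rw [hSR]
      refine (hR'adj.add (IsFnAdjoint.sum _ fun i => ?_)).smul _
      exact (hYadj i).mul (IsFnAdjoint.vfDeriv (K i)) (hX i) (hYmem i)
    · have key : ∀ i, (S * mulOp (x i) - mulOp (x i) * S)
            * (vfDeriv (K i) : Fn d M →ₗ[ℝ] Fn d M)
          - (-1 : ℝ) ^ (n + 1) • ((-(vfDeriv (K i) : Fn d M →ₗ[ℝ] Fn d M)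
            - mulOp (ρ.div (K i))) * Y i) ∈ algDiffOp (Fn d M) (n + 1) := by
        intro i
        obtain ⟨B, hB⟩ : ∃ B, B = S * mulOp (x i) - mulOp (x i) * S := ⟨_, rfl⟩
        have hBmem : B ∈ algDiffOp (Fn d M) (n + 1) := hB ▸ mem_algDiffOp_succ.mp hS (x i)
        have h1 := commutator_mem hBmem (hX i)
        have h2 : B - (-1 : ℝ) ^ n • Y i ∈ algDiffOp (Fn d M) n := hB ▸ hYsym i
        have h3 : (vfDeriv (K i) : Fn d M →ₗ[ℝ] Fn d M) * (B - (-1 : ℝ) ^ n • Y i)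
            ∈ algDiffOp (Fn d M) (n + 1) := by
          rcases n with _ | n
          · rw [mem_commFiltration_zero.mp h2, mul_zero]; exact zero_mem _
          · have := mul_mem_commFiltration (hX i) h2
            exact commFiltration_mono (by omega) this
        have h4 := mul_mem_commFiltration_left (mulOp_mem (ρ.div (K i))) (hYmem i)
        have := sub_mem (add_mem h1 h3) (Submodule.smul_mem _ ((-1 : ℝ) ^ n) h4)
        rw [← hB]
        rw [pow_succ, mul_neg_one]
        convert this using 1
        exact mul_sub_neg_smul_eq _ _ _ _ _
      have h1 : R - (-1 : ℝ) ^ (n + 1) • R' ∈ algDiffOp (Fn d M) (n + 1) :=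
        sub_mem hRmem (Submodule.smul_mem _ _ hR'mem)
      have h2 := Submodule.smul_mem _ (((n + 1 : ℕ) : ℝ)⁻¹)
        (add_mem h1 (Submodule.sum_mem _ fun i (_ : i ∈ Finset.univ) => key i))
      convert h2 using 1
      conv_lhs => enter [1]; rw [hSR]
      rw [Finset.sum_sub_distrib, ← Finset.smul_sum]
      exact smul_add_sub_smul_eq _ _ _ _ _ _

/-- The locally finite sum `∑ π_x T_x` with the members `π_x` of the partition of unity. -/
def partitionSum (T : M → Module.End ℝ (Fn d M)) : Module.End ℝ (Fn d M) where
  toFun f := ⟨fun z => ∑ᶠ x : M, partitionOfUnity d M x z • T x f z,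
    (partitionOfUnity d M).contMDiff_finsum_smul (n := ⊤)
      fun x z _ => (T x f).contMDiff.contMDiffAt⟩
  map_add' f g := by
    ext z
    change ∑ᶠ x : M, partitionOfUnity d M x z • T x (f + g) z
      = ∑ᶠ x : M, partitionOfUnity d M x z • T x f z
        + ∑ᶠ x : M, partitionOfUnity d M x z • T x g z
    rw [← SmoothPartitionOfUnity.sum_finsupport_smul_eq_finsum _ _ (fun x => T x (f + g)),
      ← SmoothPartitionOfUnity.sum_finsupport_smul_eq_finsum _ _ (fun x => T x f),
      ← SmoothPartitionOfUnity.sum_finsupport_smul_eq_finsum _ _ (fun x => T x g),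
      ← Finset.sum_add_distrib]
    refine Finset.sum_congr rfl fun x _ => ?_
    rw [map_add, ← smul_add]; rfl
  map_smul' c f := by
    ext z
    change ∑ᶠ x : M, partitionOfUnity d M x z • T x (c • f) z
      = c * ∑ᶠ x : M, partitionOfUnity d M x z • T x f z
    rw [← SmoothPartitionOfUnity.sum_finsupport_smul_eq_finsum _ _ (fun x => T x (c • f)),
      ← SmoothPartitionOfUnity.sum_finsupport_smul_eq_finsum _ _ (fun x => T x f),
      Finset.mul_sum]
    refine Finset.sum_congr rfl fun x _ => ?_
    rw [map_smul, Fn.smul_apply, smul_eq_mul, smul_eq_mul]; ring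

theorem partitionSum_apply (T : M → Module.End ℝ (Fn d M)) (f : Fn d M) (z : M) :
    partitionSum T f z
      = ∑ x ∈ (partitionOfUnity d M).finsupport z, partitionOfUnity d M x z * T x f z :=
  (SmoothPartitionOfUnity.sum_finsupport_smul_eq_finsum _ _ fun x => T x f).symm

theorem partitionSum_sub (S T : M → Module.End ℝ (Fn d M)) :
    partitionSum (fun x => S x - T x) = partitionSum S - partitionSum T := by
  ext f z
  change _ = partitionSum S f z - partitionSum T f z
  rw [partitionSum_apply, partitionSum_apply, partitionSum_apply, ← Finset.sum_sub_distrib]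
  exact Finset.sum_congr rfl fun x _ => mul_sub _ (S x f z) (T x f z)

theorem partitionSum_smul (c : ℝ) (T : M → Module.End ℝ (Fn d M)) :
    partitionSum (fun x => c • T x) = c • partitionSum T := by
  ext f z
  change _ = c * partitionSum T f z
  rw [partitionSum_apply, partitionSum_apply, Finset.mul_sum]
  exact Finset.sum_congr rfl fun x _ => mul_left_comm _ c (T x f z)

/-- Left multiplication by π_x commutes with multiplication by h, so [∑ π_x T_x, h] = ∑ π_x [T_x,
h]. -/
theorem partitionSum_mem {k : ℕ} {T : M → Module.End ℝ (Fn d M)}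
    (hT : ∀ x, T x ∈ algDiffOp (Fn d M) k) : partitionSum T ∈ algDiffOp (Fn d M) k := by
  induction k generalizing T with
  | zero =>
    have : T = fun _ => 0 := funext fun x => mem_commFiltration_zero.mp (hT x)
    rw [mem_commFiltration_zero, this]
    ext f z
    rw [partitionSum_apply]
    exact Finset.sum_eq_zero fun x _ => mul_zero _
  | succ k ih =>
    rw [mem_algDiffOp_succ]
    intro h
    convert ih fun x => mem_algDiffOp_succ.mp (hT x) h using 1
    ext f z
    change partitionSum T (h * f) z - h z * partitionSum T f z = _
    rw [partitionSum_apply, partitionSum_apply, partitionSum_apply, Finset.mul_sum,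
      ← Finset.sum_sub_distrib]
    refine Finset.sum_congr rfl fun x _ => ?_
    change _ = partitionOfUnity d M x z * (T x (h * f) z - h z * T x f z)
    ring

theorem partitionSum_eq {S : M → Module.End ℝ (Fn d M)} {T : Module.End ℝ (Fn d M)}
    (h : ∀ x z, partitionOfUnity d M x z ≠ 0 → ∀ f, S x f z = T f z) : partitionSum S = T := by
  ext f z
  rw [partitionSum_apply]
  have : ∀ x ∈ (partitionOfUnity d M).finsupport z, partitionOfUnity d M x z * S x f z
      = partitionOfUnity d M x z * T f z := fun x hx => by
    rw [h x z ((SmoothPartitionOfUnity.mem_finsupport _ _).mp hx)]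
  rw [Finset.sum_congr rfl this, ← Finset.sum_mul,
    (partitionOfUnity d M).sum_finsupport z (Set.mem_univ z), one_mul]

/-- Local dual frames, with cutoffs that are one on the supports of the partition of unity. -/
theorem exists_dualFrame (x₀ : M) : ∃ (χ : Fn d M) (I : Ideal (Fn d M)) (x : Fin d → Fn d M)
    (K : Fin d → VectorField d M), (∀ z ∈ tsupport (partitionOfUnity d M x₀), χ z = 1) ∧
      χ ∈ I ∧ DualFrame I x fun i => vfDeriv (K i) := by
  have hφ : chartAt (Euc d) x₀ ∈ maximalAtlas (𝓡 d) ∞ M := chart_mem_maximalAtlas x₀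
  obtain ⟨χ, hχ1, hχ, -⟩ := exists_bump (d := d) (isClosed_tsupport (partitionOfUnity d M x₀))
    (chartAt (Euc d) x₀).open_source (tsupport_partition_subset x₀)
  obtain ⟨η, hη1, hη, -⟩ := exists_bump (d := d) (isClosed_tsupport χ)
    (chartAt (Euc d) x₀).open_source hχ
  -- The ideal consists of the functions that vanish off the support of χ. The coordinates are cut
  -- off by η, which is 1 near that support, so the coordinate expansion holds on the support, and
  -- off it both sides vanish for a derivation with values in the ideal.
  refine ⟨χ, { carrier := {f | ∀ p ∉ tsupport χ, f p = 0}
               add_mem' := fun {f g} hf hg p hp => by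
                 change f p + g p = 0; rw [hf p hp, hg p hp, add_zero]
               zero_mem' := fun p _ => rfl
               smul_mem' := fun c f hf p hp => by
                 change c p * f p = 0; rw [hf p hp, mul_zero] },
    fun i => cutoffPull η _ hφ hη (fun y => y i) (by fun_prop),
    fun i => chartField η _ hφ hη (fun _ => EuclideanSpace.single i 1) contDiffOn_const,
    fun z hz => hχ1.self_of_nhdsSet z hz, fun p hp => image_eq_zero_of_notMem_tsupport hp,
    ⟨fun D hD f => ?_⟩⟩
  · ext p
    rw [Fn.sum_apply]
    by_cases hp : p ∈ tsupport χ
    · exact derivation_apply_eq_sum hφ hη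
        (hη1.filter_mono (nhds_le_nhdsSet hp)) D f
    · rw [hD f p hp]
      refine (Finset.sum_eq_zero fun i _ => ?_).symm
      rw [Fn.mul_apply, hD _ p hp, zero_mul]

/-- Existence of the adjoint of a differential operator. -/
theorem exists_fnAdjoint (ρ : VolumeForm d M) {n : ℕ} {T : Module.End ℝ (Fn d M)}
    (hT : T ∈ algDiffOp (Fn d M) (n + 1)) :
    ∃ T' ∈ algDiffOp (Fn d M) (n + 1), IsFnAdjoint ρ T T' ∧
      T - (-1 : ℝ) ^ n • T' ∈ algDiffOp (Fn d M) n := by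
  classical
  choose χ I x K hχ1 hχI hF using exists_dualFrame (d := d) (M := M)
  -- The local operators are χ_x T; the factor χ_x puts their values into the ideal of the frame.
  choose T' hT' hadj hsym using fun x₀ => (hF x₀).exists_adjoint (ρ := ρ)
    (mul_mem_commFiltration_left (mulOp_mem (χ x₀)) hT)
    (fun f => (I x₀).mul_mem_right _ (hχI x₀))
  have hχ : ∀ x z, partitionOfUnity d M x z ≠ 0 → χ x z = 1 :=
    fun x z h => hχ1 x z (subset_tsupport _ h)
  -- On compactly supported functions T is the sum of the operators (χ_x T) π_x, because T is local
  -- and χ_x = 1 on the support of π_x. Hence its adjoint is ∑ π_x (χ_x T)^†.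
  refine ⟨partitionSum T', partitionSum_mem hT', fun f g hf hg => ?_, ?_⟩
  · obtain ⟨F, hFin⟩ := exists_finset_partition (d := d) hf
    have h1 : ∀ x ∉ F, partitionOfUnity d M x * f = 0 := fun x hx => hFin x hx f le_rfl
    have h2 : T f * g = ∑ x ∈ F, (mulOp (χ x) * T) (partitionOfUnity d M x * f) * g := by
      conv_lhs => rw [← sum_partition_mul h1, map_sum, Finset.sum_mul]
      refine Finset.sum_congr rfl fun x _ => ?_
      congr 1
      ext z
      change _ = χ x z * T (partitionOfUnity d M x * f) z
      by_cases hz : z ∈ tsupport (partitionOfUnity d M x)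
      · rw [hχ1 x z hz, one_mul]
      · have : T (partitionOfUnity d M x * f) z = 0 := image_eq_zero_of_notMem_tsupport
          fun h => hz (tsupport_mul_subset_left _ _ (tsupport_apply_subset hT _ h))
        rw [this, mul_zero]
    have h3 : f * partitionSum T' g = ∑ x ∈ F, partitionOfUnity d M x * f * T' x g := by
      ext z
      rw [Fn.mul_apply, partitionSum_apply, Fn.sum_apply, Finset.mul_sum]
      have hz : ∀ x, f z * (partitionOfUnity d M x z * T' x g z)
          = (partitionOfUnity d M x * f * T' x g) z := fun x => by
        change _ = partitionOfUnity d M x z * f z * T' x g z; ring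
      simp_rw [hz]
      refine (Finset.sum_subset (Finset.subset_union_left (s₂ := F)) fun x _ hx => ?_).trans
        (Finset.sum_subset (Finset.subset_union_right
          (s₁ := (partitionOfUnity d M).finsupport z)) fun x _ hx => ?_).symm
      · rw [SmoothPartitionOfUnity.mem_finsupport, Function.notMem_support] at hx
        change partitionOfUnity d M x z * f z * T' x g z = 0
        rw [hx, zero_mul, zero_mul]
      · rw [h1 x hx, zero_mul]; rfl
    rw [h2, h3, int_sum ρ F fun x => hasCompactSupport_mul_right _ hg,
      int_sum ρ F fun x => hasCompactSupport_mul_left (hasCompactSupport_mul_right _ hf) _]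
    exact Finset.sum_congr rfl fun x _ => hadj x _ _ (hasCompactSupport_mul_right _ hf) hg
  · have h1 : partitionSum (fun x => mulOp (χ x) * T) = T := partitionSum_eq fun x z hz f => by
      change χ x z * T f z = _; rw [hχ x z hz, one_mul]
    have h2 := partitionSum_mem hsym
    rw [partitionSum_sub, partitionSum_smul, h1] at h2
    exact h2

end Adjoints

theorem commFiltration_antitone {V : Type*} [AddCommGroup V] [Module ℝ V]
    {S S' : Set (Module.End ℝ V)} (h : S ⊆ S') (k : ℕ) :
    commFiltration S' k ≤ commFiltration S k := by
  induction k with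
  | zero => exact le_rfl
  | succ k ih => exact fun D hD m hm => ih (hD m (h hm))

/-! ### Operators on the algebra of densities as families of operators on functions -/

section Pencil

variable {d : ℕ} {M : Type*} [TopologicalSpace M] [ChartedSpace (Euc d) M]

theorem linearMap_ext_incl {W : Type*} [AddCommGroup W] [Module ℝ W]
    {D D' : DensityAlgebra d M →ₗ[ℝ] W}
    (h : ∀ a (s : Density d M a), D (incl d M a s) = D' (incl d M a s)) : D = D' :=
  DirectSum.linearMap_ext (R := ℝ) (M := fun a => Density d M a) fun a => LinearMap.ext (h a)

theorem incl_injective (a : ℝ) : Function.Injective (incl d M a) :=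
  DirectSum.of_injective (β := fun a => Density d M a) a

theorem weightComponent_incl_self (a : ℝ) (s : Density d M a) :
    weightComponent a (incl d M a s) = s :=
  DirectSum.component.lof_self (R := ℝ) (M := fun a => Density d M a) a s

theorem weightComponent_incl_of_ne {a b : ℝ} (h : b ≠ a) (s : Density d M b) :
    weightComponent a (incl d M b s) = 0 := 
  (DirectSum.component.of (R := ℝ) (M := fun a => Density d M a) a b s).trans (dif_neg h)

theorem exists_eq_sum_incl (s : DensityAlgebra d M) :
    ∃ I : Finset ℝ, s = ∑ a ∈ I, incl d M a (weightComponent a s) := by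
  classical
  exact ⟨DFinsupp.support (β := fun a => Density d M a) s,
    (DirectSum.sum_support_of (β := fun a => Density d M a) s).symm⟩

variable [IsManifold (𝓡 d) ∞ M] (ρ : VolumeForm d M)

theorem incl_mul_incl (a b : ℝ) (f g : Fn d M) :
    incl d M a (ρ.triv a f) * incl d M b (ρ.triv b g)
      = incl d M (a + b) (ρ.triv (a + b) (f * g)) := by
  refine (DirectSum.of_mul_of (A := fun a => Density d M a) _ _).trans ?_
  refine congrArg (incl d M (a + b)) (Subtype.ext ?_)
  exact triv_mul_triv ρ a b f g

theorem one_eq_incl : (1 : DensityAlgebra d M) = incl d M 0 (ρ.triv 0 1) := by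
  rw [ρ.triv_zero]; rfl

theorem linearMap_ext_triv {W : Type*} [AddCommGroup W] [Module ℝ W]
    {D D' : DensityAlgebra d M →ₗ[ℝ] W}
    (h : ∀ a (f : Fn d M), D (incl d M a (ρ.triv a f)) = D' (incl d M a (ρ.triv a f))) : D = D' :=
  linearMap_ext_incl fun a s => by
    obtain ⟨f, rfl⟩ := (ρ.triv a).surjective s
    exact h a f

theorem incl_triv_injective (a : ℝ) :
    Function.Injective fun f : Fn d M => incl d M a (ρ.triv a f) :=
  (incl_injective a).comp (ρ.triv a).injective

namespace VolumeForm

/-- The operator on the algebra of densities equal to `ρ^a ∘ F a ∘ ρ^(-a)` in weight `a`. -/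
def pencil : (ℝ → Module.End ℝ (Fn d M)) →ₐ[ℝ] Module.End ℝ (DensityAlgebra d M) :=
  AlgHom.ofLinearMap
    { toFun := fun F => ofPencil fun a => (ρ.triv a).conj (F a)
      map_add' := fun F G => linearMap_ext_incl fun a s => by
        rw [LinearMap.add_apply, ofPencil_incl, ofPencil_incl, ofPencil_incl, Pi.add_apply,
          map_add, LinearMap.add_apply, map_add]
      map_smul' := fun c F => linearMap_ext_incl fun a s => by
        rw [RingHom.id_apply, LinearMap.smul_apply, ofPencil_incl, ofPencil_incl, Pi.smul_apply,
          map_smul, LinearMap.smul_apply, map_smul] }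
    (linearMap_ext_incl fun a s => by
      refine (ofPencil_incl _ a s).trans ?_
      rw [Pi.one_apply, Module.End.one_eq_id, LinearEquiv.conj_id]; rfl)
    (fun F G => linearMap_ext_incl fun a s => by
      simp only [LinearMap.coe_mk, AddHom.coe_mk, Module.End.mul_apply, ofPencil_incl]
      rw [Pi.mul_apply, Module.End.mul_eq_comp, LinearEquiv.conj_comp]; rfl)

theorem pencil_apply (F : ℝ → Module.End ℝ (Fn d M)) :
    ρ.pencil F = ofPencil fun a => (ρ.triv a).conj (F a) := rfl

theorem pencil_incl (F : ℝ → Module.End ℝ (Fn d M)) (a : ℝ) (f : Fn d M) :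
    ρ.pencil F (incl d M a (ρ.triv a f)) = incl d M a (ρ.triv a (F a f)) := by
  rw [pencil_apply, ofPencil_incl, LinearEquiv.conj_apply_apply, LinearEquiv.symm_apply_apply]

theorem pencil_injective : Function.Injective ρ.pencil := fun F G h => by
  ext1 a
  ext1 f
  refine incl_triv_injective ρ a ?_
  change incl d M a _ = incl d M a _
  rw [← pencil_incl, ← pencil_incl, h]

theorem ofPencil_eq_pencil (E : ∀ a, Module.End ℝ (Density d M a)) :
    ofPencil E = ρ.pencil fun a => (ρ.triv a).symm.conj (E a) := by
  rw [pencil_apply]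
  congr 1
  ext1 a
  exact ((ρ.triv a).conj.apply_symm_apply (E a)).symm

theorem mulLeft_incl_zero (f : Fn d M) :
    LinearMap.mulLeft ℝ (incl d M 0 (ρ.triv 0 f)) = ρ.pencil fun _ => mulOp f :=
  linearMap_ext_triv ρ fun a g => by
    rw [LinearMap.mulLeft_apply, incl_mul_incl, pencil_incl, zero_add]; rfl

theorem pencil_const_one (T : Module.End ℝ (Fn d M)) :
    ρ.pencil (fun _ => T) 1 = incl d M 0 (ρ.triv 0 (T 1)) := by
  rw [one_eq_incl ρ, pencil_incl]

theorem weightOp_eq_pencil : weightOp d M = ρ.pencil fun a => a • 1 := by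
  rw [weightOp, ofPencil_eq_pencil ρ]
  congr 1
  ext1 a
  rw [map_smul, LinearEquiv.conj_id]; rfl

theorem aeval_weightOp (p : Polynomial ℝ) :
    Polynomial.aeval (weightOp d M) p = ρ.pencil fun a => p.eval a • 1 := by
  rw [weightOp_eq_pencil ρ, Polynomial.aeval_algHom_apply]
  congr 1
  ext1 a
  have h := Polynomial.aeval_algHom_apply
    (Pi.evalAlgHom ℝ (fun _ : ℝ => Module.End ℝ (Fn d M)) a) (fun a => a • 1) p
  refine h.symm.trans ?_
  change Polynomial.aeval (a • (1 : Module.End ℝ (Fn d M))) p = _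
  rw [← Algebra.algebraMap_eq_smul_one, Polynomial.aeval_algebraMap_apply,
    Algebra.algebraMap_eq_smul_one, Polynomial.coe_aeval_eq_eval]

theorem aeval_weightOp_mul_pencil (p : Polynomial ℝ) (F : ℝ → Module.End ℝ (Fn d M)) :
    Polynomial.aeval (weightOp d M) p * ρ.pencil F = ρ.pencil fun a => p.eval a • F a := by
  rw [aeval_weightOp ρ, ← map_mul]
  rfl

/-- The Lie derivative of densities of weight `a`, as an operator on functions. -/
def lie (K : VectorField d M) (a : ℝ) : Module.End ℝ (Fn d M) :=
  (vfDeriv K : Fn d M →ₗ[ℝ] Fn d M) + a • mulOp (ρ.div K)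

theorem lie_mem (K : VectorField d M) (a : ℝ) : ρ.lie K a ∈ algDiffOp (Fn d M) 2 :=
  add_mem (derivation_mem _)
    (Submodule.smul_mem _ _ (commFiltration_le_succ 1 (mulOp_mem _)))

/-- The weight enters only through div K; this difference produces the equivariance defects of the
liftings. -/
theorem lie_sub_lie (K : VectorField d M) (a b : ℝ) :
    ρ.lie K a - ρ.lie K b = (a - b) • mulOp (ρ.div K) := by
  rw [lie, lie, add_sub_add_left_eq_sub]
  exact (sub_smul a b _).symm

theorem lieDeriv_eq_conj (K : VectorField d M) (a : ℝ) :
    lieDeriv K a = (ρ.triv a).conj (ρ.lie K a) := by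
  ext1 s
  obtain ⟨f, rfl⟩ := (ρ.triv a).surjective s
  rw [lieDeriv_triv, LinearEquiv.conj_apply_apply, LinearEquiv.symm_apply_apply]; rfl

theorem lieOp_eq_pencil (K : VectorField d M) : lieOp K = ρ.pencil (ρ.lie K) := by
  rw [pencil_apply, lieOp]
  simp_rw [← lieDeriv_eq_conj]

/-- The trivializations in different weights differ by powers of ρ, the very factors by which P
conjugates. So P(Δ) is a constant family. -/
theorem volumeLifting_eq_pencil (lam : ℝ) (T : Module.End ℝ (Fn d M)) :
    volumeLifting ρ lam ((ρ.triv lam).conj T) = ρ.pencil fun _ => T :=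
  linearMap_ext_triv ρ fun a f => by
    rw [volumeLifting, ofPencil_incl, pencil_incl, LinearMap.comp_apply, LinearMap.comp_apply,
      shift_triv, LinearEquiv.conj_apply_apply, LinearEquiv.symm_apply_apply, shift_triv]

theorem adDensity_conj (K : VectorField d M) (a : ℝ) (T : Module.End ℝ (Fn d M)) :
    adDensity K ((ρ.triv a).conj T) = (ρ.triv a).conj (ρ.lie K a * T - T * ρ.lie K a) := by
  rw [adDensity, lieDeriv_eq_conj ρ, map_sub]
  simp only [Module.End.mul_eq_comp, LinearEquiv.conj_comp]

theorem adAlgebra_pencil (K : VectorField d M) (F : ℝ → Module.End ℝ (Fn d M)) :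
    adAlgebra K (ρ.pencil F) = ρ.pencil fun a => ρ.lie K a * F a - F a * ρ.lie K a := by
  rw [adAlgebra, lieOp_eq_pencil ρ, ← map_mul, ← map_mul, ← map_sub]; rfl

/-- The volume form in the polynomiality condition may differ from `ρ`. Only preservation of weights
is kept here, and that suffices to read D off in the trivialization by `ρ`. -/
theorem exists_eq_pencil {D : Module.End ℝ (DensityAlgebra d M)} (hD : IsPolynomialPencil D) :
    ∃ F, D = ρ.pencil F := by
  obtain ⟨σ, m, T, h⟩ := hD
  refine ⟨_, Eq.trans ?_ (ofPencil_eq_pencil ρ fun a =>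
    ∑ k ∈ Finset.range (m + 1), a ^ k • (σ.shift 0 a ∘ₗ T k ∘ₗ σ.shift a 0))⟩
  refine linearMap_ext_incl fun a s => ?_
  rw [h, ofPencil_incl, LinearMap.sum_apply]; rfl

/-! ### Orders of pencils -/

/-- Functions on M act by constant families, so the vertical order is tested weight by weight and
ignores how the family depends on the weight. -/
theorem pencil_mem_vertical_iff (k : ℕ) (F : ℝ → Module.End ℝ (Fn d M)) :
    ρ.pencil F ∈ verticalFiltration d M k ↔ ∀ a, F a ∈ algDiffOp (Fn d M) k := by
  induction k generalizing F with
  | zero =>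
    simp only [mem_commFiltration_zero]
    constructor
    · intro h a
      exact congrFun (ρ.pencil_injective (h.trans (map_zero _).symm)) a
    · intro h
      rw [show F = 0 from funext h]; exact map_zero ρ.pencil
  | succ k ih =>
    rw [verticalFiltration, mem_commFiltration_succ, Set.forall_mem_range]
    rw [(ρ.triv 0).surjective.forall]
    have h : ∀ f : Fn d M, (ρ.pencil F * LinearMap.mulLeft ℝ (incl d M 0 (ρ.triv 0 f))
        - LinearMap.mulLeft ℝ (incl d M 0 (ρ.triv 0 f)) * ρ.pencil F
          ∈ verticalFiltration d M k) ↔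
        ∀ a, F a * mulOp f - mulOp f * F a ∈ algDiffOp (Fn d M) k := fun f => by
      rw [mulLeft_incl_zero, ← map_mul, ← map_mul, ← map_sub, ih]; rfl
    refine (forall_congr' h).trans ?_
    rw [forall_comm]
    exact forall_congr' fun a => mem_algDiffOp_succ.symm

theorem mem_of_pencil_mem {k : ℕ} {F : ℝ → Module.End ℝ (Fn d M)}
    (h : ρ.pencil F ∈ commFiltration
      (Set.range (LinearMap.mulLeft ℝ (A := DensityAlgebra d M))) k) (a : ℝ) :
    F a ∈ algDiffOp (Fn d M) k := by
  refine (pencil_mem_vertical_iff ρ k F).mp (commFiltration_antitone ?_ k h) a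
  rintro _ ⟨f, rfl⟩
  exact ⟨_, rfl⟩

theorem mul_sub_mul_mem_of_triv {D : Module.End ℝ (DensityAlgebra d M)}
    {W : Submodule ℝ (Module.End ℝ (DensityAlgebra d M))}
    (h : ∀ b (g : Fn d M), D * LinearMap.mulLeft ℝ (incl d M b (ρ.triv b g))
      - LinearMap.mulLeft ℝ (incl d M b (ρ.triv b g)) * D ∈ W) (s : DensityAlgebra d M) :
    D * LinearMap.mulLeft ℝ s - LinearMap.mulLeft ℝ s * D ∈ W := by
  obtain ⟨I, hI⟩ := exists_eq_sum_incl s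
  have e : LinearMap.mulLeft ℝ s
      = ∑ a ∈ I, LinearMap.mulLeft ℝ (incl d M a (weightComponent a s)) := by
    conv_lhs => rw [hI]
    ext1 t
    simp only [LinearMap.mulLeft_apply, LinearMap.sum_apply, Finset.sum_mul]
  rw [e, Finset.mul_sum, Finset.sum_mul, ← Finset.sum_sub_distrib]
  refine sum_mem fun a _ => ?_
  obtain ⟨f, hf⟩ := (ρ.triv a).surjective (weightComponent a s)
  rw [← hf]
  exact h a f

theorem mulLeft_mem (s : DensityAlgebra d M) : LinearMap.mulLeft ℝ s ∈ commFiltration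
    (Set.range (LinearMap.mulLeft ℝ (A := DensityAlgebra d M))) 1 := by
  rw [mem_commFiltration_succ, Set.forall_mem_range]
  intro t
  rw [mem_commFiltration_zero, sub_eq_zero]
  exact mulOp_comm _ _

/-- A constant family commutes with multiplication by ρ^b, so its commutator with ρ^b g is the
constant family [T, g] followed by multiplication by ρ^b, and the induction on the order goes
through for all densities. -/
theorem pencil_const_mem {k : ℕ} {T : Module.End ℝ (Fn d M)} (hT : T ∈ algDiffOp (Fn d M) k) :
    (ρ.pencil fun _ => T) ∈ commFiltration
      (Set.range (LinearMap.mulLeft ℝ (A := DensityAlgebra d M))) k := by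
  induction k generalizing T with
  | zero =>
    rw [mem_commFiltration_zero] at hT ⊢
    subst hT
    exact map_zero ρ.pencil
  | succ k ih =>
    rw [mem_commFiltration_succ, Set.forall_mem_range]
    refine mul_sub_mul_mem_of_triv ρ fun b g => ?_
    have e : (ρ.pencil fun _ => T) * LinearMap.mulLeft ℝ (incl d M b (ρ.triv b g))
        - LinearMap.mulLeft ℝ (incl d M b (ρ.triv b g)) * (ρ.pencil fun _ => T)
        = (ρ.pencil fun _ => T * mulOp g - mulOp g * T)
          * LinearMap.mulLeft ℝ (incl d M b (ρ.triv b 1)) :=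
      linearMap_ext_triv ρ fun a f => by
        simp only [LinearMap.sub_apply, Module.End.mul_apply, LinearMap.mulLeft_apply,
          incl_mul_incl, pencil_incl, map_sub, one_mul]
    rw [e]
    exact mul_mem_commFiltration_right (ih (hT _ ⟨g, rfl⟩)) (mulLeft_mem _)

/-- For s of weight b the commutator of ŵ with s is b s, so ŵ is an operator of order one. -/
theorem weightOp_mem (ρ : VolumeForm d M) : weightOp d M ∈ commFiltration
    (Set.range (LinearMap.mulLeft ℝ (A := DensityAlgebra d M))) 2 := by
  rw [mem_commFiltration_succ, Set.forall_mem_range]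
  refine mul_sub_mul_mem_of_triv ρ fun b g => ?_
  have e : weightOp d M * LinearMap.mulLeft ℝ (incl d M b (ρ.triv b g))
      - LinearMap.mulLeft ℝ (incl d M b (ρ.triv b g)) * weightOp d M
      = b • LinearMap.mulLeft ℝ (incl d M b (ρ.triv b g)) := by
    rw [weightOp_eq_pencil ρ]
    refine linearMap_ext_triv ρ fun a f => ?_
    simp only [LinearMap.sub_apply, Module.End.mul_apply, LinearMap.mulLeft_apply,
      incl_mul_incl, pencil_incl, LinearMap.smul_apply, Module.End.one_apply, map_smul]
    rw [← sub_smul, add_sub_cancel_right]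
  rw [e]
  exact Submodule.smul_mem _ _ (mulLeft_mem _)

end VolumeForm

end Pencil

/-! ### Polynomial dependence on the weight -/

section PolynomialFamily

variable {V : Type*} [AddCommGroup V] [Module ℝ V]

/-- Families of operators that depend polynomially on a parameter. -/
def IsPolynomialFamily (F : ℝ → Module.End ℝ V) : Prop :=
  ∃ q : Polynomial (Module.End ℝ V), ∀ a, F a = q.sum fun k T => a ^ k • T

theorem IsPolynomialFamily.add {F G : ℝ → Module.End ℝ V} (hF : IsPolynomialFamily F)
    (hG : IsPolynomialFamily G) : IsPolynomialFamily (F + G) := by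
  obtain ⟨p, hp⟩ := hF
  obtain ⟨q, hq⟩ := hG
  refine ⟨p + q, fun a => ?_⟩
  rw [Pi.add_apply, hp, hq, Polynomial.sum_add_index _ _ _ (fun k => smul_zero _)
    (fun k S T => smul_add _ _ _)]

theorem isPolynomialFamily_eval_smul (p : Polynomial ℝ) (T : Module.End ℝ V) :
    IsPolynomialFamily fun a => p.eval a • T := by
  induction p using Polynomial.induction_on' with
  | add p q hp hq =>
    simp only [Polynomial.eval_add, add_smul]
    exact hp.add hq
  | monomial n c =>
    refine ⟨Polynomial.monomial n (c • T), fun a => ?_⟩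
    rw [Polynomial.sum_monomial_index (c • T) (fun k T => a ^ k • T) (smul_zero _),
      smul_smul, mul_comm, ← Polynomial.eval_monomial]

end PolynomialFamily

/-! ### Adjoints on the algebra of densities -/

section AlgebraAdjoint

variable {d : ℕ} {M : Type*} [TopologicalSpace M] [ChartedSpace (Euc d) M]
  [IsManifold (𝓡 d) ∞ M]

theorem IsPolynomialFamily.isPolynomialPencil (ρ : VolumeForm d M)
    {F : ℝ → Module.End ℝ (Fn d M)} (hF : IsPolynomialFamily F) :
    IsPolynomialPencil (ρ.pencil F) := by
  obtain ⟨q, hq⟩ := hF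
  refine ⟨ρ, q.natDegree, fun k => (ρ.triv 0).conj (q.coeff k), fun a s => ?_⟩
  obtain ⟨f, rfl⟩ := (ρ.triv a).surjective s
  rw [ρ.pencil_incl, hq, q.sum_over_range fun k => smul_zero _, LinearMap.sum_apply, map_sum]
  congr 1
  refine Finset.sum_congr rfl fun k _ => ?_
  rw [ρ.shift_triv, LinearEquiv.conj_apply_apply, LinearEquiv.symm_apply_apply, ρ.shift_triv,
    LinearMap.smul_apply, map_smul]

namespace VolumeForm

variable (ρ : VolumeForm d M)

/-- The function `ρ^(-a) s_a`, where `s_a` is the component of weight `a` of `s`. -/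
def coord (a : ℝ) : DensityAlgebra d M →ₗ[ℝ] Fn d M :=
  (ρ.triv a).symm.toLinearMap ∘ₗ weightComponent a

theorem coord_incl_self (a : ℝ) (f : Fn d M) : ρ.coord a (incl d M a (ρ.triv a f)) = f := by
  rw [coord, LinearMap.comp_apply, weightComponent_incl_self]
  exact (ρ.triv a).symm_apply_apply f

theorem coord_incl_of_ne {a b : ℝ} (h : b ≠ a) (s : Density d M b) :
    ρ.coord a (incl d M b s) = 0 := by
  rw [coord, LinearMap.comp_apply, weightComponent_incl_of_ne h, map_zero]

theorem eq_sum_coord (s : DensityAlgebra d M) :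
    ∃ I : Finset ℝ, s = ∑ a ∈ I, incl d M a (ρ.triv a (ρ.coord a s)) := by
  obtain ⟨I, hI⟩ := exists_eq_sum_incl s
  refine ⟨I, hI.trans (Finset.sum_congr rfl fun a _ => congrArg _ ?_)⟩
  exact ((ρ.triv a).apply_symm_apply _).symm

theorem coord_pencil (F : ℝ → Module.End ℝ (Fn d M)) (a : ℝ) (s : DensityAlgebra d M) :
    ρ.coord a (ρ.pencil F s) = F a (ρ.coord a s) := by
  refine LinearMap.congr_fun (f := ρ.coord a ∘ₗ ρ.pencil F) (g := F a ∘ₗ ρ.coord a)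
    (linearMap_ext_triv ρ fun b f => ?_) s
  rw [LinearMap.comp_apply, LinearMap.comp_apply, pencil_incl]
  by_cases h : b = a
  · subst h; rw [coord_incl_self, coord_incl_self]
  · rw [coord_incl_of_ne ρ h, coord_incl_of_ne ρ h, map_zero]

theorem weightComponent_one_mul (a : ℝ) (f : Fn d M) (t : DensityAlgebra d M) :
    weightComponent 1 (incl d M a (ρ.triv a f) * t) = ρ.triv 1 (f * ρ.coord (1 - a) t) := by
  refine LinearMap.congr_fun (f := weightComponent 1 ∘ₗ
      LinearMap.mulLeft ℝ (incl d M a (ρ.triv a f)))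
    (g := (ρ.triv 1).toLinearMap ∘ₗ mulOp f ∘ₗ ρ.coord (1 - a))
    (linearMap_ext_triv ρ fun b g => ?_) t
  change weightComponent 1 (incl d M a (ρ.triv a f) * incl d M b (ρ.triv b g))
    = ρ.triv 1 (f * ρ.coord (1 - a) (incl d M b (ρ.triv b g)))
  rw [incl_mul_incl]
  by_cases h : b = 1 - a
  · subst h
    rw [coord_incl_self, add_sub_cancel, weightComponent_incl_self]
  · rw [coord_incl_of_ne ρ h, weightComponent_incl_of_ne (by intro h'; apply h; linarith),
      mul_zero, map_zero]

variable [T2Space M] [SigmaCompactSpace M]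

theorem hasCompactSupport_coord {s : DensityAlgebra d M} (hs : HasCompactSupp s) (a : ℝ) :
    HasCompactSupport (ρ.coord a s) := by
  obtain ⟨C, hC, h⟩ := hs
  refine HasCompactSupport.intro hC fun x hx => ?_
  change (ρ.triv a).symm (weightComponent a s) x = 0
  rw [triv_symm_apply, h a (basePoint d x) (by rwa [basePoint_symm]), mul_zero]

theorem hasCompactSupp_incl (a : ℝ) {f : Fn d M} (hf : HasCompactSupport f) :
    HasCompactSupp (incl d M a (ρ.triv a f)) := by
  refine ⟨tsupport f, hf, fun b p hp => ?_⟩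
  by_cases h : a = b
  · subst h
    rw [weightComponent_incl_self, triv_apply, image_eq_zero_of_notMem_tsupport hp, mul_zero]
  · rw [weightComponent_incl_of_ne h]; rfl

theorem scalarProduct_sum (I : Finset ℝ) {u : ℝ → Fn d M} (hu : ∀ a, HasCompactSupport (u a))
    (t : DensityAlgebra d M) :
    scalarProduct (∑ a ∈ I, incl d M a (ρ.triv a (u a))) t
      = ∑ a ∈ I, ρ.int (u a * ρ.coord (1 - a) t) := by
  rw [scalarProduct, Finset.sum_mul, map_sum]
  simp_rw [weightComponent_one_mul]
  rw [← map_sum, ← int_sum ρ I fun a => hasCompactSupport_mul_left (hu a) _]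
  rfl

/-- The scalar product pairs weight a with weight 1 - a, so adjointness of families is adjointness
on functions of the members at a and 1 - a. -/
theorem isAdjoint_pencil {k : ℕ} {F G : ℝ → Module.End ℝ (Fn d M)}
    (hF : ∀ a, F a ∈ algDiffOp (Fn d M) k) (hG : ∃ n, IsDiffOpAlg n (ρ.pencil G))
    (h : ∀ a, IsFnAdjoint ρ (F a) (G (1 - a))) : IsAdjoint (ρ.pencil F) (ρ.pencil G) := by
  refine ⟨hG, fun s t hs ht => ?_⟩
  obtain ⟨I, hI⟩ := ρ.eq_sum_coord s
  have hsa := ρ.hasCompactSupport_coord hs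
  have hFs : ρ.pencil F s = ∑ a ∈ I, incl d M a (ρ.triv a (F a (ρ.coord a s))) := by
    conv_lhs => rw [hI]
    rw [map_sum]
    exact Finset.sum_congr rfl fun a _ => ρ.pencil_incl F a _
  rw [hFs, ρ.scalarProduct_sum I fun a => hasCompactSupport_apply (hF a) (hsa a)]
  conv_rhs => rw [hI]
  rw [ρ.scalarProduct_sum I hsa]
  refine Finset.sum_congr rfl fun a _ => ?_
  rw [coord_pencil]
  exact h a _ _ (hsa a) (ρ.hasCompactSupport_coord ht _)

/-- Conversely, testing on ρ^a f and ρ^(1-a) g isolates one weight. That the adjoint preserves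
weights is part of its being a polynomial pencil. -/
theorem exists_pencil_of_isAdjoint {F : ℝ → Module.End ℝ (Fn d M)}
    {D : Module.End ℝ (DensityAlgebra d M)} (h : IsAdjoint (ρ.pencil F) D) :
    ∃ (G : ℝ → Module.End ℝ (Fn d M)) (k : ℕ), D = ρ.pencil G ∧
      (∀ a, G a ∈ algDiffOp (Fn d M) k) ∧ ∀ a, IsFnAdjoint ρ (F a) (G (1 - a)) := by
  obtain ⟨⟨n, hn⟩, hadj⟩ := h
  obtain ⟨G, rfl⟩ := ρ.exists_eq_pencil hn.polynomial
  refine ⟨G, n + 1, rfl, ρ.mem_of_pencil_mem hn.order_le, fun a f g hf hg => ?_⟩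
  have key : ∀ u v : Fn d M, scalarProduct (incl d M a (ρ.triv a u))
      (incl d M (1 - a) (ρ.triv (1 - a) v)) = ρ.int (u * v) := fun u v => by
    rw [scalarProduct, weightComponent_one_mul, coord_incl_self]; rfl
  have := hadj _ _ (ρ.hasCompactSupp_incl a hf) (ρ.hasCompactSupp_incl (1 - a) hg)
  rwa [pencil_incl, pencil_incl, key, key] at this

theorem isAdjoint_unique {F : ℝ → Module.End ℝ (Fn d M)}
    {D D' : Module.End ℝ (DensityAlgebra d M)} (h : IsAdjoint (ρ.pencil F) D)
    (h' : IsAdjoint (ρ.pencil F) D') : D = D' := by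
  obtain ⟨G, k, rfl, hG, hFG⟩ := ρ.exists_pencil_of_isAdjoint h
  obtain ⟨G', k', rfl, hG', hFG'⟩ := ρ.exists_pencil_of_isAdjoint h'
  congr 1
  ext1 a
  have := (hFG (1 - a)).unique (hFG' (1 - a)) (hG _) (hG' _)
  rwa [sub_sub_cancel] at this

theorem adjointOp_eq {F : ℝ → Module.End ℝ (Fn d M)}
    {D : Module.End ℝ (DensityAlgebra d M)} (h : IsAdjoint (ρ.pencil F) D) :
    adjointOp (ρ.pencil F) = D := by
  have hex : ∃ D, IsAdjoint (ρ.pencil F) D := ⟨D, h⟩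
  rw [adjointOp, dif_pos hex]
  exact ρ.isAdjoint_unique hex.choose_spec h

theorem isDiffOpAlg_pencil_const {n : ℕ} {T : Module.End ℝ (Fn d M)}
    (hT : T ∈ algDiffOp (Fn d M) (n + 1)) : IsDiffOpAlg n (ρ.pencil fun _ => T) where
  order_le := ρ.pencil_const_mem hT
  polynomial := by
    have h := isPolynomialFamily_eval_smul 1 T
    simp only [Polynomial.eval_one, one_smul] at h
    exact h.isPolynomialPencil ρ

theorem isAdjoint_pencil_const {n : ℕ} {T T' : Module.End ℝ (Fn d M)}
    (hT : T ∈ algDiffOp (Fn d M) (n + 1)) (hT' : T' ∈ algDiffOp (Fn d M) (n + 1))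
    (h : IsFnAdjoint ρ T T') : IsAdjoint (ρ.pencil fun _ => T) (ρ.pencil fun _ => T') :=
  ρ.isAdjoint_pencil (fun _ => hT) ⟨n, ρ.isDiffOpAlg_pencil_const hT'⟩ fun _ => h

end VolumeForm

end AlgebraAdjoint

theorem mul_mem_commFiltration_add {V : Type*} [AddCommGroup V] [Module ℝ V]
    {S : Set (Module.End ℝ V)} {j k : ℕ} {D D' : Module.End ℝ V}
    (hD : D ∈ commFiltration S (j + 1)) (hD' : D' ∈ commFiltration S k) :
    D * D' ∈ commFiltration S (j + k) := by
  rcases k with _ | k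
  · rw [mem_commFiltration_zero.mp hD', mul_zero]; exact zero_mem _
  · exact mul_mem_commFiltration hD hD'

theorem aeval_mem_commFiltration {V : Type*} [AddCommGroup V] [Module ℝ V]
    {S : Set (Module.End ℝ V)} {D : Module.End ℝ V} (hD : D ∈ commFiltration S 2)
    {p : Polynomial ℝ} {k : ℕ} (hp : p.natDegree ≤ k) :
    Polynomial.aeval D p ∈ commFiltration S (k + 1) := by
  rw [Polynomial.aeval_eq_sum_range' (Nat.lt_succ_of_le hp)]
  refine sum_mem fun i hi => Submodule.smul_mem _ _ ?_
  have := Finset.mem_range.mp hi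
  exact commFiltration_mono (by omega) (pow_mem_commFiltration hD i)

theorem commutator_mulOp_mem {A : Type*} [CommRing A] [Algebra ℝ A] {n : ℕ}
    {T : Module.End ℝ A} (hT : T ∈ algDiffOp A n) (f : A) :
    mulOp f * T - T * mulOp f ∈ algDiffOp A (n - 1) := by
  rcases n with _ | n
  · rw [mem_commFiltration_zero.mp hT, mul_zero, zero_mul, sub_zero]; exact zero_mem _
  · exact mulOp_comm_mem hT f

theorem mem_of_eq_of_mem {V : Type*} [AddCommGroup V] [Module ℝ V] {p : Submodule ℝ V} {x y : V}
    (h : x = y) (hy : y ∈ p) : x ∈ p := h ▸ hy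

theorem neg_add_one_sub_smul {V : Type*} [AddCommGroup V] [Module ℝ V] (X D : V) (a : ℝ) :
    -(X + (1 - a) • D) = -X - D + a • D := by
  module

theorem mul_neg_sub_neg_mul {R : Type*} [Ring R] (X Y : R) : Y * -X - -X * Y = X * Y - Y * X := by
  noncomm_ring

theorem smul_mul_sub_mul_smul {R : Type*} [Ring R] [Algebra ℝ R] (c : ℝ) (X Y : R) :
    (c • X) * Y - Y * (c • X) = c • (X * Y - Y * X) := by
  rw [smul_mul_assoc, mul_smul_comm, smul_sub]

/-! ### The family of liftings and the distinguished lifting -/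

section Liftings

variable {d : ℕ} {M : Type*} [TopologicalSpace M] [ChartedSpace (Euc d) M]
  [IsManifold (𝓡 d) ∞ M]

theorem IsDiffOpAlg.smul {n : ℕ} {D : Module.End ℝ (DensityAlgebra d M)} (h : IsDiffOpAlg n D)
    (c : ℝ) : IsDiffOpAlg n (c • D) where
  order_le := Submodule.smul_mem _ c h.order_le
  polynomial := by
    obtain ⟨ρ, m, T, hT⟩ := h.polynomial
    refine ⟨ρ, m, fun k => c • T k, fun a s => ?_⟩
    rw [LinearMap.smul_apply, hT, ← map_smul, Finset.smul_sum]
    congr 1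
    refine Finset.sum_congr rfl fun k _ => ?_
    rw [LinearMap.smul_apply, map_smul, smul_comm]

variable [T2Space M] [SigmaCompactSpace M] (ρ : VolumeForm d M) {n : ℕ} {lam : ℝ}
  {T T' : Module.End ℝ (Fn d M)}

/-- The adjoint of a differential operator of order at most `n` on functions, with the same
principal symbol up to sign. -/
structure IsSymbolAdjoint (ρ : VolumeForm d M) (n : ℕ) (T T' : Module.End ℝ (Fn d M)) : Prop where
  mem : T ∈ algDiffOp (Fn d M) (n + 1)
  mem_adjoint : T' ∈ algDiffOp (Fn d M) (n + 1)
  adjoint : IsFnAdjoint ρ T T'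
  symbol : T - (-1 : ℝ) ^ n • T' ∈ algDiffOp (Fn d M) n

theorem exists_isSymbolAdjoint (hT : T ∈ algDiffOp (Fn d M) (n + 1)) :
    ∃ T', IsSymbolAdjoint ρ n T T' := by
  obtain ⟨T', h1, h2, h3⟩ := exists_fnAdjoint ρ hT
  exact ⟨T', hT, h1, h2, h3⟩

theorem exists_conj_isSymbolAdjoint {Δ : Module.End ℝ (Density d M lam)}
    (hΔ : Δ ∈ DiffOp d M n lam) :
    ∃ T T', Δ = (ρ.triv lam).conj T ∧ IsSymbolAdjoint ρ n T T' := by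
  obtain ⟨T, rfl⟩ := (ρ.triv lam).conj.surjective Δ
  obtain ⟨T', h⟩ := exists_isSymbolAdjoint ρ ((mem_diffOp_iff ρ n lam T).mp hΔ)
  exact ⟨T, T', rfl, h⟩

namespace IsSymbolAdjoint

variable {ρ}

theorem isAdjoint (h : IsSymbolAdjoint ρ n T T') :
    IsAdjoint (ρ.pencil fun _ => T) (ρ.pencil fun _ => T') :=
  ρ.isAdjoint_pencil_const h.mem h.mem_adjoint h.adjoint

/-- Lie derivatives of adjoint operators are adjoint. -/
theorem lie (h : IsSymbolAdjoint ρ n T T') (K : VectorField d M) (a : ℝ) :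
    IsSymbolAdjoint ρ n (ρ.lie K a * T - T * ρ.lie K a)
      (ρ.lie K (1 - a) * T' - T' * ρ.lie K (1 - a)) := by
  -- The Lie derivative in weight a is minus the adjoint of the one in weight 1 - a, by the
  -- divergence theorem. So ad_K Δ again has a symbol adjoint, namely T' bracketed with the Lie
  -- derivative in weight 1 - a.
  have hadj : IsFnAdjoint ρ (ρ.lie K a) (-ρ.lie K (1 - a)) := by
    convert (IsFnAdjoint.vfDeriv (ρ := ρ) K).add ((IsFnAdjoint.mulOp (ρ.div K)).smul a) using 1
    · rfl
    · exact neg_add_one_sub_smul _ _ a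
  have hm := ρ.lie_mem K
  have e : ∀ {j : ℕ} {S : Module.End ℝ (Fn d M)} (_ : S ∈ algDiffOp (Fn d M) (j + 1)) (b : ℝ),
      ρ.lie K b * S - S * ρ.lie K b ∈ algDiffOp (Fn d M) (j + 1) := fun hS b => by
    rw [add_comm]; exact commutator_mem (hm b) hS
  refine ⟨e h.mem a, e h.mem_adjoint (1 - a), ?_, ?_⟩
  · have h1 := (hadj.mul h.adjoint h.mem (neg_mem (hm (1 - a)))).sub
      (h.adjoint.mul hadj (hm a) h.mem_adjoint)
    convert h1 using 1
    exact (mul_neg_sub_neg_mul _ _).symm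
  · have h1 : ρ.lie K a * T - T * ρ.lie K a
        - (-1 : ℝ) ^ n • (ρ.lie K (1 - a) * T' - T' * ρ.lie K (1 - a))
        = (ρ.lie K a * (T - (-1 : ℝ) ^ n • T') - (T - (-1 : ℝ) ^ n • T') * ρ.lie K a)
          + (-1 : ℝ) ^ n • ((ρ.lie K a - ρ.lie K (1 - a)) * T'
            - T' * (ρ.lie K a - ρ.lie K (1 - a))) := by
      simp only [mul_sub, sub_mul, mul_smul_comm, smul_mul_assoc, smul_sub]
      abel
    rw [h1, ρ.lie_sub_lie]
    refine add_mem ?_ (Submodule.smul_mem _ _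
      (mem_of_eq_of_mem (smul_mul_sub_mul_smul _ _ _)
        (Submodule.smul_mem _ _ (mulOp_comm_mem h.mem_adjoint _))))
    rcases n with _ | n
    · rw [mem_commFiltration_zero.mp h.symbol, mul_zero, zero_mul, sub_zero]; exact zero_mem _
    · exact e h.symbol a

variable (lam) in
open Polynomial in
theorem familyLifting_eq (h : IsSymbolAdjoint ρ n T T') (b : ℝ) (c e : Fin n → ℝ) :
    familyLifting ρ n lam b c e ((ρ.triv lam).conj T) = ρ.pencil fun a =>
      (1 - b * (a - lam)) • T + ((-1) ^ n * (b * (a - lam))) • T'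
      + (∑ k : Fin n, c k * (a - lam) ^ (k.val + 1)) • mulOp (T 1)
      + (∑ k : Fin n, e k * (a - lam) ^ (k.val + 1)) • mulOp (T' 1) := by
  simp only [familyLifting, ρ.volumeLifting_eq_pencil, ρ.adjointOp_eq h.isAdjoint,
    ρ.pencil_const_one, ρ.mulLeft_incl_zero, ρ.aeval_weightOp_mul_pencil, ← map_add]
  congr 1
  ext1 a
  simp [eval_finsetSum]

variable (lam) in
open Polynomial in
theorem distinguishedLifting_eq (h : IsSymbolAdjoint ρ n T T') :
    distinguishedLifting ρ n lam ((ρ.triv lam).conj T) = ρ.pencil fun a =>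
      ((a + lam - 1) / (2 * lam - 1)) • T
        + ((-1) ^ n * ((lam - a) / (2 * lam - 1))) • T' := by
  simp only [distinguishedLifting, ρ.volumeLifting_eq_pencil, ρ.adjointOp_eq h.isAdjoint,
    ρ.aeval_weightOp_mul_pencil, ← map_add]
  congr 1
  ext1 a
  rw [Pi.add_apply]
  congr 2
  · simp; ring
  · simp; ring

variable (lam) in
theorem distinguishedLifting_eq_familyLifting (h : IsSymbolAdjoint ρ n T T')
    (hlam : lam ≠ 1 / 2) : distinguishedLifting ρ n lam ((ρ.triv lam).conj T)
      = familyLifting ρ n lam (1 / (1 - 2 * lam)) 0 0 ((ρ.triv lam).conj T) := by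
  rw [h.familyLifting_eq, h.distinguishedLifting_eq]
  congr 1
  ext1 a
  obtain ⟨x, hx⟩ : ∃ x, x = 2 * lam - 1 := ⟨_, rfl⟩
  have hx0 : x ≠ 0 := fun h => hlam (by linarith)
  have hx' : 1 - 2 * lam = -x := by rw [hx]; ring
  simp only [Pi.zero_apply, zero_mul, Finset.sum_const_zero, zero_smul, add_zero]
  have e1 : (a + lam - 1) / x = 1 - 1 / (-x) * (a - lam) := by
    field_simp
    rw [hx]; ring
  have e2 : (lam - a) / x = 1 / (-x) * (a - lam) := by
    field_simp
    ring
  rw [hx', ← hx, e1, e2]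

variable (lam) in
open Polynomial in
theorem isDiffOpAlg_familyLifting (h : IsSymbolAdjoint ρ n T T') (b : ℝ) (c e : Fin n → ℝ) :
    IsDiffOpAlg n (familyLifting ρ n lam b c e ((ρ.triv lam).conj T)) := by
  have hw := VolumeForm.weightOp_mem ρ
  have hdeg : ∀ c : Fin n → ℝ,
      (∑ k : Fin n, C (c k) * (X - C lam) ^ (k.val + 1)).natDegree ≤ n := fun c =>
    natDegree_sum_le_of_forall_le _ _ fun k _ => (natDegree_C_mul_le _ _).trans
      (natDegree_pow_le.trans (by rw [natDegree_X_sub_C]; omega))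
  refine ⟨?_, ?_⟩
  · have e1 : familyLifting ρ n lam b c e ((ρ.triv lam).conj T)
        = (ρ.pencil fun _ => T)
          - aeval (weightOp d M) (C b * (X - C lam))
              * (ρ.pencil fun _ => T - (-1 : ℝ) ^ n • T')
          + aeval (weightOp d M) (∑ k : Fin n, C (c k) * (X - C lam) ^ (k.val + 1))
              * (ρ.pencil fun _ => mulOp (T 1))
          + aeval (weightOp d M) (∑ k : Fin n, C (e k) * (X - C lam) ^ (k.val + 1))
              * (ρ.pencil fun _ => mulOp (T' 1)) := by
      rw [h.familyLifting_eq]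
      simp only [ρ.aeval_weightOp_mul_pencil, ← map_add, ← map_sub]
      congr 1
      ext1 a
      simp only [Pi.add_apply, Pi.sub_apply, eval_mul, eval_C, eval_sub, eval_X, eval_finsetSum,
        eval_pow]
      module
    rw [e1]
    refine add_mem (add_mem (sub_mem (ρ.pencil_const_mem h.mem) ?_) ?_) ?_
    · rw [add_comm n]
      refine mul_mem_commFiltration_add (aeval_mem_commFiltration hw ?_)
        (ρ.pencil_const_mem h.symbol)
      exact (natDegree_C_mul_le _ _).trans (natDegree_X_sub_C _).le
    · exact mul_mem_commFiltration_add (aeval_mem_commFiltration hw (hdeg c))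
        (ρ.pencil_const_mem (mulOp_mem _))
    · exact mul_mem_commFiltration_add (aeval_mem_commFiltration hw (hdeg e))
        (ρ.pencil_const_mem (mulOp_mem _))
  · rw [h.familyLifting_eq]
    have key := (((isPolynomialFamily_eval_smul (1 - C b * (X - C lam)) T).add
      (isPolynomialFamily_eval_smul ((-1) ^ n * (C b * (X - C lam))) T')).add
      (isPolynomialFamily_eval_smul (∑ k : Fin n, C (c k) * (X - C lam) ^ (k.val + 1))
        (mulOp (T 1)))).add
      (isPolynomialFamily_eval_smul (∑ k : Fin n, C (e k) * (X - C lam) ^ (k.val + 1))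
        (mulOp (T' 1)))
    convert key.isPolynomialPencil ρ using 2
    ext1 a
    simp [eval_finsetSum]

variable (lam) in
theorem familyLifting_incl (h : IsSymbolAdjoint ρ n T T') (b : ℝ) (c e : Fin n → ℝ)
    (s : Density d M lam) :
    familyLifting ρ n lam b c e ((ρ.triv lam).conj T) (incl d M lam s)
      = incl d M lam ((ρ.triv lam).conj T s) := by
  obtain ⟨f, rfl⟩ := (ρ.triv lam).surjective s
  rw [h.familyLifting_eq, ρ.pencil_incl, LinearEquiv.conj_apply_apply,
    LinearEquiv.symm_apply_apply]
  simp

variable (lam) in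
theorem isAdjoint_distinguishedLifting (h : IsSymbolAdjoint ρ n T T') (hlam : lam ≠ 1 / 2) :
    IsAdjoint (distinguishedLifting ρ n lam ((ρ.triv lam).conj T))
      ((-1 : ℝ) ^ n • distinguishedLifting ρ n lam ((ρ.triv lam).conj T)) := by
  have hD : IsDiffOpAlg n ((-1 : ℝ) ^ n • distinguishedLifting ρ n lam ((ρ.triv lam).conj T)) := by
    rw [h.distinguishedLifting_eq_familyLifting lam hlam]
    exact (h.isDiffOpAlg_familyLifting lam _ _ _).smul _
  rw [h.distinguishedLifting_eq, ← map_smul] at hD ⊢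
  refine ρ.isAdjoint_pencil (k := n + 1) (fun a => add_mem (Submodule.smul_mem _ _ h.mem)
    (Submodule.smul_mem _ _ h.mem_adjoint)) ⟨n, hD⟩ fun a => ?_
  -- Replacing a by 1 - a turns a + λ - 1 into λ - a and conversely, so the two coefficients trade
  -- places up to the sign (-1)^n.
  convert (h.adjoint.smul ((a + lam - 1) / (2 * lam - 1))).add
    (h.adjoint.symm.smul ((-1) ^ n * ((lam - a) / (2 * lam - 1)))) using 1
  have hs : ((-1 : ℝ) ^ n) * (-1) ^ n = 1 := by rw [← mul_pow]; norm_num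
  rw [Pi.smul_apply, smul_add, smul_smul, smul_smul, ← mul_assoc, hs, add_comm]
  congr 2
  · ring
  · ring

end IsSymbolAdjoint

end Liftings

/-- Here X, Y, Z are the Lie derivatives in weights a, λ, 1 - λ, and m is div K. The lifting of ad_K
Δ brackets T with Y and T' with Z, while ad_K of the lifting uses X throughout; the differences are
brackets with m. -/
theorem commutator_combination {R : Type*} [Ring R] [Algebra ℝ R]
    {X Y Z T T' C C' D D' m U V : R} {s t : ℝ} (α β γ δ : ℝ) (hY : X - Y = s • m)
    (hZ : X - Z = t • m) (hC : X * C - C * X - C' = U) (hD : X * D - D * X - D' = V) :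
    (X * (α • T + β • T' + γ • C + δ • D) - (α • T + β • T' + γ • C + δ • D) * X)
      - (α • (Y * T - T * Y) + β • (Z * T' - T' * Z) + γ • C' + δ • D')
    = (α * s) • (m * T - T * m) + (β * t) • (m * T' - T' * m) + γ • U + δ • V := by
  obtain rfl : Y = X - s • m := by rw [← hY]; abel
  obtain rfl : Z = X - t • m := by rw [← hZ]; abel
  subst hC hD
  simp only [mul_add, add_mul, mul_sub, sub_mul, mul_smul_comm, smul_mul_assoc]
  module

theorem smul_commutator_sub_smul_commutator {R : Type*} [Ring R] [Algebra ℝ R] (m T T' : R)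
    (c e : ℝ) : c • (m * T - T * m) - (e * c) • (m * T' - T' * m)
      = c • (m * (T - e • T') - (T - e • T') * m) := by
  simp only [mul_sub, sub_mul, mul_smul_comm, smul_mul_assoc]
  module

theorem conj_identity {R : Type*} [Ring R] [Algebra ℝ R] {E F : R} (h : E * F = 1) (T L : R)
    (c : ℝ) : E * T * F - T - c • (L * T - T * L)
      = E * ((T * F - F * T) - ((-c) • F) * (T * L - L * T)) := by
  have h1 : ∀ S, E * (F * S) = S := fun S => by rw [← mul_assoc, h, one_mul]
  simp only [mul_sub, neg_smul, neg_mul, smul_mul_assoc, mul_neg, mul_smul_comm, h1, mul_assoc]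
  module

/-! ### Equivariance of the liftings -/

section Equivariance

variable {d : ℕ} {M : Type*} [TopologicalSpace M] [ChartedSpace (Euc d) M]
  [IsManifold (𝓡 d) ∞ M]

theorem VolumeForm.lie_commutator_mulOp (ρ : VolumeForm d M) (K : VectorField d M) (a : ℝ)
    (f : Fn d M) : ρ.lie K a * mulOp f - mulOp f * ρ.lie K a = mulOp (vfDeriv K f) := by
  ext1 g
  change vfDeriv K (f * g) + a • (ρ.div K * (f * g))
    - f * (vfDeriv K g + a • (ρ.div K * g)) = vfDeriv K f * g
  rw [Derivation.leibniz, mul_add, mul_smul_comm, mul_left_comm (ρ.div K)]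
  simp only [smul_eq_mul]
  rw [mul_comm g]
  abel

theorem VolumeForm.div_eq_zero {ρ : VolumeForm d M} {K : VectorField d M}
    (hK : K ∈ divergenceless ρ) : ρ.div K = 0 := by
  have h1 : ρ.triv 1 1 = ρ.toDensity := Subtype.ext (funext fun p => by
    rw [triv_apply, Real.rpow_one]; exact mul_one _)
  have h2 := lieDeriv_triv ρ K 1 1
  rw [h1, (hK : lieDeriv K 1 ρ.toDensity = 0), Derivation.map_one_eq_zero, zero_add, one_smul,
    mul_one] at h2
  exact (ρ.triv 1).map_eq_zero_iff.mp h2.symm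

variable [T2Space M] [SigmaCompactSpace M] {ρ : VolumeForm d M} {n : ℕ}
  {T T' : Module.End ℝ (Fn d M)}

namespace IsSymbolAdjoint

/-- T and (-1)^n T' have the same symbol of order n, so their brackets with a function agree up to
order n - 2; for n ≤ 1 they agree exactly, in accordance with the truncated n - 1. -/
theorem commutator_mem (h : IsSymbolAdjoint ρ n T T') (f : Fn d M) (c : ℝ) :
    c • (mulOp f * T - T * mulOp f) - ((-1) ^ n * c) • (mulOp f * T' - T' * mulOp f)
      ∈ algDiffOp (Fn d M) (n - 1) :=
  mem_of_eq_of_mem (smul_commutator_sub_smul_commutator _ _ _ _ _)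
    (Submodule.smul_mem _ c (commutator_mulOp_mem h.symbol f))

variable (lam : ℝ)

/-- The equivariance defect of a member of the family of liftings. -/
theorem adAlgebra_familyLifting_sub (h : IsSymbolAdjoint ρ n T T') (b : ℝ) (c e : Fin n → ℝ)
    (K : VectorField d M) :
    adAlgebra K (familyLifting ρ n lam b c e ((ρ.triv lam).conj T))
      - familyLifting ρ n lam b c e (adDensity K ((ρ.triv lam).conj T)) = ρ.pencil fun a =>
      ((1 - b * (a - lam)) * (a - lam)) • (mulOp (ρ.div K) * T - T * mulOp (ρ.div K))
      + ((-1) ^ n * (b * (a - lam)) * (a - (1 - lam))) •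
          (mulOp (ρ.div K) * T' - T' * mulOp (ρ.div K))
      + (∑ k : Fin n, c k * (a - lam) ^ (k.val + 1)) •
          mulOp (vfDeriv K (T 1) - (ρ.lie K lam * T - T * ρ.lie K lam) 1)
      + (∑ k : Fin n, e k * (a - lam) ^ (k.val + 1)) •
          mulOp (vfDeriv K (T' 1) - (ρ.lie K (1 - lam) * T' - T' * ρ.lie K (1 - lam)) 1) := by
  rw [ρ.adDensity_conj, h.familyLifting_eq, (h.lie K lam).familyLifting_eq, ρ.adAlgebra_pencil,
    ← map_sub]
  congr 1
  ext1 a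
  refine commutator_combination _ _ _ _ (ρ.lie_sub_lie K a lam) (ρ.lie_sub_lie K a (1 - lam)) ?_ ?_
  · rw [ρ.lie_commutator_mulOp]
    exact (map_sub (LinearMap.mul ℝ (Fn d M)) _ _).symm
  · rw [ρ.lie_commutator_mulOp]
    exact (map_sub (LinearMap.mul ℝ (Fn d M)) _ _).symm

/-- When div K = 0 the Lie derivative is the derivation K in every weight, and K(T 1) = [K, T] 1
since K kills constants. Hence every term of the defect vanishes. -/
theorem familyLifting_equivariant (h : IsSymbolAdjoint ρ n T T') (b : ℝ) (c e : Fin n → ℝ)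
    {K : VectorField d M} (hK : K ∈ divergenceless ρ) :
    adAlgebra K (familyLifting ρ n lam b c e ((ρ.triv lam).conj T))
      = familyLifting ρ n lam b c e (adDensity K ((ρ.triv lam).conj T)) := by
  rw [← sub_eq_zero, h.adAlgebra_familyLifting_sub]
  have hdiv := VolumeForm.div_eq_zero hK
  have h0 : ∀ S : Module.End ℝ (Fn d M),
      mulOp (0 : Fn d M) * S - S * mulOp (0 : Fn d M) = 0 := fun S => by
    rw [show mulOp (0 : Fn d M) = 0 from map_zero (LinearMap.mul ℝ (Fn d M)), zero_mul, mul_zero,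
      sub_zero]
  have h1 : ∀ (S : Module.End ℝ (Fn d M)) (a : ℝ),
      vfDeriv K (S 1) - (ρ.lie K a * S - S * ρ.lie K a) 1 = 0 := fun S a => by
    change vfDeriv K (S 1) - (vfDeriv K (S 1) + a • (ρ.div K * S 1)
      - S (vfDeriv K 1 + a • (ρ.div K * 1))) = 0
    rw [hdiv, zero_mul, zero_mul, smul_zero, Derivation.map_one_eq_zero, add_zero, add_zero,
      map_zero, sub_zero, sub_self]
  simp only [h1, hdiv, h0, smul_zero, zero_add]
  have h2 : mulOp (0 : Fn d M) = 0 := map_zero (LinearMap.mul ℝ (Fn d M))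
  simp only [h2, smul_zero, add_zero]
  exact map_zero ρ.pencil

theorem adAlgebra_distinguishedLifting_sub_mem (h : IsSymbolAdjoint ρ n T T')
    (hlam : lam ≠ 1 / 2) (K : VectorField d M) :
    adAlgebra K (distinguishedLifting ρ n lam ((ρ.triv lam).conj T))
      - distinguishedLifting ρ n lam (adDensity K ((ρ.triv lam).conj T))
        ∈ verticalFiltration d M (n - 1) := by
  have h1 := (h.lie K lam).distinguishedLifting_eq_familyLifting lam hlam
  rw [← ρ.adDensity_conj] at h1
  rw [h1, h.distinguishedLifting_eq_familyLifting lam hlam, h.adAlgebra_familyLifting_sub,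
    ρ.pencil_mem_vertical_iff]
  intro a
  simp only [Pi.zero_apply, zero_mul, Finset.sum_const_zero]
  have hx : 1 - 2 * lam ≠ 0 := fun h => hlam (by linarith)
  convert h.commutator_mem (ρ.div K) ((1 - 1 / (1 - 2 * lam) * (a - lam)) * (a - lam)) using 1
  -- For b = 1/(1 - 2λ) one has 1 - b(a - λ) = -b(a + λ - 1), so the coefficients of the two
  -- brackets are opposite up to (-1)^n and their symbols cancel.
  have e : (-1 : ℝ) ^ n * (1 / (1 - 2 * lam) * (a - lam)) * (a - (1 - lam))
      = -((-1) ^ n * ((1 - 1 / (1 - 2 * lam) * (a - lam)) * (a - lam))) := by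
    field_simp
    ring
  rw [e]
  module

end IsSymbolAdjoint

/-! ### Change of the volume form -/

theorem exists_log (ρ ρ' : VolumeForm d M) : ∃ l : Fn d M,
    ∀ p : LocalPoint d M, ρ'.toDensity.1 p
      = ρ.toDensity.1 p * Real.exp (l (p.1.1.symm p.1.2)) := by
  set g := (ρ.triv 1).symm ρ'.toDensity with hg
  have hpos : ∀ x, 0 < g x := fun x => by
    rw [hg, ρ.triv_symm_apply]
    exact mul_pos (Real.rpow_pos_of_pos (ρ.pos _) _) (ρ'.pos _)
  refine ⟨⟨fun x => Real.log (g x), fun x =>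
    (Real.contDiffAt_log.mpr (hpos x).ne').comp_contMDiffAt g.contMDiff.contMDiffAt⟩, fun p => ?_⟩
  change _ = _ * Real.exp (Real.log (g _))
  rw [Real.exp_log (hpos _)]
  have := ρ.triv_apply 1 g p
  rwa [hg, LinearEquiv.apply_symm_apply, Real.rpow_one] at this

/-- The function `exp (c l)`. -/
def Fn.exp (l : Fn d M) (c : ℝ) : Fn d M :=
  ⟨fun x => Real.exp (c * l x), Real.contDiff_exp.comp_contMDiff
    ((contDiff_const.mul contDiff_id).comp_contMDiff l.contMDiff)⟩

theorem Fn.exp_mul_exp (l : Fn d M) (a b : ℝ) : l.exp a * l.exp b = l.exp (a + b) := by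
  ext x
  change Real.exp (a * l x) * Real.exp (b * l x) = Real.exp ((a + b) * l x)
  rw [← Real.exp_add, add_mul]

theorem Fn.exp_zero (l : Fn d M) : l.exp 0 = 1 := by
  ext x
  change Real.exp (0 * l x) = 1
  rw [zero_mul, Real.exp_zero]

theorem mulOp_exp_mul (l : Fn d M) (a b : ℝ) :
    mulOp (l.exp a) * mulOp (l.exp b) = mulOp (l.exp (a + b)) := by
  rw [← mulOp_mul, Fn.exp_mul_exp]

/-- Conjugation by e^(cl) expanded to first order in l: the chain rule gives [T, e^(-cl)] = -c
e^(-cl) [T, l] up to order n - 2, and multiplication by e^(cl) gives the claim. -/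
theorem conj_exp_mem {n : ℕ} {T : Module.End ℝ (Fn d M)} (hT : T ∈ algDiffOp (Fn d M) (n + 1))
    (l : Fn d M) (c : ℝ) :
    mulOp (l.exp c) * T * mulOp (l.exp (-c)) - T - c • (mulOp l * T - T * mulOp l)
      ∈ algDiffOp (Fn d M) (n - 1) := by
  have h1 := commutator_chain (g := l.exp (-c)) (l := l) (c := (-c) • l.exp (-c))
    (fun D => derivation_comp_exp (fun x => rfl) D) hT
  have h2 := mul_mem_commFiltration_left (mulOp_mem (l.exp c)) h1
  convert h2 using 1
  have e1 : mulOp (l.exp c) * mulOp (l.exp (-c)) = 1 := by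
    rw [mulOp_exp_mul, add_neg_cancel, Fn.exp_zero]
    ext1 f; exact one_mul f
  have e2 : mulOp ((-c) • l.exp (-c)) = (-c) • mulOp (l.exp (-c)) :=
    map_smul (LinearMap.mul ℝ (Fn d M)) _ _
  rw [e2]
  exact (conj_identity e1 T (mulOp l) c)

end Equivariance

theorem smul_sub_conj_identity {V : Type*} [AddCommGroup V] [Module ℝ V]
    {T T' S S' B B' : V} {α β s t c e : ℝ} (hs : α * s = c) (ht : β * t = -(e * c)) :
    (α • T + β • T') - (α • S + β • S')
      = (-α) • (S - T - s • B) + (-β) • (S' - T' - t • B') - (c • B - (e * c) • B') := by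
  obtain rfl := hs
  rw [← neg_neg (e * _), ← ht]
  module

section ChangeOfVolume

variable {d : ℕ} {M : Type*} [TopologicalSpace M] [ChartedSpace (Euc d) M]
  [IsManifold (𝓡 d) ∞ M] [T2Space M] [SigmaCompactSpace M] {ρ ρ' : VolumeForm d M} {n : ℕ}
  {T T' : Module.End ℝ (Fn d M)} {l : Fn d M}

theorem triv_eq_triv_exp (hl : ∀ p : LocalPoint d M, ρ'.toDensity.1 p
      = ρ.toDensity.1 p * Real.exp (l (p.1.1.symm p.1.2))) (a : ℝ) (f : Fn d M) :
    ρ'.triv a f = ρ.triv a (l.exp a * f) := by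
  refine Subtype.ext (funext fun p => ?_)
  rw [ρ'.triv_apply, ρ.triv_apply, hl, Real.mul_rpow (ρ.pos p).le (Real.exp_pos _).le,
    ← Real.exp_mul, mul_comm (l _), mul_assoc]
  rfl

theorem exp_mul_exp_neg_mul (l f : Fn d M) (a : ℝ) : l.exp a * (l.exp (-a) * f) = f := by
  rw [← mul_assoc, Fn.exp_mul_exp, add_neg_cancel, Fn.exp_zero, one_mul]

theorem exp_neg_mul_exp_mul (l f : Fn d M) (a : ℝ) : l.exp (-a) * (l.exp a * f) = f := by
  rw [← mul_assoc, Fn.exp_mul_exp, neg_add_cancel, Fn.exp_zero, one_mul]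

theorem pencil_eq_pencil_exp (hl : ∀ p : LocalPoint d M, ρ'.toDensity.1 p
      = ρ.toDensity.1 p * Real.exp (l (p.1.1.symm p.1.2)))
    (G : ℝ → Module.End ℝ (Fn d M)) :
    ρ'.pencil G = ρ.pencil fun a => mulOp (l.exp a) * G a * mulOp (l.exp (-a)) :=
  linearMap_ext_triv ρ' fun a f => by
    rw [ρ'.pencil_incl, triv_eq_triv_exp hl, triv_eq_triv_exp hl, ρ.pencil_incl]
    simp only [Module.End.mul_apply, LinearMap.mulLeft_apply, exp_neg_mul_exp_mul]

theorem conj_eq_conj_exp (hl : ∀ p : LocalPoint d M, ρ'.toDensity.1 p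
      = ρ.toDensity.1 p * Real.exp (l (p.1.1.symm p.1.2))) (a : ℝ) :
    (ρ.triv a).conj T = (ρ'.triv a).conj (mulOp (l.exp (-a)) * T * mulOp (l.exp a)) := by
  ext1 s
  obtain ⟨f, rfl⟩ := (ρ'.triv a).surjective s
  rw [LinearEquiv.conj_apply_apply, LinearEquiv.conj_apply_apply, LinearEquiv.symm_apply_apply,
    triv_eq_triv_exp hl, triv_eq_triv_exp hl, LinearEquiv.symm_apply_apply]
  simp only [Module.End.mul_apply, LinearMap.mulLeft_apply, exp_mul_exp_neg_mul]

/-- The exponents of the adjoint are shifted by one because ∫ρ' carries an additional factor e^l. -/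
theorem isFnAdjoint_conj_exp (hl : ∀ p : LocalPoint d M, ρ'.toDensity.1 p
      = ρ.toDensity.1 p * Real.exp (l (p.1.1.symm p.1.2))) (h : IsFnAdjoint ρ T T') (a : ℝ) :
    IsFnAdjoint ρ' (mulOp (l.exp (-a)) * T * mulOp (l.exp a))
      (mulOp (l.exp (a - 1)) * T' * mulOp (l.exp (1 - a))) := fun f g hf hg => by
  have hint : ∀ u, ρ'.int u = ρ.int (l.exp 1 * u) := fun u => by
    rw [VolumeForm.int, triv_eq_triv_exp hl]; rfl
  rw [hint, hint]
  have h1 := h _ _ (hasCompactSupport_mul_right (l.exp a) hf)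
    (hasCompactSupport_mul_right (l.exp (1 - a)) hg)
  convert h1 using 2
  · simp only [Module.End.mul_apply, LinearMap.mulLeft_apply]
    rw [show 1 - a = 1 + -a by ring, ← Fn.exp_mul_exp]
    ring
  · simp only [Module.End.mul_apply, LinearMap.mulLeft_apply]
    have : l.exp a = l.exp 1 * l.exp (a - 1) := by rw [Fn.exp_mul_exp, add_sub_cancel]
    rw [this]
    ring

theorem IsSymbolAdjoint.conj_exp (hl : ∀ p : LocalPoint d M, ρ'.toDensity.1 p
      = ρ.toDensity.1 p * Real.exp (l (p.1.1.symm p.1.2))) (h : IsSymbolAdjoint ρ n T T')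
    (a : ℝ) :
    IsSymbolAdjoint ρ' n (mulOp (l.exp (-a)) * T * mulOp (l.exp a))
      (mulOp (l.exp (a - 1)) * T' * mulOp (l.exp (1 - a))) := by
  have hm : ∀ {S : Module.End ℝ (Fn d M)} (f g : Fn d M), S ∈ algDiffOp (Fn d M) (n + 1) →
      mulOp f * S * mulOp g ∈ algDiffOp (Fn d M) (n + 1) := fun f g hS =>
    mul_mem_commFiltration_right (mul_mem_commFiltration_left (mulOp_mem f) hS) (mulOp_mem g)
  -- The symbol condition is not computed: some adjoint satisfies it, and the adjoint is unique.
  obtain ⟨S, hS⟩ := exists_isSymbolAdjoint ρ' (hm (l.exp (-a)) (l.exp a) h.mem)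
  rwa [hS.adjoint.unique (isFnAdjoint_conj_exp hl h.adjoint a) hS.mem_adjoint
    (hm _ _ h.mem_adjoint)] at hS

/-- Modulo lower order, the distinguished lifting does not depend on the volume form. -/
theorem IsSymbolAdjoint.distinguishedLifting_sub_mem (h : IsSymbolAdjoint ρ n T T')
    (ρ' : VolumeForm d M) (lam : ℝ) :
    distinguishedLifting ρ n lam ((ρ.triv lam).conj T)
      - distinguishedLifting ρ' n lam ((ρ.triv lam).conj T)
        ∈ verticalFiltration d M (n - 1) := by
  obtain ⟨l, hl⟩ := exists_log ρ ρ'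
  rw [h.distinguishedLifting_eq, conj_eq_conj_exp hl, (h.conj_exp hl lam).distinguishedLifting_eq,
    pencil_eq_pencil_exp hl, ← map_sub, ρ.pencil_mem_vertical_iff]
  intro a
  have hE : ∀ (b c : ℝ) (S : Module.End ℝ (Fn d M)),
      mulOp (l.exp a) * (mulOp (l.exp b) * S * mulOp (l.exp c)) * mulOp (l.exp (-a))
        = mulOp (l.exp (a + b)) * S * mulOp (l.exp (c + -a)) := fun b c S => by
    rw [← mulOp_exp_mul, ← mulOp_exp_mul]
    simp only [mul_assoc]
  have h1 := conj_exp_mem h.mem l (a + -lam)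
  have h2 := conj_exp_mem h.mem_adjoint l (a + (lam - 1))
  simp only [Pi.sub_apply, mul_add, add_mul, mul_smul_comm, smul_mul_assoc, hE]
  rw [show lam + -a = -(a + -lam) by ring, show 1 - lam + -a = -(a + (lam - 1)) by ring]
  -- The corrections are (a - λ)[l, T] and (a + λ - 1)[l, T']. With their coefficients (a + λ -
  -- 1)/(2λ - 1) and (-1)^n (λ - a)/(2λ - 1) the products are opposite up to (-1)^n, so the symbols
  -- cancel.
  refine mem_of_eq_of_mem (smul_sub_conj_identity (e := (-1) ^ n)
    (c := (a + lam - 1) / (2 * lam - 1) * (a + -lam)) rfl ?_)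
    (sub_mem (add_mem (Submodule.smul_mem _ _ h1) (Submodule.smul_mem _ _ h2))
      (h.commutator_mem l _))
  ring

end ChangeOfVolume

/-! ### Detecting orders by powers of functions that vanish at a point -/

section Uniqueness

variable {A : Type*} [CommRing A] [Algebra ℝ A] (ev : A →ₐ[ℝ] ℝ)

/-- Differential operators kill high powers of functions that vanish at a point. -/
theorem eval_apply_pow_mul_eq_zero {v : A} (hv : ev v = 0) {k : ℕ} {S : Module.End ℝ A}
    (hS : S ∈ algDiffOp A k) (w : A) : ev (S (v ^ k * w)) = 0 := by
  induction k generalizing S with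
  | zero => rw [mem_commFiltration_zero.mp hS]; exact map_zero ev
  | succ k ih =>
    have h := ih (mem_algDiffOp_succ.mp hS v)
    have e : S (v ^ (k + 1) * w)
        = (S * mulOp v - mulOp v * S) (v ^ k * w) + v * S (v ^ k * w) := by
      change _ = S (v * (v ^ k * w)) - v * S (v ^ k * w) + v * S (v ^ k * w)
      rw [sub_add_cancel]
      congr 1; ring
    rw [e, map_add, h, map_mul, hv, zero_mul, zero_add]

/-- Where v = 0 only those terms survive in which each of the n derivatives falls on its own factor
v; there are n! of them. -/
theorem eval_derivation_pow_apply {v : A} (hv : ev v = 0) (X : Derivation ℝ A A) (n : ℕ) (w : A) :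
    ev (((X : A →ₗ[ℝ] A) ^ n) (v ^ n * w)) = n.factorial * ev (X v) ^ n * ev w := by
  induction n generalizing w with
  | zero => simp
  | succ n ih =>
    have e : X (v ^ (n + 1) * w) = v ^ n * (((n : A) + 1) * X v * w + v * X w) := by
      rw [Derivation.leibniz, Derivation.leibniz_pow]
      simp only [smul_eq_mul, nsmul_eq_mul, Nat.add_sub_cancel, Nat.cast_add, Nat.cast_one]
      ring
    rw [pow_succ, Module.End.mul_apply]
    change ev (((X : A →ₗ[ℝ] A) ^ n) (X (v ^ (n + 1) * w))) = _
    rw [e, ih]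
    simp only [map_add, map_mul, map_natCast, map_one, hv, zero_mul, add_zero,
      Nat.factorial_succ, Nat.cast_mul, Nat.cast_add, Nat.cast_one]
    ring

/-- Put v = f - f(p). An operator of order n - 2 kills v^(n-1) at p, whereas [f, X^n] = [v, X^n]
sends it to -n! (X f(p))^n there. -/
theorem eval_derivation_eq_zero {X : Derivation ℝ A A} {f : A} {n : ℕ} (hn : 1 ≤ n)
    (h : mulOp f * (X : A →ₗ[ℝ] A) ^ n - (X : A →ₗ[ℝ] A) ^ n * mulOp f ∈ algDiffOp A (n - 1)) :
    ev (X f) = 0 := by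
  obtain ⟨n, rfl⟩ := Nat.exists_eq_add_of_le' hn
  set v : A := f - algebraMap ℝ A (ev f) with hv
  have hv0 : ev v = 0 := by
    rw [hv, map_sub, AlgHom.commutes, Algebra.algebraMap_self_apply, sub_self]
  have h1 := eval_apply_pow_mul_eq_zero ev hv0 h 1
  rw [Nat.add_sub_cancel] at h1
  have h2 : (mulOp f * (X : A →ₗ[ℝ] A) ^ (n + 1) - (X : A →ₗ[ℝ] A) ^ (n + 1) * mulOp f)
      (v ^ n * 1) = v * ((X : A →ₗ[ℝ] A) ^ (n + 1)) (v ^ n)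
        - ((X : A →ₗ[ℝ] A) ^ (n + 1)) (v ^ (n + 1) * 1) := by
    have hf : f = v + algebraMap ℝ A (ev f) := by rw [hv, sub_add_cancel]
    change f * ((X : A →ₗ[ℝ] A) ^ (n + 1)) (v ^ n * 1)
      - ((X : A →ₗ[ℝ] A) ^ (n + 1)) (f * (v ^ n * 1)) = _
    rw [mul_one, mul_one, pow_succ v, mul_comm (v ^ n) v]
    conv_lhs => rw [hf]
    rw [add_mul, add_mul, map_add, ← Algebra.smul_def, ← Algebra.smul_def, map_smul]
    abel
  rw [h2, map_sub, map_mul, hv0, zero_mul, zero_sub, neg_eq_zero,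
    eval_derivation_pow_apply ev hv0, map_one, mul_one] at h1
  have h3 : ev (X v) = 0 := by
    refine (pow_eq_zero_iff (Nat.succ_ne_zero n)).mp ((mul_eq_zero.mp h1).resolve_left ?_)
    exact_mod_cast Nat.factorial_ne_zero _
  rwa [hv, map_sub, Derivation.map_algebraMap, sub_zero] at h3

end Uniqueness

/-! ### A vector field whose divergence detects the symbol -/

section Test

variable {d : ℕ} {M : Type*} [TopologicalSpace M] [ChartedSpace (Euc d) M]
  [IsManifold (𝓡 d) ∞ M]

/-- Multiplication of a vector field by a function. -/
def fnSMul (f : Fn d M) (K : VectorField d M) : VectorField d M :=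
  ⟨(f : M → ℝ) • fun x => K x, f.contMDiff.smul_section K.contMDiff⟩

theorem vfDeriv_fnSMul (f : Fn d M) (K : VectorField d M) (g : Fn d M) :
    vfDeriv (fnSMul f K) g = f * vfDeriv K g := by
  ext x
  have hφ := (basePoint d x).2.1
  have hy := (basePoint d x).2.2
  rw [Fn.mul_apply, ← basePoint_symm (d := d) x, vfDeriv_symm_apply _ _ hφ hy,
    vfDeriv_symm_apply _ _ hφ hy]
  refine (congrArg (fderiv ℝ (g ∘ (basePoint d x).1.1.symm) (basePoint d x).1.2) ?_).trans
    (map_smul _ (f ((basePoint d x).1.1.symm (basePoint d x).1.2)) _)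
  exact (mfderiv (𝓡 d) (𝓡 d) (basePoint d x).1.1
    ((basePoint d x).1.1.symm (basePoint d x).1.2)).map_smul _ _

variable [T2Space M] [SigmaCompactSpace M]

/-- The adjoint of f K is K^† ∘ f; uniqueness of the adjoint and evaluation at 1 give the formula
without coordinates. -/
theorem div_fnSMul (ρ : VolumeForm d M) (f : Fn d M) (K : VectorField d M) :
    ρ.div (fnSMul f K) = f * ρ.div K + vfDeriv K f := by
  have hd := fun K : VectorField d M => sub_mem
    (neg_mem (derivation_mem (vfDeriv K))) (commFiltration_le_succ 1 (mulOp_mem (ρ.div K)))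
  have h1 := IsFnAdjoint.vfDeriv (ρ := ρ) (fnSMul f K)
  have h2 := (IsFnAdjoint.mulOp (ρ := ρ) f).mul (IsFnAdjoint.vfDeriv (ρ := ρ) K)
    (derivation_mem (vfDeriv K)) (mulOp_mem f)
  have e : (vfDeriv (fnSMul f K) : Fn d M →ₗ[ℝ] Fn d M)
      = mulOp f * (vfDeriv K : Fn d M →ₗ[ℝ] Fn d M) :=
    LinearMap.ext fun g => vfDeriv_fnSMul f K g
  rw [e] at h1
  have h3 := LinearMap.congr_fun (h1.unique h2 (by rw [← e]; exact hd _)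
    (mul_mem_commFiltration_right (hd K) (mulOp_mem f))) 1
  have h4 : -(f * vfDeriv K 1) - ρ.div (fnSMul f K) * 1
      = -vfDeriv K (f * 1) - ρ.div K * (f * 1) := h3
  rw [Derivation.map_one_eq_zero, mul_zero, neg_zero, zero_sub, mul_one, mul_one] at h4
  rw [← neg_inj, h4]
  ring

/-- On a manifold of positive dimension the divergence does not commute with differential operators
modulo lower order. -/
theorem exists_commutator_div_notMem (ρ : VolumeForm d M) (hd : 0 < d) (p : M) {n : ℕ}
    (hn : 1 ≤ n) : ∃ (K : VectorField d M), ∃ T ∈ algDiffOp (Fn d M) (n + 1),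
      mulOp (ρ.div K) * T - T * mulOp (ρ.div K) ∉ algDiffOp (Fn d M) (n - 1) := by
  have hφ : chartAt (Euc d) p ∈ maximalAtlas (𝓡 d) ∞ M := chart_mem_maximalAtlas p
  obtain ⟨η, hη1, hη, -, -⟩ := exists_bump_at (d := d)
    ((chartAt (Euc d) p).open_source.mem_nhds (mem_chart_source (Euc d) p))
  have hKu := vfDeriv_chartField_cutoffPull hφ hη hη1 (⟨0, hd⟩ : Fin d) ⟨0, hd⟩
  rw [if_pos rfl] at hKu
  set K := chartField η _ hφ hη
    (fun _ => EuclideanSpace.single (⟨0, hd⟩ : Fin d) 1) contDiffOn_const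
  set u := cutoffPull η _ hφ hη (fun y => y (⟨0, hd⟩ : Fin d)) (by fun_prop)
  let ev : Fn d M →ₐ[ℝ] ℝ :=
    { toFun := fun f => f p
      map_one' := rfl
      map_mul' := fun _ _ => rfl
      map_zero' := rfl
      map_add' := fun _ _ => rfl
      commutes' := fun _ => rfl }
  set v : Fn d M := u - algebraMap ℝ (Fn d M) (u p) with hv
  have hvp : ev v = 0 := sub_self (u p)
  have hKv : ev (vfDeriv K v) = 1 := by
    rw [hv, map_sub, Derivation.map_algebraMap, sub_zero]; exact hKu
  -- Here v(p) = 0 and K v(p) = 1, so div(v² K) = v² div K + 2 v K v has derivative 2 along K at p.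
  -- The operator is K^n.
  refine ⟨fnSMul (v * v) K, _, derivation_pow_mem (vfDeriv K) n, fun h => ?_⟩
  have h1 := eval_derivation_eq_zero ev hn h
  rw [div_fnSMul] at h1
  simp only [map_add, Derivation.leibniz, smul_eq_mul, map_mul, hvp, hKv] at h1
  norm_num at h1

/-- In dimension zero all differential operators have order zero. -/
theorem algDiffOp_le_one (h : d = 0 ∨ IsEmpty M) (k : ℕ) :
    algDiffOp (Fn d M) k ≤ algDiffOp (Fn d M) 1 := by
  intro T hT
  have e : T = mulOp (T 1) := by
    ext f p
    rcases h with rfl | h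
    · have h1 := apply_congr_of_eventuallyEq hT (f := f) (g := f p • (1 : Fn 0 M)) (p := p) (by
        filter_upwards [(chartAt (Euc 0) p).open_source.mem_nhds (mem_chart_source (Euc 0) p)]
          with z hz
        -- The model space is a single point, so the chart domain is {p} and every function is
        -- locally constant.
        have : z = p := (chartAt (Euc 0) p).injOn hz (mem_chart_source (Euc 0) p)
          (Subsingleton.elim _ _)
        rw [this]
        exact (mul_one (f p)).symm)
      rw [h1, map_smul]
      exact mul_comm _ _
    · exact h.elim p
  rw [e]
  exact mulOp_mem _

end Test

theorem symbol_defect_identity {V : Type*} [AddCommGroup V] [Module ℝ V] {B B' W : V}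
    {α β e c : ℝ} (he : e * e = 1) (hc : α + e * β = c) :
    c • B = (α • B + β • B' + W) - W + (e * β) • (B - e • B') := by
  subst hc
  rw [smul_sub, smul_smul, mul_right_comm, he, one_mul]
  module

/-! ### Uniqueness of the induced equivariant map -/

section UniqueLifting

variable {d : ℕ} {M : Type*} [TopologicalSpace M] [ChartedSpace (Euc d) M]
  [IsManifold (𝓡 d) ∞ M] [T2Space M] [SigmaCompactSpace M] {ρ : VolumeForm d M} {n : ℕ} {lam b : ℝ}
  {c e : Fin n → ℝ}

/-- This is where n ≥ 2 enters: multiplications have order 0 ≤ n - 2, so the parameters c and e are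
invisible in the quotient. -/
theorem smul_mulOp_mem (hn : 2 ≤ n) (r s : ℝ) (f g : Fn d M) :
    r • mulOp f + s • mulOp g ∈ algDiffOp (Fn d M) (n - 1) :=
  commFiltration_mono (by omega : 1 ≤ n - 1)
    (add_mem (Submodule.smul_mem _ _ (mulOp_mem f)) (Submodule.smul_mem _ _ (mulOp_mem g)))

/-- For an equivariant member of the family, either the coefficient is that of the distinguished
lifting or all differential operators commute with divergences up to lower order. -/
theorem commutator_div_mem_of_equivariant (hn : 2 ≤ n)
    (h : IsDiffEquivariantModulo n lam (verticalFiltration d M (n - 1))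
      (familyLifting ρ n lam b c e)) (hb : 1 - b * (1 - 2 * lam) ≠ 0) (K : VectorField d M)
    {T : Module.End ℝ (Fn d M)} (hT : T ∈ algDiffOp (Fn d M) (n + 1)) :
    mulOp (ρ.div K) * T - T * mulOp (ρ.div K) ∈ algDiffOp (Fn d M) (n - 1) := by
  obtain ⟨T', hS⟩ := exists_isSymbolAdjoint ρ hT
  have h1 := h K _ ((mem_diffOp_iff ρ n lam T).mpr hT)
  rw [hS.adAlgebra_familyLifting_sub, ρ.pencil_mem_vertical_iff] at h1
  -- At a = λ + 1 the factor a - λ is 1, and the symbols of the two brackets combine with total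
  -- coefficient 1 - b(1 - 2λ), assumed nonzero.
  have h2 := h1 (lam + 1)
  rw [add_assoc] at h2
  have h3 := commutator_mulOp_mem hS.symbol (ρ.div K)
  refine (Submodule.smul_mem_iff _ hb).mp ?_
  have hs : ((-1 : ℝ) ^ n) * (-1) ^ n = 1 := by rw [← mul_pow]; norm_num
  refine mem_of_eq_of_mem (symbol_defect_identity hs ?_) (add_mem (sub_mem h2
    (smul_mulOp_mem hn _ _ _ _)) (Submodule.smul_mem _ _ (mem_of_eq_of_mem ?_ h3)))
  · rw [← mul_assoc, ← mul_assoc, hs]; ring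
  · have := smul_commutator_sub_smul_commutator (mulOp (ρ.div K)) T T' 1 ((-1) ^ n)
    rwa [mul_one, one_smul, one_smul] at this

theorem familyLifting_sub_distinguishedLifting_mem (hlam : lam ≠ 1 / 2) (hn : 2 ≤ n)
    (h : IsDiffEquivariantModulo n lam (verticalFiltration d M (n - 1))
      (familyLifting ρ n lam b c e)) {T T' : Module.End ℝ (Fn d M)}
    (hT : IsSymbolAdjoint ρ n T T') :
    familyLifting ρ n lam b c e ((ρ.triv lam).conj T)
      - distinguishedLifting ρ n lam ((ρ.triv lam).conj T)
        ∈ verticalFiltration d M (n - 1) := by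
  have hx : 1 - 2 * lam ≠ 0 := fun h => hlam (by linarith)
  rw [hT.distinguishedLifting_eq_familyLifting lam hlam, hT.familyLifting_eq, hT.familyLifting_eq,
    ← map_sub, ρ.pencil_mem_vertical_iff]
  intro a
  rw [Pi.sub_apply]
  by_cases hb : 1 - b * (1 - 2 * lam) = 0
  · have hb' : b = 1 / (1 - 2 * lam) := by
      rw [eq_div_iff hx]; linarith
    rw [← hb']
    have h0 := smul_mulOp_mem hn (∑ k : Fin n, c k * (a - lam) ^ (k.val + 1))
      (∑ k : Fin n, e k * (a - lam) ^ (k.val + 1)) (T 1) (T' 1)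
    refine mem_of_eq_of_mem ?_ h0
    simp only [Pi.zero_apply, zero_mul, Finset.sum_const_zero, zero_smul, add_zero]
    abel
  -- The other values of b survive only in the degenerate case, where both liftings have order zero
  -- and hence already lie in the subspace by which one divides.
  · have hzero : d = 0 ∨ IsEmpty M := by
      by_contra! hne
      obtain ⟨hd, ⟨p⟩⟩ := hne
      obtain ⟨K, S, hS, hS'⟩ := exists_commutator_div_notMem ρ (Nat.pos_of_ne_zero hd) p
        (show 1 ≤ n by omega)
      exact hS' (commutator_div_mem_of_equivariant hn h hb K hS)
    refine commFiltration_mono (by omega : 1 ≤ n - 1) (algDiffOp_le_one hzero (n + 1) ?_)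
    have hm : ∀ f : Fn d M, mulOp f ∈ algDiffOp (Fn d M) (n + 1) := fun f =>
      commFiltration_mono (by omega) (mulOp_mem f)
    have key : ∀ r s t u : ℝ, r • T + s • T' + t • mulOp (T 1) + u • mulOp (T' 1)
        ∈ algDiffOp (Fn d M) (n + 1) := fun r s t u =>
      add_mem (add_mem (add_mem (Submodule.smul_mem _ _ hT.mem)
        (Submodule.smul_mem _ _ hT.mem_adjoint)) (Submodule.smul_mem _ _ (hm _)))
        (Submodule.smul_mem _ _ (hm _))
    exact sub_mem (key _ _ _ _) (key _ _ _ _)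

end UniqueLifting

end PencilLifting

end

theorem mainTheorem3 {d : ℕ} {M : Type*} [TopologicalSpace M] [ChartedSpace (Euc d) M]
    [IsManifold (𝓡 d) ∞ M] [T2Space M] [SigmaCompactSpace M]
    (n : ℕ) (lam : ℝ) (hlam : lam ≠ 1 / 2) :
    -- for each volume form: the family of liftings and its distinguished member
    (∀ ρ : VolumeForm d M,
      (∀ Δ ∈ DiffOp d M n lam, ∃! D', IsAdjoint (volumeLifting ρ lam Δ) D') ∧
      (∀ (b : ℝ) (c e : Fin n → ℝ),
        IsRegularPencilLifting n lam (familyLifting ρ n lam b c e) ∧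
        IsEquivariant n lam (divergenceless ρ) (familyLifting ρ n lam b c e)) ∧
      (∀ Δ ∈ DiffOp d M n lam,
        distinguishedLifting ρ n lam Δ = familyLifting ρ n lam (1 / (1 - 2 * lam)) 0 0 Δ) ∧
      (∀ Δ ∈ DiffOp d M n lam,
        IsAdjoint (distinguishedLifting ρ n lam Δ)
          ((-1 : ℝ) ^ n • distinguishedLifting ρ n lam Δ))) ∧
    -- independence of the volume form modulo `V^(n-2)`
    (∀ ρ ρ' : VolumeForm d M, ∀ Δ ∈ DiffOp d M n lam,
      distinguishedLifting ρ n lam Δ - distinguishedLifting ρ' n lam Δ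
        ∈ verticalFiltration d M (n - 1)) ∧
    -- equivariance of the induced map
    (∀ ρ : VolumeForm d M,
      IsDiffEquivariantModulo n lam (verticalFiltration d M (n - 1))
        (distinguishedLifting ρ n lam)) ∧
    -- uniqueness of the induced map
    (2 ≤ n → ∀ (ρ : VolumeForm d M) (b : ℝ) (c e : Fin n → ℝ),
      IsDiffEquivariantModulo n lam (verticalFiltration d M (n - 1))
        (familyLifting ρ n lam b c e) →
      ∀ Δ ∈ DiffOp d M n lam,
        familyLifting ρ n lam b c e Δ - distinguishedLifting ρ n lam Δ
          ∈ verticalFiltration d M (n - 1)) := by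
  refine ⟨fun ρ => ⟨fun Δ hΔ => ?_, fun b c e => ⟨fun Δ hΔ => ?_, fun K hK Δ hΔ => ?_⟩,
    fun Δ hΔ => ?_, fun Δ hΔ => ?_⟩, fun ρ ρ' Δ hΔ => ?_, fun ρ K Δ hΔ => ?_,
    fun hn ρ b c e h Δ hΔ => ?_⟩ <;>
  obtain ⟨T, T', rfl, hT⟩ := exists_conj_isSymbolAdjoint ρ hΔ
  · rw [ρ.volumeLifting_eq_pencil]
    exact ⟨_, hT.isAdjoint, fun D hD => ρ.isAdjoint_unique hD hT.isAdjoint⟩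
  · exact ⟨hT.isDiffOpAlg_familyLifting lam b c e, hT.familyLifting_incl lam b c e⟩
  · exact hT.familyLifting_equivariant lam b c e hK
  · exact hT.distinguishedLifting_eq_familyLifting lam hlam
  · exact hT.isAdjoint_distinguishedLifting lam hlam
  · exact hT.distinguishedLifting_sub_mem ρ' lam
  · exact hT.adAlgebra_distinguishedLifting_sub_mem lam hlam K
  · exact familyLifting_sub_distinguishedLifting_mem hlam hn h hT
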